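/- Let $F$ be an algebraically closed field, let $2\le m\le n$, and let $R=F[x_{i,j},y_{i,j} : 1\le i\le m,\ 1\le j\le n]$ with its standard grading. Let $Y\subseteq F^{2mn}$ be the Zariski closure of the set of pairs $(A,B)$ such that $A$ is a nonsingular point of the variety of $m\times n$ matrices of rank at most $1$ and $B$ is a tangent vector to this variety at $A$ (the principal component of the first-order jet scheme of this variety), and let $J\subseteq R$ be the ideal of $Y$. Then $J$ is homogeneous and the multiplicity of $R/J$ (that is, $(\deg P)!$ times the leading coefficient of $P$, where $P$ is the Hilbert polynomial of $R/J$) is $$\sum_{\substack{1\le i\le m,\ 1\le j\le n\\ (i,j)\neq(m,n)}}\binom{m+n-i-j}{m-i}\det\begin{pmatrix}\binom{i+n-2}{i-1}&\binom{m+j-2}{m-1}\\[2pt] \binom{i+n-3}{i-2}&\binom{m+j-3}{m-2}\end{pmatrix},$$ where a binomial coefficient with negative lower entry is $0$. Moreover, let $LT(J)$ be the leading term ideal of $J$ for the graded reverse lexicographical order with $y_{1,1}>y_{1,2}>\dots>y_{1,n}>y_{2,1}>\dots>y_{m,n}>x_{1,1}>x_{1,2}>\dots>x_{1,n}>x_{2,1}>\dots>x_{m,n}$,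 and let $\Delta$ be the simplicial complex on the set of all variables whose faces are the sets of variables whose product is not in $LT(J)$. Then for each $(i,j)\ne(m,n)$ the summand with index $(i,j)$ is the number of facets $S$ of $\Delta$ with $\mu(S)=x_{i,j}$, that is, with $x_{i,j}\in S$ and with $i\le c$, $j\le d$ for all $x_{c,d}\in S$. -/

import Mathlib

noncomputable section

namespace JetDet

open MvPolynomial

/-! ### Tangent spaces and nonsingular points of affine varieties -/

section Tangent

variable {F : Type*} [Field F] {ι : Type*} [Fintype ι]

/-- The Zariski tangent space at `p` of the affine variety `V ⊆ F^ι`: the vectors killed by the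
differentials at `p` of all polynomials vanishing on `V`. -/
def tangentSpace (V : Set (ι → F)) (p : ι → F) : Submodule F (ι → F) where
  carrier := {v | ∀ f ∈ vanishingIdeal F V, ∑ i, eval p (pderiv i f) * v i = 0}
  zero_mem' := by
    intro f _
    simp
  add_mem' := by
    intro v w hv hw f hf
    simp only [Pi.add_apply, mul_add, Finset.sum_add_distrib, hv f hf, hw f hf, add_zero]
  smul_mem' := by
    intro c v hv f hf
    have h : ∀ i, eval p (pderiv i f) * (c • v) i = c * (eval p (pderiv i f) * v i) := by
      intro i
      simp only [Pi.smul_apply, smul_eq_mul]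
      ring
    simp only [h, ← Finset.mul_sum, hv f hf, mul_zero]

/-- Nonsingular points of an irreducible affine variety `V`: the points of `V` at which the
dimension of the Zariski tangent space is the dimension of `V` (the Krull dimension of its
coordinate ring). This is the Jacobian criterion definition. -/
def IsNonsingularPoint (V : Set (ι → F)) (p : ι → F) : Prop :=
  p ∈ V ∧ (Module.finrank F (tangentSpace V p) : WithBot ℕ∞) =
    ringKrullDim (MvPolynomial ι F ⧸ vanishingIdeal F V)

end Tangent

/-! ### The principal component of the first-order jet scheme -/

/-- The variables of `R = F[x_{i,j}, y_{i,j}]`: `Sum.inl (i, j)` is `x_{i,j}` and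
`Sum.inr (i, j)` is `y_{i,j}`. -/
abbrev Var (m n : ℕ) : Type := (Fin m × Fin n) ⊕ (Fin m × Fin n)

/-- The determinantal variety of `m × n` matrices of rank at most `1`. It is irreducible. -/
def detVariety (F : Type*) [Field F] (m n : ℕ) : Set (Fin m × Fin n → F) :=
  {A | (Matrix.of fun i j => A (i, j)).rank ≤ 1}

/-- The set of tangents at the nonsingular points of the determinantal variety: the points
`(A, B)`, with `x`-coordinates `A` and `y`-coordinates `B`, such that `A` is a nonsingular point
and `B` is a tangent vector at `A`. -/
def smoothTangents (F : Type*) [Field F] (m n : ℕ) : Set (Var m n → F) :=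
  {P | IsNonsingularPoint (detVariety F m n) (fun a => P (Sum.inl a)) ∧
    (fun a => P (Sum.inr a)) ∈ tangentSpace (detVariety F m n) (fun a => P (Sum.inl a))}

/-- The principal component `Y`: the Zariski closure of the set of tangents at the nonsingular
points of the determinantal variety. -/
def principalComponent (F : Type*) [Field F] (m n : ℕ) : Set (Var m n → F) :=
  zeroLocus F (vanishingIdeal F (smoothTangents F m n))

/-- The ideal `J` of the principal component `Y`. -/
def principalIdeal (F : Type*) [Field F] (m n : ℕ) : Ideal (MvPolynomial (Var m n) F) :=
  vanishingIdeal F (principalComponent F m n)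

/-! ### Multiplicity of a standard graded algebra -/

section Multiplicity

variable {F : Type*} [Field F] {σ : Type*}

/-- The Hilbert function `k ↦ dim_F (R / J)_k` of `R / J`, where `R` is the polynomial ring with
its standard grading; `(R / J)_k` is the image of the space of forms of degree `k`. -/
def hilbertFunction (J : Ideal (MvPolynomial σ F)) (k : ℕ) : ℕ :=
  Module.finrank F
    ((homogeneousSubmodule σ F k).map (Ideal.Quotient.mkₐ F J).toLinearMap)

/-- `HasMultiplicity J e`: the ideal `J` is homogeneous, and the standard graded algebra `R / J`
has multiplicity `e`. That is, its Hilbert function agrees for all large `k` with a polynomial `P`,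
and `e` is `(deg P)!` times the leading coefficient of `P` if `P ≠ 0`, and the length of `R / J` if
`P = 0` (the case of dimension zero). -/
def HasMultiplicity (J : Ideal (MvPolynomial σ F)) (e : ℚ) : Prop :=
  (∀ f ∈ J, ∀ k : ℕ, homogeneousComponent k f ∈ J) ∧
  ∃ P : Polynomial ℚ,
    (∀ᶠ k : ℕ in Filter.atTop, (hilbertFunction J k : ℚ) = P.eval (k : ℚ)) ∧
    ((P ≠ 0 ∧ e = (P.natDegree.factorial : ℚ) * P.leadingCoeff) ∨
      (P = 0 ∧ e = (Module.finrank F (MvPolynomial σ F ⧸ J) : ℚ)))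

end Multiplicity

/-! ### The initial complex -/

/-- Position of a variable in the list
`y_{1,1}, …, y_{1,n}, y_{2,1}, …, y_{m,n}, x_{1,1}, …, x_{1,n}, x_{2,1}, …, x_{m,n}`,
which lists the variables from the largest to the smallest. -/
def varPos {m n : ℕ} : Var m n → ℕ
  | Sum.inr (i, j) => (i : ℕ) * n + j
  | Sum.inl (i, j) => m * n + ((i : ℕ) * n + j)

/-- The strict graded reverse lexicographical order on (exponents of) monomials. -/
def GrevlexLT {m n : ℕ} (a b : Var m n →₀ ℕ) : Prop :=
  a.degree < b.degree ∨
    (a.degree = b.degree ∧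
      ∃ v, b v < a v ∧ ∀ w, varPos v < varPos w → a w = b w)

/-- `x^a` is the leading monomial of `f`. -/
def IsLeadingMonomial {F : Type*} [Field F] {m n : ℕ} (f : MvPolynomial (Var m n) F)
    (a : Var m n →₀ ℕ) : Prop :=
  a ∈ f.support ∧ ∀ b ∈ f.support, b ≠ a → GrevlexLT b a

/-- The leading term ideal `LT(J)`. -/
def leadingIdeal {F : Type*} [Field F] {m n : ℕ} (J : Ideal (MvPolynomial (Var m n) F)) :
    Ideal (MvPolynomial (Var m n) F) :=
  Ideal.span {g | ∃ f ∈ J, ∃ a, IsLeadingMonomial f a ∧ g = monomial a 1}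

/-- `S` is a face of the complex `Δ_L`: the squarefree monomial with support `S` is
not in `L`. -/
def IsFace {F : Type*} [Field F] {σ : Type*} (L : Ideal (MvPolynomial σ F)) (S : Finset σ) :
    Prop :=
  (∏ v ∈ S, (X v : MvPolynomial σ F)) ∉ L

/-- A facet is a face that is maximal with respect to inclusion. -/
def IsFacet {F : Type*} [Field F] {σ : Type*} (L : Ideal (MvPolynomial σ F)) (S : Finset σ) :
    Prop :=
  Maximal (IsFace L) S

/-- `μ(S) = x_{i,j}` for `p = (i, j)`: the vertex `x_{i,j}` is in `S`, and `i ≤ c`, `j ≤ d` for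
all `x_{c,d}` in `S`. -/
def HasMu {m n : ℕ} (S : Finset (Var m n)) (p : Fin m × Fin n) : Prop :=
  IsLeast {q : Fin m × Fin n | Sum.inl q ∈ S} p

/-! ### The summand -/

/-- The binomial coefficient with integer entries and nonnegative upper entry, equal to `0` when the
lower entry is negative. -/
def binom (a b : ℤ) : ℤ :=
  if b < 0 then 0 else (a.toNat.choose b.toNat : ℤ)

/-- The summand for the index `(i, j)`, with `1 ≤ i ≤ m` and `1 ≤ j ≤ n`. -/
def summand (m n i j : ℤ) : ℤ :=
  binom (m + n - i - j) (m - i) *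
    Matrix.det !![binom (i + n - 2) (i - 1), binom (m + j - 2) (m - 1);
                  binom (i + n - 3) (i - 2), binom (m + j - 3) (m - 2)]

end JetDet

end

/-!
Both claims come from one computation of the initial ideal of `J`. By `mem_principalIdeal_iff`, `J`
consists of the polynomials that vanish at all pairs `(u vᵀ, a vᵀ + u bᵀ)` with `u ≠ 0` and `v ≠ 0`:
a matrix of rank at most one is a nonsingular point of the determinantal variety exactly if it is
not zero, since the dimension `m + n - 1` of the variety (Noether normalization and transcendence
degree) is the dimension of the tangent space at such a matrix only. So `J` contains the two by two
minors of `(x)`, their derivatives, and the three by three minors of the two matrices obtained by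
putting `(x)` below `(y)` and to the right of `(y)`. Call a set of variables standard
(`Standard`) if it does not contain the support of the leading monomial of one of these. The main
point is that the initial ideal of `J` is generated by these leading monomials, so that the initial
complex consists of the standard sets. A direct argument in the style of Buchberger is avoided;
two counts are compared instead.

From above: in a standard set `S` with `μ(S) = x_{i,j}` the `x`-part is a chain that starts at
`(i, j)` and the `y`-part lies on a pair of lattice paths that end in the last column of row `i` and
in the last row of column `j`. Removing the last step of one of the paths shows by induction that a
family of at most `pairDet` sets of the expected size covers all possible `y`-parts (`pairCover`),
and the product of this determinant with the number of paths from `(i, j)` to `(m, n)` is the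
summand (`summand_eq`). Telescoping, the sum of all the summands is `e ^ 2` with
`e = (m + n - 2).choose (m - 1)` (`sum_summand`).

From below: let `K` be the kernel of `segreMap`, the ideal of the pairs `(A, B)` for which `A` and
`A + B` have rank at most one. In the coordinates `x` and `x + y` this is a product of two cones
over Segre varieties of degree `e`, so the Hilbert function of the quotient by `K` grows at least
like the count of `e ^ 2` facets. Up to terms of lower degree in `x`, `K` contains the generators of
`J` listed above, hence its leading monomials, for an order that compares the degrees in `x` before
the reverse lexicographic rule, include all nonstandard ones. The two bounds agree. Therefore all
members of the covering families are facets, their numbers are the summands (`exists_facets`), and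
`K` has no standard leading monomial (`not_isLead_of_standard`), as such a monomial would make the
Hilbert function too small.

It remains to return to `J`, which is the limit of `K` under scaling of `y` up to powers of
`x_{m,n}`. If `f ∈ J` is bihomogeneous, then modulo the minors of `(x)` and their derivatives some
product of `f` and a power of `x_{m,n}` is a polynomial in the variables in the last row and
column; these take arbitrary values on the pairs above, so the product lies in the ideal
generated by the minors and their derivatives (`exists_pow_mul_mem_jetIdeal`). The elements of that
ideal lift to `K` by adding terms of lower degree in `x` (`exists_mem_segreIdeal`). As `x_{m,n}` is
a cone point of the complex of standard sets, a standard leading monomial of `f` would yield one for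
`K` (`not_isLead_principalIdeal`). The multiplicity is then the number `e ^ 2` of the facets of the
initial complex, all of which have the same size.
-/

noncomputable section

namespace JetDet

open MvPolynomial

/-! ### Lattice paths and pairs of disjoint lattice paths -/

/-- The number of lattice paths from `(1, 0)` to `(r, c)` with steps `(1, 0)` and `(0, 1)`. -/
def lowerPaths : ℕ → ℕ → ℕ
  | 0, _ => 0
  | r + 1, c => (r + c).choose c

/-- The Lindström–Gessel–Viennot determinant for pairs of disjoint lattice paths, one from `(0, 1)`
to `(r₁, c₁)` and one from `(1, 0)` to `(r₂, c₂)`. -/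
def pairDet (r₁ c₁ r₂ c₂ : ℕ) : ℤ :=
  lowerPaths c₁ r₁ * lowerPaths r₂ c₂ - lowerPaths c₂ r₂ * lowerPaths r₁ c₁

/-- The condition on the `y`-part `T` of a face that will put it below a pair of disjoint
lattice paths ending at `(r₁, c₁)` and at `(r₂, c₂)`, where `r₁ ≤ r₂` and `c₂ ≤ c₁`. It says that
`T` lies in the rectangle with corners `(0, 0)` and `(r₂, c₁)` and that, after the two points
`(r₁, c₁ + 1)` and `(r₂ + 1, c₂)` are added to it, it has no three points each of which lies
strictly below and strictly to the left of the one before. -/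
structure WidthTwo (r₁ c₁ r₂ c₂ : ℕ) (T : Finset (ℕ × ℕ)) : Prop where
  region : ∀ p ∈ T, (p.1 ≤ r₁ ∧ p.2 ≤ c₁) ∨ (p.1 ≤ r₂ ∧ p.2 ≤ c₂)
  right : ∀ p ∈ T, ∀ q ∈ T, p.1 < q.1 → q.2 < p.2 → q.2 ≤ c₂
  lower : ∀ p ∈ T, ∀ q ∈ T, p.1 < q.1 → q.2 < p.2 → p.1 ≤ r₁
  three : ∀ p ∈ T, ∀ q ∈ T, ∀ s ∈ T, p.1 < q.1 → q.2 < p.2 → q.1 < s.1 → ¬ s.2 < q.2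

/-- A family of at most `pairDet r₁ c₁ r₂ c₂` sets, each of size at most that of a pair of disjoint
paths, such that every set satisfying `WidthTwo` is contained in a member of the family. -/
def PairCover (r₁ c₁ r₂ c₂ : ℕ) : Prop :=
  ∃ Q : Finset (Finset (ℕ × ℕ)), (Q.card : ℤ) ≤ pairDet r₁ c₁ r₂ c₂ ∧
    (∀ M ∈ Q, M.card ≤ r₁ + c₁ + r₂ + c₂ + 1) ∧
    ∀ T, WidthTwo r₁ c₁ r₂ c₂ T → ∃ M ∈ Q, T ⊆ M

lemma lowerPaths_rec (r c : ℕ) : lowerPaths (r + 1) (c + 1) =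
    lowerPaths r (c + 1) + lowerPaths (r + 1) c := by
  cases r with
  | zero => simp [lowerPaths]
  | succ r =>
    simp only [lowerPaths]
    rw [show r + 1 + (c + 1) = (r + c + 1) + 1 by ring, Nat.choose_succ_succ,
      show r + (c + 1) = r + c + 1 by ring, show r + 1 + c = r + c + 1 by ring]
    ring

lemma WidthTwo.mono {r₁ c₁ r₂ c₂ : ℕ} {T T' : Finset (ℕ × ℕ)} (h : WidthTwo r₁ c₁ r₂ c₂ T)
    (hT : T' ⊆ T) : WidthTwo r₁ c₁ r₂ c₂ T' where
  region p hp := h.region p (hT hp)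
  right p hp q hq := h.right p (hT hp) q (hT hq)
  lower p hp q hq := h.lower p (hT hp) q (hT hq)
  three p hp q hq s hs := h.three p (hT hp) q (hT hq) s (hT hs)

/-- Removing the last step of the path that ends at `(r₁, c₁)`, the endpoint of larger rank. -/
lemma pairCover_step {r₁ c₁ r₂ c₂ : ℕ} (hc₁ : 1 ≤ c₁) (hr₂ : 1 ≤ r₂) (hr : r₁ ≤ r₂) (hc : c₂ ≤ c₁)
    (hne : ¬ (r₁ = r₂ ∧ c₁ = c₂)) (hrank : r₂ + c₂ ≤ r₁ + c₁)
    (h1 : 1 ≤ r₁ → PairCover (r₁ - 1) c₁ r₂ c₂)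
    (h2 : 2 ≤ c₁ → ¬ (r₁ = r₂ ∧ c₁ - 1 = c₂) → PairCover r₁ (c₁ - 1) r₂ c₂) :
    PairCover r₁ c₁ r₂ c₂ := by
  classical
  have hcc : c₂ < c₁ := by omega
  by_cases hbase : r₁ = 0 ∧ c₁ = 1
  · obtain ⟨rfl, rfl⟩ := hbase
    obtain rfl : c₂ = 0 := by omega
    obtain rfl : r₂ = 1 := by omega
    refine ⟨{{(0, 0), (0, 1), (1, 0)}}, by simp [pairDet, lowerPaths], by simp, fun T hT => ?_⟩
    refine ⟨_, Finset.mem_singleton_self _, fun p hp => ?_⟩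
    have := hT.region p hp
    obtain ⟨a, b⟩ := p
    simp only [Finset.mem_insert, Finset.mem_singleton, Prod.mk.injEq] at this ⊢
    omega
  have H1 : ∃ Q : Finset (Finset (ℕ × ℕ)),
      (Q.card : ℤ) ≤ (if 1 ≤ r₁ then pairDet (r₁ - 1) c₁ r₂ c₂ else 0) ∧
      (∀ M ∈ Q, M.card ≤ r₁ + c₁ + r₂ + c₂) ∧
      (1 ≤ r₁ → ∀ T, WidthTwo (r₁ - 1) c₁ r₂ c₂ T → ∃ M ∈ Q, T ⊆ M) := by
    by_cases h : 1 ≤ r₁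
    · obtain ⟨Q, hQ, hs, hT⟩ := h1 h
      exact ⟨Q, by simpa [h] using hQ, fun M hM => (hs M hM).trans (by omega), fun _ => hT⟩
    · exact ⟨∅, by simp [h], by simp, fun h' => absurd h' h⟩
  have H2 : ∃ Q : Finset (Finset (ℕ × ℕ)),
      (Q.card : ℤ) ≤ (if 2 ≤ c₁ ∧ ¬ (r₁ = r₂ ∧ c₁ - 1 = c₂) then
        pairDet r₁ (c₁ - 1) r₂ c₂ else 0) ∧
      (∀ M ∈ Q, M.card ≤ r₁ + c₁ + r₂ + c₂) ∧
      (2 ≤ c₁ ∧ ¬ (r₁ = r₂ ∧ c₁ - 1 = c₂) →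
        ∀ T, WidthTwo r₁ (c₁ - 1) r₂ c₂ T → ∃ M ∈ Q, T ⊆ M) := by
    by_cases h : 2 ≤ c₁ ∧ ¬ (r₁ = r₂ ∧ c₁ - 1 = c₂)
    · obtain ⟨Q, hQ, hs, hT⟩ := h2 h.1 h.2
      exact ⟨Q, by rwa [if_pos h], fun M hM => (hs M hM).trans (by omega), fun _ => hT⟩
    · exact ⟨∅, by rw [if_neg h]; simp, by simp, fun h' => absurd h' h⟩
  obtain ⟨Q₁, hQ₁, hs₁, hT₁⟩ := H1
  obtain ⟨Q₂, hQ₂, hs₂, hT₂⟩ := H2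
  have hdet : pairDet r₁ c₁ r₂ c₂ = (if 1 ≤ r₁ then pairDet (r₁ - 1) c₁ r₂ c₂ else 0) +
      (if 2 ≤ c₁ ∧ ¬ (r₁ = r₂ ∧ c₁ - 1 = c₂) then pairDet r₁ (c₁ - 1) r₂ c₂ else 0) := by
    obtain ⟨c, rfl⟩ := Nat.exists_eq_add_of_le' hc₁
    -- a forbidden step to the left contributes a vanishing determinant
    have hif : 1 ≤ r₁ → (if 2 ≤ c + 1 ∧ ¬ (r₁ = r₂ ∧ c + 1 - 1 = c₂) then
        pairDet r₁ (c + 1 - 1) r₂ c₂ else 0) = pairDet r₁ c r₂ c₂ := by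
      intro h
      split_ifs with h'
      · simp
      · rcases Nat.eq_zero_or_pos c with rfl | hc0
        · obtain rfl : c₂ = 0 := by omega
          obtain ⟨a, rfl⟩ := Nat.exists_eq_add_of_le' h
          simp [pairDet, lowerPaths]
        · have h3 : r₁ = r₂ ∧ c = c₂ := by omega
          rw [h3.1, h3.2, pairDet, sub_self]
    rcases Nat.eq_zero_or_pos r₁ with rfl | hpos
    · have h3 : 2 ≤ c + 1 ∧ ¬ (0 = r₂ ∧ c + 1 - 1 = c₂) := by omega
      rw [if_pos h3, if_neg (by omega)]
      obtain ⟨b, rfl⟩ : ∃ b, c = b + 1 := ⟨c - 1, by omega⟩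
      simp [pairDet, lowerPaths]
    · rw [hif hpos, if_pos (show 1 ≤ r₁ from hpos)]
      obtain ⟨a, rfl⟩ := Nat.exists_eq_add_of_le' hpos
      simp only [pairDet, Nat.add_sub_cancel]
      rw [lowerPaths_rec c a, lowerPaths_rec a c]
      push_cast
      ring
  refine ⟨(Q₁ ∪ Q₂).image (insert (r₁, c₁)), ?_, ?_, ?_⟩
  · have : ((Q₁ ∪ Q₂).image (insert (r₁, c₁))).card ≤ Q₁.card + Q₂.card :=
      Finset.card_image_le.trans (Finset.card_union_le _ _)
    rw [hdet]
    have h' : (((Q₁ ∪ Q₂).image (insert (r₁, c₁))).card : ℤ) ≤ Q₁.card + Q₂.card := by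
      exact_mod_cast this
    linarith
  · intro M hM
    obtain ⟨M', hM', rfl⟩ := Finset.mem_image.mp hM
    refine (Finset.card_insert_le _ _).trans (Nat.add_le_add_right ?_ 1)
    rcases Finset.mem_union.mp hM' with h | h
    exacts [hs₁ M' h, hs₂ M' h]
  · intro T hT
    -- it suffices to cover the rest of `T` for one of the two shorter paths
    suffices h : (1 ≤ r₁ ∧ WidthTwo (r₁ - 1) c₁ r₂ c₂ (T.erase (r₁, c₁))) ∨
        ((2 ≤ c₁ ∧ ¬ (r₁ = r₂ ∧ c₁ - 1 = c₂)) ∧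
          WidthTwo r₁ (c₁ - 1) r₂ c₂ (T.erase (r₁, c₁))) by
      rcases h with ⟨h, h'⟩ | ⟨h, h'⟩
      · obtain ⟨M, hM, hTM⟩ := hT₁ h _ h'
        refine ⟨_, Finset.mem_image_of_mem _ (Finset.mem_union_left _ hM), ?_⟩
        exact Finset.subset_insert_iff.mpr hTM
      · obtain ⟨M, hM, hTM⟩ := hT₂ h _ h'
        refine ⟨_, Finset.mem_image_of_mem _ (Finset.mem_union_right _ hM), ?_⟩
        exact Finset.subset_insert_iff.mpr hTM
    have hE := hT.mono (Finset.erase_subset (r₁, c₁) T)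
    have hnot : ∀ p ∈ T.erase (r₁, c₁), ¬ (p.1 = r₁ ∧ p.2 = c₁) := by
      rintro p hp ⟨h3, h4⟩
      exact Finset.ne_of_mem_erase hp (Prod.ext h3 h4)
    generalize T.erase (r₁, c₁) = U at hE hnot
    by_cases hcol : ∃ p ∈ U, p.2 = c₁
    · left
      obtain ⟨p, hp, hpc⟩ := hcol
      have hpr := hE.region p hp
      have hpn := hnot p hp
      have hpr1 : p.1 < r₁ := by omega
      refine ⟨by omega, ⟨fun q hq => ?_, hE.right, fun q hq s hs h h' => ?_, hE.three⟩⟩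
      · have h1 := hE.region q hq
        have h2 := hnot q hq
        by_contra hcon
        have := hE.right p hp q hq (by omega) (by omega)
        omega
      · by_contra hcon
        have h1 := hE.region q hq
        have h2 := hnot q hq
        exact hE.three p hp q hq s hs (by omega) (by omega) h h'
    · push Not at hcol
      by_cases h2 : 2 ≤ c₁ ∧ ¬ (r₁ = r₂ ∧ c₁ - 1 = c₂)
      · right
        refine ⟨h2, ⟨fun q hq => ?_, hE.right, hE.lower, hE.three⟩⟩
        have h1 := hE.region q hq
        have h2 := hcol q hq
        omega
      · left
        refine ⟨by omega, ⟨fun q hq => ?_, hE.right, fun q hq s hs h h' => ?_, hE.three⟩⟩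
        · have h1 := hE.region q hq
          have h2 := hcol q hq
          omega
        · have h1 := hE.region q hq
          have h2 := hcol q hq
          have h3 := hE.region s hs
          have h4 := hE.lower q hq s hs h h'
          omega

lemma WidthTwo.swap {r₁ c₁ r₂ c₂ : ℕ} {T : Finset (ℕ × ℕ)} (h : WidthTwo r₁ c₁ r₂ c₂ T) :
    WidthTwo c₂ r₂ c₁ r₁ (T.map (Equiv.prodComm ℕ ℕ).toEmbedding) := by
  have key : ∀ p ∈ T.map (Equiv.prodComm ℕ ℕ).toEmbedding, (p.2, p.1) ∈ T := by
    intro p hp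
    obtain ⟨q, hq, rfl⟩ := Finset.mem_map.mp hp
    simpa using hq
  refine ⟨fun p hp => ?_, fun p hp q hq h1 h2 => ?_, fun p hp q hq h1 h2 => ?_,
    fun p hp q hq s hs h1 h2 h3 h4 => ?_⟩
  · have := h.region _ (key p hp)
    simp only at this
    omega
  · exact h.lower _ (key q hq) _ (key p hp) h2 h1
  · exact h.right _ (key q hq) _ (key p hp) h2 h1
  · exact h.three _ (key s hs) _ (key q hq) _ (key p hp) h4 h3 h2 h1

lemma PairCover.swap {r₁ c₁ r₂ c₂ : ℕ} (h : PairCover r₁ c₁ r₂ c₂) : PairCover c₂ r₂ c₁ r₁ := by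
  classical
  obtain ⟨Q, hQ, hs, hT⟩ := h
  refine ⟨Q.image fun M => M.map (Equiv.prodComm ℕ ℕ).toEmbedding, ?_, ?_, ?_⟩
  · have h1 : pairDet c₂ r₂ c₁ r₁ = pairDet r₁ c₁ r₂ c₂ := by
      simp only [pairDet]
      ring
    rw [h1]
    exact le_trans (by exact_mod_cast Finset.card_image_le) hQ
  · intro M hM
    obtain ⟨M', hM', rfl⟩ := Finset.mem_image.mp hM
    rw [Finset.card_map]
    exact (hs M' hM').trans (by omega)
  · intro T hT'
    obtain ⟨M, hM, hTM⟩ := hT _ hT'.swap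
    refine ⟨_, Finset.mem_image_of_mem _ hM, ?_⟩
    intro p hp
    have := hTM (Finset.mem_map_of_mem _ hp)
    exact Finset.mem_map.mpr ⟨_, this, rfl⟩

/-- A set satisfying `WidthTwo` lies below a pair of disjoint lattice paths. Since only an upper
bound for the number of pairs is recorded, no injectivity of the union of two paths is needed. -/
theorem pairCover (r₁ c₁ r₂ c₂ : ℕ) (hc₁ : 1 ≤ c₁) (hr₂ : 1 ≤ r₂) (hr : r₁ ≤ r₂) (hc : c₂ ≤ c₁)
    (hne : ¬ (r₁ = r₂ ∧ c₁ = c₂)) : PairCover r₁ c₁ r₂ c₂ := by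
  induction h : r₁ + c₁ + r₂ + c₂ using Nat.strong_induction_on generalizing r₁ c₁ r₂ c₂ with
  | _ N ih =>
    rcases le_total (r₂ + c₂) (r₁ + c₁) with hrank | hrank
    · refine pairCover_step hc₁ hr₂ hr hc hne hrank (fun h1 => ?_) (fun h1 h2 => ?_)
      · exact ih _ (by omega) _ _ _ _ hc₁ hr₂ (by omega) hc (by omega) rfl
      · exact ih _ (by omega) _ _ _ _ (by omega) hr₂ hr (by omega) h2 rfl
    · refine PairCover.swap (pairCover_step hr₂ hc₁ hc hr (by omega) (by omega)
        (fun h1 => ?_) (fun h1 h2 => ?_))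
      · exact PairCover.swap
          (ih _ (by omega) _ _ _ _ hc₁ hr₂ (by omega) (by omega) (by omega) rfl)
      · exact PairCover.swap
          (ih _ (by omega) _ _ _ _ hc₁ (by omega) (by omega) hc (by omega) rfl)

/-- The set `T` has no two points in antidiagonal position. -/
def IsGridChain (T : Finset (ℕ × ℕ)) : Prop :=
  ∀ p ∈ T, ∀ q ∈ T, p.1 < q.1 → ¬ q.2 < p.2

/-- The chains between two points of the grid lie below the lattice paths joining these points. -/
theorem chainCover (a b i j : ℕ) : ∃ E : Finset (Finset (ℕ × ℕ)),
    E.card ≤ (a + b).choose a ∧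
    (∀ M ∈ E, M.card ≤ a + b + 1 ∧ (i, j) ∈ M ∧ ∀ p ∈ M, i ≤ p.1 ∧ j ≤ p.2) ∧
    ∀ T, IsGridChain T → (∀ p ∈ T, i ≤ p.1 ∧ j ≤ p.2 ∧ p.1 ≤ i + a ∧ p.2 ≤ j + b) →
      ∃ M ∈ E, T ⊆ M := by
  classical
  induction h : a + b generalizing a b i j with
  | zero =>
    obtain ⟨rfl, rfl⟩ : a = 0 ∧ b = 0 := by omega
    refine ⟨{{(i, j)}}, by simp, by simp, fun T _ hT => ⟨_, Finset.mem_singleton_self _, ?_⟩⟩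
    intro p hp
    have := hT p hp
    obtain ⟨x, y⟩ := p
    simp only [Finset.mem_singleton, Prod.mk.injEq] at this ⊢
    omega
  | succ N ih =>
    have H1 : ∃ E : Finset (Finset (ℕ × ℕ)),
        E.card ≤ (if 1 ≤ a then N.choose (a - 1) else 0) ∧
        (∀ M ∈ E, M.card ≤ N + 1 ∧ ∀ p ∈ M, i ≤ p.1 ∧ j ≤ p.2) ∧
        (1 ≤ a → ∀ T, IsGridChain T →
          (∀ p ∈ T, i + 1 ≤ p.1 ∧ j ≤ p.2 ∧ p.1 ≤ i + a ∧ p.2 ≤ j + b) → ∃ M ∈ E, T ⊆ M) := by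
      by_cases ha : 1 ≤ a
      · obtain ⟨E, hE, hs, hT⟩ := ih (a - 1) b (i + 1) j (by omega)
        refine ⟨E, by simpa [ha] using hE, fun M hM => ⟨(hs M hM).1, fun p hp => ?_⟩,
          fun _ T hc h => hT T hc fun p hp => ?_⟩
        · have := (hs M hM).2.2 p hp
          omega
        · have := h p hp
          omega
      · exact ⟨∅, by simp, by simp, fun h => absurd h ha⟩
    have H2 : ∃ E : Finset (Finset (ℕ × ℕ)),
        E.card ≤ N.choose a ∧
        (∀ M ∈ E, M.card ≤ N + 1 ∧ ∀ p ∈ M, i ≤ p.1 ∧ j ≤ p.2) ∧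
        (1 ≤ b → ∀ T, IsGridChain T →
          (∀ p ∈ T, i ≤ p.1 ∧ j + 1 ≤ p.2 ∧ p.1 ≤ i + a ∧ p.2 ≤ j + b) → ∃ M ∈ E, T ⊆ M) := by
      by_cases hb : 1 ≤ b
      · obtain ⟨E, hE, hs, hT⟩ := ih a (b - 1) i (j + 1) (by omega)
        refine ⟨E, hE, fun M hM => ⟨(hs M hM).1, fun p hp => ?_⟩,
          fun _ T hc h => hT T hc fun p hp => ?_⟩
        · have := (hs M hM).2.2 p hp
          omega
        · have := h p hp
          omega
      · exact ⟨∅, by simp, by simp, fun h => absurd h hb⟩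
    obtain ⟨E₁, hE₁, hs₁, hT₁⟩ := H1
    obtain ⟨E₂, hE₂, hs₂, hT₂⟩ := H2
    refine ⟨(E₁ ∪ E₂).image (insert (i, j)), ?_, ?_, ?_⟩
    · refine (Finset.card_image_le.trans (Finset.card_union_le _ _)).trans ?_
      rcases Nat.eq_zero_or_pos a with rfl | ha
      · simp at hE₁ hE₂ ⊢
        simp [hE₁, hE₂]
      · rw [if_pos (show 1 ≤ a from ha)] at hE₁
        obtain ⟨c, rfl⟩ := Nat.exists_eq_add_of_le' ha
        rw [Nat.choose_succ_succ]
        simp only [Nat.add_sub_cancel] at hE₁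
        simpa using add_le_add hE₁ hE₂
    · intro M hM
      obtain ⟨M', hM', rfl⟩ := Finset.mem_image.mp hM
      have h3 : M'.card ≤ N + 1 ∧ ∀ p ∈ M', i ≤ p.1 ∧ j ≤ p.2 := by
        rcases Finset.mem_union.mp hM' with h | h
        exacts [hs₁ M' h, hs₂ M' h]
      refine ⟨(Finset.card_insert_le _ _).trans (by omega), by simp, fun p hp => ?_⟩
      rcases Finset.mem_insert.mp hp with rfl | hp
      · simp
      · exact h3.2 p hp
    · intro T hc hT
      have hc' : IsGridChain (T.erase (i, j)) := fun p hp q hq =>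
        hc p (Finset.mem_of_mem_erase hp) q (Finset.mem_of_mem_erase hq)
      have hnot : ∀ p ∈ T.erase (i, j), ¬ (p.1 = i ∧ p.2 = j) := by
        rintro p hp ⟨h3, h4⟩
        exact Finset.ne_of_mem_erase hp (Prod.ext h3 h4)
      have hT' : ∀ p ∈ T.erase (i, j), i ≤ p.1 ∧ j ≤ p.2 ∧ p.1 ≤ i + a ∧ p.2 ≤ j + b :=
        fun p hp => hT p (Finset.mem_of_mem_erase hp)
      have : (∃ M ∈ E₁, T.erase (i, j) ⊆ M) ∨ (∃ M ∈ E₂, T.erase (i, j) ⊆ M) := by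
        by_cases hrow : ∃ p ∈ T.erase (i, j), p.1 = i
        · right
          obtain ⟨p, hp, hpi⟩ := hrow
          have h1 := hnot p hp
          have h2 := hT' p hp
          refine hT₂ (by omega) _ hc' fun q hq => ?_
          have h3 := hnot q hq
          have h4 := hT' q hq
          have h5 := hc' p hp q hq
          omega
        · push Not at hrow
          by_cases ha : 1 ≤ a
          · left
            refine hT₁ ha _ hc' fun q hq => ?_
            have h3 := hrow q hq
            have h4 := hT' q hq
            omega
          · right
            refine hT₂ (by omega) _ hc' fun q hq => ?_
            have h3 := hrow q hq
            have h4 := hT' q hq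
            omega
      rcases this with ⟨M, hM, hTM⟩ | ⟨M, hM, hTM⟩
      · refine ⟨_, Finset.mem_image_of_mem _ (Finset.mem_union_left _ hM), ?_⟩
        exact Finset.subset_insert_iff.mpr hTM
      · refine ⟨_, Finset.mem_image_of_mem _ (Finset.mem_union_right _ hM), ?_⟩
        exact Finset.subset_insert_iff.mpr hTM

/-- The lattice paths from `(0, 0)` to `(a, b)`, as chains of the maximal size. -/
theorem exists_maximal_chains (a b : ℕ) : ∃ E : Finset (Finset (ℕ × ℕ)),
    E.card = (a + b).choose a ∧
    ∀ M ∈ E, M.card = a + b + 1 ∧ (a, b) ∈ M ∧ IsGridChain M ∧ ∀ p ∈ M, p.1 ≤ a ∧ p.2 ≤ b := by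
  classical
  induction h : a + b generalizing a b with
  | zero =>
    obtain ⟨rfl, rfl⟩ : a = 0 ∧ b = 0 := by omega
    exact ⟨{{(0, 0)}}, by simp, by simp [IsGridChain]⟩
  | succ N ih =>
    have H1 : ∃ E : Finset (Finset (ℕ × ℕ)),
        E.card = (if 1 ≤ a then N.choose (a - 1) else 0) ∧
        ∀ M ∈ E, M.card = N + 1 ∧ (1 ≤ a ∧ (a - 1, b) ∈ M) ∧ IsGridChain M ∧
          ∀ p ∈ M, p.1 + 1 ≤ a ∧ p.2 ≤ b := by
      by_cases ha : 1 ≤ a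
      · obtain ⟨E, hE, hs⟩ := ih (a - 1) b (by omega)
        refine ⟨E, by simpa [ha] using hE, fun M hM => ?_⟩
        obtain ⟨h1, h2, h3, h4⟩ := hs M hM
        refine ⟨h1, ⟨ha, h2⟩, h3, fun p hp => ?_⟩
        have := h4 p hp
        omega
      · exact ⟨∅, by simp [ha], by simp⟩
    have H2 : ∃ E : Finset (Finset (ℕ × ℕ)),
        E.card = N.choose a ∧
        ∀ M ∈ E, M.card = N + 1 ∧ IsGridChain M ∧ ∀ p ∈ M, p.1 ≤ a ∧ p.2 + 1 ≤ b := by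
      by_cases hb : 1 ≤ b
      · obtain ⟨E, hE, hs⟩ := ih a (b - 1) (by omega)
        refine ⟨E, hE, fun M hM => ?_⟩
        obtain ⟨h1, h2, h3, h4⟩ := hs M hM
        refine ⟨h1, h3, fun p hp => ?_⟩
        have := h4 p hp
        omega
      · refine ⟨∅, ?_, by simp⟩
        rw [Finset.card_empty, Nat.choose_eq_zero_of_lt (by omega)]
    obtain ⟨E₁, hE₁, hs₁⟩ := H1
    obtain ⟨E₂, hE₂, hs₂⟩ := H2
    have hdis : Disjoint E₁ E₂ := by
      rw [Finset.disjoint_left]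
      intro M h1 h2
      have h3 := (hs₂ M h2).2.2 _ (hs₁ M h1).2.1.2
      simp only at h3
      have h4 : ∃ p ∈ M, p.2 = b := ⟨_, (hs₁ M h1).2.1.2, rfl⟩
      obtain ⟨p, hp, hpb⟩ := h4
      have := (hs₂ M h2).2.2 p hp
      omega
    have hmem : ∀ M ∈ E₁ ∪ E₂, M.card = N + 1 ∧ IsGridChain M ∧ (a, b) ∉ M ∧
        ∀ p ∈ M, p.1 ≤ a ∧ p.2 ≤ b := by
      intro M hM
      rcases Finset.mem_union.mp hM with h | h
      · obtain ⟨h1, h2, h3, h4⟩ := hs₁ M h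
        refine ⟨h1, h3, fun h' => ?_, fun p hp => ?_⟩
        · have := h4 _ h'
          simp at this
        · have := h4 p hp
          omega
      · obtain ⟨h1, h3, h4⟩ := hs₂ M h
        refine ⟨h1, h3, fun h' => ?_, fun p hp => ?_⟩
        · have := h4 _ h'
          simp at this
        · have := h4 p hp
          omega
    refine ⟨(E₁ ∪ E₂).image (insert (a, b)), ?_, ?_⟩
    · rw [Finset.card_image_of_injOn, Finset.card_union_of_disjoint hdis, hE₁, hE₂]
      · rcases Nat.eq_zero_or_pos a with rfl | ha
        · simp
        · rw [if_pos (show 1 ≤ a from ha)]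
          obtain ⟨c, rfl⟩ := Nat.exists_eq_add_of_le' ha
          rw [Nat.choose_succ_succ]
          simp
      · intro M hM M' hM' heq
        have h1 := (hmem M hM).2.2.1
        have h2 := (hmem M' hM').2.2.1
        rw [← Finset.erase_insert h1, ← Finset.erase_insert h2]
        exact congrArg (fun s => Finset.erase s (a, b)) heq
    · intro M hM
      obtain ⟨M', hM', rfl⟩ := Finset.mem_image.mp hM
      obtain ⟨h1, h2, h3, h4⟩ := hmem M' hM'
      refine ⟨by rw [Finset.card_insert_of_notMem h3, h1], by simp, ?_, ?_⟩
      · intro p hp q hq hlt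
        rcases Finset.mem_insert.mp hp with rfl | hp
        · rcases Finset.mem_insert.mp hq with rfl | hq
          · simp
          · have := h4 q hq
            simp only at hlt
            omega
        · rcases Finset.mem_insert.mp hq with rfl | hq
          · have := h4 p hp
            simp only
            omega
          · exact h2 p hp q hq hlt
      · intro p hp
        rcases Finset.mem_insert.mp hp with rfl | hp
        · simp
        · exact h4 p hp

/-! ### The summands -/

lemma binom_natCast (a b : ℕ) : binom (a : ℤ) (b : ℤ) = (a.choose b : ℤ) := by
  simp [binom]

lemma binom_neg (a : ℤ) {b : ℤ} (hb : b < 0) : binom a b = 0 := by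
  simp [binom, hb]

/-- The number of all lattice paths is the sum of the numbers of those through `(1, 0)` and
those through `(0, 1)`. -/
lemma choose_eq_lowerPaths (r c : ℕ) (h : r + c ≠ 0) :
    ((r + c).choose r : ℤ) = lowerPaths r c + lowerPaths c r := by
  rcases r with _ | r
  · obtain ⟨c, rfl⟩ := Nat.exists_eq_succ_of_ne_zero (by simpa using h)
    simp [lowerPaths]
  · rcases c with _ | c
    · simp [lowerPaths]
    · simp only [lowerPaths]
      rw [show r + 1 + (c + 1) = (r + (c + 1)) + 1 by ring, Nat.choose_succ_succ,
        show c + (r + 1) = r + (c + 1) by ring]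
      have h1 : (r + (c + 1)).choose r = (r + (c + 1)).choose (c + 1) :=
        Nat.choose_symm_add
      push_cast
      rw [h1]

theorem summand_eq (m n i j : ℕ) (hm : 2 ≤ m) (hn : 2 ≤ n) (hi : i < m) (hj : j < n) :
    summand (m : ℤ) (n : ℤ) ((i : ℤ) + 1) ((j : ℤ) + 1) =
      ((m - 1 - i + (n - 1 - j)).choose (m - 1 - i) : ℤ) * pairDet i (n - 1) (m - 1) j := by
  have e1 : (m : ℤ) + n - (i + 1) - (j + 1) = ((m - 1 - i + (n - 1 - j) : ℕ) : ℤ) := by omega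
  have e2 : (m : ℤ) - (i + 1) = ((m - 1 - i : ℕ) : ℤ) := by omega
  have e3 : (i : ℤ) + 1 + n - 2 = ((i + (n - 1) : ℕ) : ℤ) := by omega
  have e4 : (i : ℤ) + 1 - 1 = ((i : ℕ) : ℤ) := by omega
  have e5 : (m : ℤ) + (j + 1) - 2 = ((m - 1 + j : ℕ) : ℤ) := by omega
  have e6 : (m : ℤ) - 1 = ((m - 1 : ℕ) : ℤ) := by omega
  have e7 : (m : ℤ) + (j + 1) - 3 = ((m - 2 + j : ℕ) : ℤ) := by omega
  have e8 : (m : ℤ) - 2 = ((m - 2 : ℕ) : ℤ) := by omega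
  have h1 : binom ((i : ℤ) + 1 + n - 3) ((i : ℤ) + 1 - 2) = (lowerPaths i (n - 1) : ℤ) := by
    rcases i with _ | i
    · rw [binom_neg _ (by norm_num)]
      simp [lowerPaths]
    · have e9 : ((i + 1 : ℕ) : ℤ) + 1 + n - 3 = ((i + (n - 1) : ℕ) : ℤ) := by omega
      have e10 : ((i + 1 : ℕ) : ℤ) + 1 - 2 = (i : ℤ) := by push_cast; ring
      rw [e9, e10, binom_natCast, lowerPaths, Nat.choose_symm_add]
  have h2 : ((m - 2 + j).choose (m - 2) : ℤ) = lowerPaths (m - 1) j := by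
    obtain ⟨a, rfl⟩ := Nat.exists_eq_add_of_le' hm
    simp only [Nat.add_sub_cancel, show a + 2 - 1 = a + 1 by omega, lowerPaths]
    rw [Nat.choose_symm_add]
  rw [summand, Matrix.det_fin_two_of, h1, e1, e2, e3, e4, e5, e6, e7, e8]
  simp only [binom_natCast]
  rw [h2, choose_eq_lowerPaths i (n - 1) (by omega), choose_eq_lowerPaths (m - 1) j (by omega),
    pairDet]
  ring

/-- Abel summation in two variables: summation by parts moves the differences of `F` and `G` to
`W`. -/
lemma sum_two_variable_abel (M N : ℕ) (F G : ℕ → ℤ) (W : ℕ → ℕ → ℤ) (hF : F 0 = 0) (hG : G 0 = 0)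
    (hM : ∀ j, W M j = 0) (hN : ∀ i, W i N = 0) :
    ∑ i ∈ Finset.range M, ∑ j ∈ Finset.range N,
      W i j * (F (i + 1) * G (j + 1) - F (i + 1) * G j - F i * G (j + 1)) =
    ∑ i ∈ Finset.range M, ∑ j ∈ Finset.range N,
      (W i j - W i (j + 1) - W (i + 1) j) * (F (i + 1) * G (j + 1)) := by
  have shift : ∀ (K : ℕ) (h : ℕ → ℤ), h 0 = 0 → h K = 0 →
      ∑ k ∈ Finset.range K, h k = ∑ k ∈ Finset.range K, h (k + 1) := by
    intro K h h0 hK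
    have h1 := Finset.sum_range_succ h K
    rw [Finset.sum_range_succ', h0, hK] at h1
    linarith
  have hA : ∀ i, ∑ j ∈ Finset.range N, W i j * (F (i + 1) * G j) =
      ∑ j ∈ Finset.range N, W i (j + 1) * (F (i + 1) * G (j + 1)) := fun i =>
    shift N (fun j => W i j * (F (i + 1) * G j)) (by simp [hG]) (by simp [hN])
  have hB : ∑ i ∈ Finset.range M, ∑ j ∈ Finset.range N, W i j * (F i * G (j + 1)) =
      ∑ i ∈ Finset.range M, ∑ j ∈ Finset.range N, W (i + 1) j * (F (i + 1) * G (j + 1)) :=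
    shift M (fun i => ∑ j ∈ Finset.range N, W i j * (F i * G (j + 1))) (by simp [hF])
      (by simp [hM])
  simp only [mul_sub, sub_mul, Finset.sum_sub_distrib]
  rw [hB, Finset.sum_congr rfl fun i _ => hA i]

/-- The number of lattice paths from `(i, j)` to `(M, N)`. -/
def pathsTo (M N i j : ℕ) : ℤ :=
  if i ≤ M ∧ j ≤ N then ((M - i + (N - j)).choose (M - i) : ℤ) else 0

lemma pathsTo_rec {M N i j : ℕ} (hi : i ≤ M) (hj : j ≤ N) (hne : ¬ (i = M ∧ j = N)) :
    pathsTo M N i j - pathsTo M N i (j + 1) - pathsTo M N (i + 1) j = 0 := by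
  simp only [pathsTo]
  rw [if_pos ⟨hi, hj⟩]
  rcases Nat.lt_or_ge i M with hi' | hi'
  · obtain ⟨k, hk⟩ : ∃ k, M - i = k + 1 := ⟨M - i - 1, by omega⟩
    rcases Nat.lt_or_ge j N with hj' | hj'
    · obtain ⟨l, hl⟩ : ∃ l, N - j = l + 1 := ⟨N - j - 1, by omega⟩
      rw [if_pos ⟨by omega, by omega⟩, if_pos ⟨by omega, by omega⟩, hk, hl,
        show N - (j + 1) = l by omega, show M - (i + 1) = k by omega,
        show k + 1 + (l + 1) = (k + (l + 1)) + 1 by ring, Nat.choose_succ_succ,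
        show k + 1 + l = k + (l + 1) by ring]
      push_cast
      ring
    · rw [if_neg (by omega), if_pos ⟨by omega, by omega⟩, hk, show N - j = 0 by omega,
        show M - (i + 1) = k by omega]
      simp
  · rw [if_pos ⟨by omega, by omega⟩, if_neg (by omega), show M - i = 0 by omega]
    simp

lemma pairDet_eq_sub (a b i j : ℕ) : pairDet i (b + 1) (a + 1) j =
    (lowerPaths (i + 1) (b + 1) : ℤ) * lowerPaths (j + 1) (a + 1) -
      lowerPaths (i + 1) (b + 1) * lowerPaths j (a + 1) -
      lowerPaths i (b + 1) * lowerPaths (j + 1) (a + 1) := by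
  have h5 := choose_eq_lowerPaths i (b + 1) (by omega)
  have h6 := choose_eq_lowerPaths j (a + 1) (by omega)
  have h7 : (lowerPaths (i + 1) (b + 1) : ℤ) = ((i + (b + 1)).choose i : ℤ) := by
    rw [lowerPaths, Nat.choose_symm_add]
  have h8 : (lowerPaths (j + 1) (a + 1) : ℤ) = ((j + (a + 1)).choose j : ℤ) := by
    rw [lowerPaths, Nat.choose_symm_add]
  rw [h7, h8, h5, h6, pairDet]
  ring

lemma sum_pathsTo_mul_pairDet (a b : ℕ) :
    ∑ i ∈ Finset.range (a + 2), ∑ j ∈ Finset.range (b + 2),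
      pathsTo (a + 1) (b + 1) i j * pairDet i (b + 1) (a + 1) j =
    ((a + 1 + (b + 1)).choose (a + 1) : ℤ) ^ 2 := by
  simp only [pairDet_eq_sub]
  rw [sum_two_variable_abel (a + 2) (b + 2) (fun i => (lowerPaths i (b + 1) : ℤ))
    (fun j => (lowerPaths j (a + 1) : ℤ)) (pathsTo (a + 1) (b + 1)) (by simp [lowerPaths])
    (by simp [lowerPaths]) (by intro j; simp [pathsTo]) (by intro i; simp [pathsTo])]
  rw [Finset.sum_eq_single (a + 1), Finset.sum_eq_single (b + 1)]
  · have h1 : (lowerPaths (a + 1 + 1) (b + 1) : ℤ) = ((a + 1 + (b + 1)).choose (a + 1) : ℤ) := by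
      rw [lowerPaths, Nat.choose_symm_add]
    have h2 : (lowerPaths (b + 1 + 1) (a + 1) : ℤ) = ((a + 1 + (b + 1)).choose (a + 1) : ℤ) := by
      rw [lowerPaths, add_comm (b + 1)]
    rw [h1, h2]
    simp [pathsTo, sq]
  · intro j hj hne
    rw [Finset.mem_range] at hj
    rw [pathsTo_rec le_rfl (by omega) (by omega), zero_mul]
  · simp
  · intro i hi hne
    rw [Finset.mem_range] at hi
    refine Finset.sum_eq_zero fun j hj => ?_
    rw [Finset.mem_range] at hj
    rw [pathsTo_rec (by omega) (by omega) (by omega), zero_mul]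
  · simp

lemma summand_eq_pathsTo (a b i j : ℕ) (hi : i < a + 2) (hj : j < b + 2) :
    summand ((a + 2 : ℕ) : ℤ) ((b + 2 : ℕ) : ℤ) ((i + 1 : ℕ) : ℤ) ((j + 1 : ℕ) : ℤ) =
      pathsTo (a + 1) (b + 1) i j * pairDet i (b + 1) (a + 1) j := by
  have h1 := summand_eq (a + 2) (b + 2) i j (by omega) (by omega) hi hj
  rw [Nat.cast_add i 1, Nat.cast_add j 1, Nat.cast_one, h1, pathsTo,
    if_pos ⟨Nat.lt_succ_iff.mp hi, Nat.lt_succ_iff.mp hj⟩]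
  rfl

lemma sum_erase_Icc_product (m n : ℕ) (f : ℕ × ℕ → ℤ) (h : f (m, n) = 0) :
    ∑ q ∈ ((Finset.Icc 1 m) ×ˢ (Finset.Icc 1 n)).erase (m, n), f q =
      ∑ i ∈ Finset.range m, ∑ j ∈ Finset.range n, f (i + 1, j + 1) := by
  have hIcc : ∀ (K : ℕ) (h : ℕ → ℤ), ∑ k ∈ Finset.Icc 1 K, h k =
      ∑ k ∈ Finset.range K, h (k + 1) := by
    intro K h
    rw [Finset.range_eq_Ico, Finset.sum_Ico_add', zero_add, Finset.Ico_add_one_right_eq_Icc]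
  rw [Finset.sum_erase _ h, Finset.sum_product, hIcc]
  simp only [hIcc]

/-- The sum of the summands is the square of the degree of the variety of matrices of rank at most
one. -/
theorem sum_summand (m n : ℕ) (hm : 2 ≤ m) (hn : 2 ≤ n) :
    ∑ q ∈ ((Finset.Icc 1 m) ×ˢ (Finset.Icc 1 n)).erase (m, n),
      summand (m : ℤ) (n : ℤ) (q.1 : ℤ) (q.2 : ℤ) = ((m - 1 + (n - 1)).choose (m - 1) : ℤ) ^ 2 := by
  obtain ⟨a, rfl⟩ := Nat.exists_eq_add_of_le' hm
  obtain ⟨b, rfl⟩ := Nat.exists_eq_add_of_le' hn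
  have hlast : summand ((a + 2 : ℕ) : ℤ) ((b + 2 : ℕ) : ℤ) ((a + 2 : ℕ) : ℤ) ((b + 2 : ℕ) : ℤ)
      = 0 := by
    refine (summand_eq_pathsTo a b (a + 1) (b + 1) (by omega) (by omega)).trans ?_
    rw [pairDet, sub_self, mul_zero]
  rw [show a + 2 - 1 = a + 1 from rfl, show b + 2 - 1 = b + 1 from rfl,
    ← sum_pathsTo_mul_pairDet a b]
  generalize hf : (fun q : ℕ × ℕ => summand ((a + 2 : ℕ) : ℤ) ((b + 2 : ℕ) : ℤ) (q.1 : ℤ)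
    (q.2 : ℤ)) = f
  have hq : ∀ i j : ℕ, summand ((a + 2 : ℕ) : ℤ) ((b + 2 : ℕ) : ℤ) (i : ℤ) (j : ℤ) = f (i, j) := by
    intro i j
    rw [← hf]
  simp only [hq] at hlast
  rw [sum_erase_Icc_product _ _ f hlast]
  refine Finset.sum_congr rfl fun i hi => Finset.sum_congr rfl fun j hj => ?_
  rw [← hq, summand_eq_pathsTo a b i j (Finset.mem_range.mp hi) (Finset.mem_range.mp hj)]

/-! ### Weighted graded reverse lexicographic orders and leading exponents -/

section Order

variable {σ : Type*}

/-- The strict monomial order that compares first the degree, then the weight for `w`, and then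
uses the reverse lexicographic rule for the positions `pos` of the variables. -/
def WLT (pos w : σ → ℕ) (a b : σ →₀ ℕ) : Prop :=
  a.degree < b.degree ∨ (a.degree = b.degree ∧ (Finsupp.weight w a < Finsupp.weight w b ∨
    (Finsupp.weight w a = Finsupp.weight w b ∧
      ∃ v, b v < a v ∧ ∀ u, pos v < pos u → a u = b u)))

variable {pos w : σ → ℕ}

lemma WLT.irrefl (a : σ →₀ ℕ) : ¬ WLT pos w a a := by
  rintro (h | ⟨-, h | ⟨-, v, h, -⟩⟩) <;> exact lt_irrefl _ h

lemma WLT.trans {a b c : σ →₀ ℕ} (hpos : Function.Injective pos) (hab : WLT pos w a b)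
    (hbc : WLT pos w b c) : WLT pos w a c := by
  rcases hab with hab | ⟨h1, hab⟩
  · rcases hbc with hbc | ⟨h2, -⟩
    · exact Or.inl (hab.trans hbc)
    · exact Or.inl (h2 ▸ hab)
  rcases hbc with hbc | ⟨h2, hbc⟩
  · exact Or.inl (h1 ▸ hbc)
  refine Or.inr ⟨h1.trans h2, ?_⟩
  rcases hab with hab | ⟨h3, v, hv, hv'⟩
  · rcases hbc with hbc | ⟨h4, -⟩
    · exact Or.inl (hab.trans hbc)
    · exact Or.inl (h4 ▸ hab)
  rcases hbc with hbc | ⟨h4, u, hu, hu'⟩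
  · exact Or.inl (h3 ▸ hbc)
  refine Or.inr ⟨h3.trans h4, ?_⟩
  rcases lt_trichotomy (pos v) (pos u) with h | h | h
  · exact ⟨u, by rw [hv' u h]; exact hu, fun x hx => (hv' x (h.trans hx)).trans (hu' x hx)⟩
  · obtain rfl := hpos h
    exact ⟨v, hu.trans hv, fun x hx => (hv' x hx).trans (hu' x hx)⟩
  · exact ⟨v, by rw [← hu' v h]; exact hv, fun x hx => (hv' x hx).trans (hu' x (h.trans hx))⟩

lemma WLT.add_right {a b : σ →₀ ℕ} (h : WLT pos w a b) (c : σ →₀ ℕ) :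
    WLT pos w (a + c) (b + c) := by
  unfold WLT at h ⊢
  simp only [map_add, Finsupp.add_apply, add_lt_add_iff_right, add_left_inj]
  exact h

lemma WLT.total [Finite σ] {a b : σ →₀ ℕ} (hne : a ≠ b) :
    WLT pos w a b ∨ WLT pos w b a := by
  classical
  have := Fintype.ofFinite σ
  rcases lt_trichotomy a.degree b.degree with h | h | h
  · exact Or.inl (Or.inl h)
  · rcases lt_trichotomy (Finsupp.weight w a) (Finsupp.weight w b) with h' | h' | h'
    · exact Or.inl (Or.inr ⟨h, Or.inl h'⟩)
    · have hS : (Finset.univ.filter fun v => a v ≠ b v).Nonempty := by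
        by_contra hcon
        rw [Finset.not_nonempty_iff_eq_empty, Finset.filter_eq_empty_iff] at hcon
        exact hne (Finsupp.ext fun v => not_not.mp (hcon (Finset.mem_univ v)))
      obtain ⟨v, hv, hmax⟩ := Finset.exists_max_image _ pos hS
      have hmax' : ∀ u, pos v < pos u → a u = b u := by
        intro u hu
        by_contra hcon
        exact absurd (hmax u (by simp [hcon])) (not_le.mpr hu)
      have hv' : a v ≠ b v := by simpa using hv
      rcases lt_or_gt_of_ne hv' with h3 | h3
      · exact Or.inr (Or.inr ⟨h.symm, Or.inr ⟨h'.symm, v, h3, fun u hu => (hmax' u hu).symm⟩⟩)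
      · exact Or.inl (Or.inr ⟨h, Or.inr ⟨h', v, h3, hmax'⟩⟩)
    · exact Or.inr (Or.inr ⟨h.symm, Or.inl h'⟩)
  · exact Or.inr (Or.inl h)

/-- The exponents of total degree `k`. -/
def degreeExps (σ : Type*) [Fintype σ] (k : ℕ) : Finset (σ →₀ ℕ) :=
  by classical exact Finset.finsuppAntidiag Finset.univ k

lemma mem_degreeExps [Fintype σ] {k : ℕ} {a : σ →₀ ℕ} : a ∈ degreeExps σ k ↔ a.degree = k := by
  simp [degreeExps, Finsupp.degree_eq_sum]

lemma WLT.wellFounded [Finite σ] (hpos : Function.Injective pos) : WellFounded (WLT pos w) := by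
  classical
  have := Fintype.ofFinite σ
  -- the number of predecessors is finite, and strictly monotone
  have hfin : ∀ a : σ →₀ ℕ, {b | WLT pos w b a}.Finite := by
    intro a
    refine ((Finset.range (a.degree + 1)).biUnion (degreeExps σ)).finite_toSet.subset ?_
    intro b hb
    have : b.degree ≤ a.degree := by
      rcases hb with h | ⟨h, -⟩
      exacts [h.le, h.le]
    simp only [Finset.coe_biUnion, Set.mem_iUnion, Finset.mem_coe, Finset.mem_range,
      mem_degreeExps]
    exact ⟨_, by omega, rfl⟩
  refine Subrelation.wf (r := InvImage (· < ·) fun a => {b | WLT pos w b a}.ncard) ?_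
    (InvImage.wf _ wellFounded_lt)
  intro a b hab
  refine Set.ncard_lt_ncard ?_ (hfin b)
  refine (Set.ssubset_iff_of_subset fun c hc => hc.trans hpos hab).mpr ⟨a, hab, WLT.irrefl a⟩

/-- A sufficient condition for `a` to be smaller than `b` in terms of the smallest variable. -/
lemma WLT.of_last {a b : σ →₀ ℕ} (hdeg : a.degree = b.degree)
    (hw : Finsupp.weight w a = Finsupp.weight w b) (v : σ) (hv : a v ≠ 0)
    (ha : ∀ u, pos v < pos u → a u = 0) (hb : ∀ u, pos v ≤ pos u → b u = 0) : WLT pos w a b := by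
  refine Or.inr ⟨hdeg, Or.inr ⟨hw, v, ?_, fun u hu => by rw [ha u hu, hb u hu.le]⟩⟩
  rw [hb v le_rfl]
  exact Nat.pos_of_ne_zero hv

variable {F : Type*} [Field F]

/-- `a` is the leading exponent of `f` for the order `WLT pos w`. -/
def IsLead (pos w : σ → ℕ) (f : MvPolynomial σ F) (a : σ →₀ ℕ) : Prop :=
  a ∈ f.support ∧ ∀ b ∈ f.support, b ≠ a → WLT pos w b a

/-- All exponents of `f` are smaller than `a`. -/
def IsBelow (pos w : σ → ℕ) (f : MvPolynomial σ F) (a : σ →₀ ℕ) : Prop :=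
  ∀ b ∈ f.support, WLT pos w b a

lemma IsBelow.add {f g : MvPolynomial σ F} {a : σ →₀ ℕ} (hf : IsBelow pos w f a)
    (hg : IsBelow pos w g a) : IsBelow pos w (f + g) a := by
  classical
  intro b hb
  rcases Finset.mem_union.mp (support_add hb) with h | h
  exacts [hf b h, hg b h]

lemma IsBelow.neg {f : MvPolynomial σ F} {a : σ →₀ ℕ} (hf : IsBelow pos w f a) :
    IsBelow pos w (-f) a := by
  intro b hb
  exact hf b (by simpa using hb)

lemma IsBelow.smul {f : MvPolynomial σ F} {a : σ →₀ ℕ} (hf : IsBelow pos w f a) (c : F) :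
    IsBelow pos w (C c * f) a := by
  intro b hb
  refine hf b ?_
  rw [mem_support_iff, coeff_C_mul] at hb
  exact mem_support_iff.mpr (right_ne_zero_of_mul hb)

lemma IsBelow.monomial {a b : σ →₀ ℕ} (h : WLT pos w b a) (c : F) :
    IsBelow pos w (monomial b c) a := by
  classical
  intro x hx
  rw [Finset.mem_singleton.mp (support_monomial_subset hx)]
  exact h

lemma IsLead.of_isBelow {f g : MvPolynomial σ F} {a : σ →₀ ℕ} (hg : IsBelow pos w g a)
    (hf : f = MvPolynomial.monomial a 1 + g) : IsLead pos w f a := by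
  classical
  have ha : coeff a g = 0 := by
    by_contra h
    exact WLT.irrefl a (hg a (mem_support_iff.mpr h))
  refine ⟨by rw [hf, mem_support_iff, coeff_add, ha]; simp, fun b hb hne => hg b ?_⟩
  rw [hf, mem_support_iff, coeff_add, coeff_monomial, if_neg hne.symm, zero_add] at hb
  exact mem_support_iff.mpr hb

lemma IsLead.add_isBelow {f g : MvPolynomial σ F} {a : σ →₀ ℕ} (hf : IsLead pos w f a)
    (hg : IsBelow pos w g a) : IsLead pos w (f + g) a := by
  classical
  have ha : coeff a g = 0 := by
    by_contra h
    exact WLT.irrefl a (hg a (mem_support_iff.mpr h))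
  refine ⟨by rw [mem_support_iff, coeff_add, ha, add_zero]; exact mem_support_iff.mp hf.1,
    fun b hb hne => ?_⟩
  rcases Finset.mem_union.mp (support_add hb) with h | h
  exacts [hf.2 b h hne, hg b h]

lemma IsLead.of_support_subset {f g : MvPolynomial σ F} {a : σ →₀ ℕ} (hf : IsLead pos w f a)
    (ha : a ∈ g.support) (h : ∀ b ∈ g.support, b ∈ f.support) : IsLead pos w g a :=
  ⟨ha, fun b hb => hf.2 b (h b hb)⟩

lemma IsLead.homogeneousComponent {f : MvPolynomial σ F} {a : σ →₀ ℕ} {k : ℕ}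
    (hf : IsLead pos w f a) (ha : a.degree = k) :
    IsLead pos w (MvPolynomial.homogeneousComponent k f) a := by
  refine hf.of_support_subset ?_ fun b hb => ?_
  · rw [mem_support_iff, coeff_homogeneousComponent, if_pos ha]
    exact mem_support_iff.mp hf.1
  · rw [mem_support_iff, coeff_homogeneousComponent] at hb
    rw [mem_support_iff]
    intro h
    simp [h] at hb

lemma IsLead.monomial_mul {f : MvPolynomial σ F} {a : σ →₀ ℕ} (hf : IsLead pos w f a)
    (c : σ →₀ ℕ) : IsLead pos w (MvPolynomial.monomial c 1 * f) (a + c) := by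
  classical
  constructor
  · rw [mem_support_iff, add_comm, coeff_monomial_mul, one_mul]
    exact mem_support_iff.mp hf.1
  · intro b hb hne
    rw [mem_support_iff, coeff_monomial_mul'] at hb
    split_ifs at hb with hcb
    · rw [one_mul] at hb
      have h1 := hf.2 (b - c) (mem_support_iff.mpr hb) (by
        rintro rfl
        exact hne (tsub_add_cancel_of_le hcb).symm)
      have h2 := h1.add_right c
      rwa [tsub_add_cancel_of_le hcb] at h2
    · exact absurd rfl hb

lemma exists_isLead [Finite σ] (hpos : Function.Injective pos) {f : MvPolynomial σ F}
    (hf : f ≠ 0) : ∃ a, IsLead pos w f a := by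
  classical
  have key : ∀ s : Finset (σ →₀ ℕ), s.Nonempty → ∃ a ∈ s, ∀ b ∈ s, b ≠ a → WLT pos w b a := by
    intro s hs
    induction hs using Finset.Nonempty.cons_induction with
    | singleton a => exact ⟨a, by simp, by simp⟩
    | cons x s hx hs ih =>
      obtain ⟨a, ha, hmax⟩ := ih
      rcases WLT.total (pos := pos) (w := w) (show x ≠ a by rintro rfl; exact hx ha) with h | h
      · refine ⟨a, by simp [ha], fun b hb hne => ?_⟩
        rcases Finset.mem_cons.mp hb with rfl | hb
        exacts [h, hmax b hb hne]
      · refine ⟨x, by simp, fun b hb hne => ?_⟩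
        rcases Finset.mem_cons.mp hb with rfl | hb
        · exact absurd rfl hne
        · by_cases hba : b = a
          · rwa [hba]
          · exact (hmax b hb hba).trans hpos h
  exact key f.support (support_nonempty.mpr hf)

end Order

/-! ### Dimensions of images of spaces of forms -/

section Dimension

variable {F : Type*} [Field F] {σ : Type*} [Fintype σ] {V : Type*} [AddCommGroup V] [Module F V]

lemma homogeneousSubmodule_eq_span (k : ℕ) : homogeneousSubmodule σ F k =
    Submodule.span F ((fun a => monomial a (1 : F)) '' (degreeExps σ k : Set (σ →₀ ℕ))) := by
  apply le_antisymm
  · intro f hf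
    rw [mem_homogeneousSubmodule] at hf
    rw [f.as_sum]
    refine Submodule.sum_mem _ fun a ha => ?_
    have : monomial a (coeff a f) = coeff a f • monomial a (1 : F) := by
      rw [smul_monomial, smul_eq_mul, mul_one]
    rw [this]
    refine Submodule.smul_mem _ _ (Submodule.subset_span ⟨a, ?_, rfl⟩)
    have h1 := hf (mem_support_iff.mp ha)
    rw [Finset.mem_coe, mem_degreeExps, Finsupp.degree_eq_weight_one]
    exact h1
  · rw [Submodule.span_le]
    rintro _ ⟨a, ha, rfl⟩
    rw [Finset.mem_coe, mem_degreeExps] at ha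
    exact isHomogeneous_monomial _ ha

instance (k : ℕ) : Module.Finite F (homogeneousSubmodule σ F k) := by
  rw [homogeneousSubmodule_eq_span]
  exact Module.Finite.span_of_finite F ((Finset.finite_toSet _).image _)

/-- Linearly independent images of forms of degree `k` bound the dimension from below. -/
lemma card_le_finrank_map (φ : MvPolynomial σ F →ₗ[F] V) (k : ℕ) {ι : Type*} [Fintype ι]
    (g : ι → MvPolynomial σ F) (hg : ∀ i, (g i).IsHomogeneous k)
    (hli : LinearIndependent F fun i => φ (g i)) :
    Fintype.card ι ≤ Module.finrank F ((homogeneousSubmodule σ F k).map φ) := by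
  have h : LinearIndependent F fun i => (⟨φ (g i), Submodule.mem_map_of_mem (hg i)⟩ :
      (homogeneousSubmodule σ F k).map φ) :=
    LinearIndependent.of_comp ((homogeneousSubmodule σ F k).map φ).subtype hli
  exact h.fintype_card_le_finrank

variable {pos w : σ → ℕ}

/-- If every exponent of degree `k` outside of `B` is a leading exponent of a form in the kernel,
then the exponents in `B` bound the dimension of the image from above. -/
lemma finrank_map_le_card (hpos : Function.Injective pos) (φ : MvPolynomial σ F →ₗ[F] V) (k : ℕ)
    (B : Finset (σ →₀ ℕ)) (hB : ∀ a : σ →₀ ℕ, a.degree = k → a ∉ B →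
      ∃ f, φ f = 0 ∧ f.IsHomogeneous k ∧ IsLead pos w f a) :
    Module.finrank F ((homogeneousSubmodule σ F k).map φ) ≤ B.card := by
  classical
  let W := Submodule.span F ((B.image fun a => φ (monomial a 1) : Finset V) : Set V)
  have key : ∀ a : σ →₀ ℕ, a.degree = k → φ (monomial a 1) ∈ W := by
    intro a
    induction a using (WLT.wellFounded (w := w) hpos).induction with
    | _ a ih =>
      intro ha
      by_cases haB : a ∈ B
      · exact Submodule.subset_span (by
          rw [Finset.mem_coe]; exact Finset.mem_image_of_mem _ haB)
      obtain ⟨f, hf, hk, hlead⟩ := hB a ha haB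
      have h1 : φ f = ∑ b ∈ f.support, coeff b f • φ (monomial b 1) := by
        conv_lhs => rw [f.as_sum, map_sum]
        refine Finset.sum_congr rfl fun b _ => ?_
        rw [← map_smul, smul_monomial, smul_eq_mul, mul_one]
      rw [hf, ← Finset.add_sum_erase _ _ hlead.1] at h1
      have h2 : ∑ b ∈ f.support.erase a, coeff b f • φ (monomial b 1) ∈ W := by
        refine Submodule.sum_mem _ fun b hb => Submodule.smul_mem _ _ ?_
        rw [Finset.mem_erase] at hb
        refine ih b (hlead.2 b hb.2 hb.1) ?_
        rw [Finsupp.degree_eq_weight_one]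
        exact hk (mem_support_iff.mp hb.2)
      have h3 : coeff a f • φ (monomial a 1) ∈ W := by
        rw [eq_neg_of_add_eq_zero_left h1.symm]
        exact Submodule.neg_mem _ h2
      exact (Submodule.smul_mem_iff _ (mem_support_iff.mp hlead.1)).mp h3
  have hle : (homogeneousSubmodule σ F k).map φ ≤ W := by
    rw [homogeneousSubmodule_eq_span, Submodule.map_span, Submodule.span_le]
    rintro _ ⟨_, ⟨a, ha, rfl⟩, rfl⟩
    exact key a (mem_degreeExps.mp ha)
  have : Module.Finite F W := Module.Finite.span_of_finite F (Finset.finite_toSet _)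
  refine (Submodule.finrank_mono hle).trans ((finrank_span_finset_le_card _).trans ?_)
  exact Finset.card_image_le

/-- If no form in the kernel has a leading exponent in `B`, then the exponents in `B` bound the
dimension of the image from below. -/
lemma card_le_finrank_map_of_isLead (hpos : Function.Injective pos)
    (φ : MvPolynomial σ F →ₗ[F] V) (k : ℕ) (B : Finset (σ →₀ ℕ)) (hdeg : ∀ a ∈ B, a.degree = k)
    (hB : ∀ a ∈ B, ∀ f, φ f = 0 → ¬ IsLead pos w f a) :
    B.card ≤ Module.finrank F ((homogeneousSubmodule σ F k).map φ) := by
  classical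
  have h := card_le_finrank_map φ k (fun a : B => monomial (a : σ →₀ ℕ) (1 : F))
    (fun a => isHomogeneous_monomial _ (hdeg a a.2)) ?_
  · simpa using h
  rw [Fintype.linearIndependent_iff]
  intro g hg i
  by_contra hi
  let f : MvPolynomial σ F := ∑ a : B, g a • monomial (a : σ →₀ ℕ) (1 : F)
  have hcoeff : ∀ b : B, coeff b f = g b := by
    intro b
    simp only [f, coeff_sum, coeff_smul, coeff_monomial, smul_eq_mul, mul_ite, mul_one, mul_zero]
    rw [Finset.sum_eq_single b]
    · simp
    · intro c _ hc
      rw [if_neg]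
      exact fun h => hc (Subtype.ext h)
    · simp
  have hne : f ≠ 0 := by
    intro h0
    have := hcoeff i
    rw [h0, coeff_zero] at this
    exact hi this.symm
  obtain ⟨a, ha⟩ := exists_isLead (w := w) hpos hne
  have haB : a ∈ B := by
    by_contra hcon
    refine mem_support_iff.mp ha.1 ?_
    simp only [f, coeff_sum, coeff_smul, coeff_monomial, smul_eq_mul]
    refine Finset.sum_eq_zero fun c _ => ?_
    rw [if_neg, mul_zero]
    rintro rfl
    exact hcon c.2
  refine hB a haB f ?_ ha
  simp only [f, map_sum, map_smul]
  exact hg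

end Dimension

/-! ### Counting monomials by their supports -/

section SupportPolynomial

variable {σ : Type*} [DecidableEq σ]

/-- The polynomial that counts the exponents with support `S` in all large degrees. -/
def supportPoly (S : Finset σ) : Polynomial ℚ :=
  if S = ∅ then 0 else Polynomial.preHilbertPoly ℚ (S.card - 1) S.card

lemma natDegree_supportPoly_le {S : Finset σ} {k : ℕ} (hS : S.card ≤ k + 1) :
    (supportPoly S).natDegree ≤ k := by
  rw [supportPoly]
  split_ifs
  · simp
  · rw [Polynomial.natDegree_preHilbertPoly]
    omega

lemma coeff_supportPoly {S : Finset σ} {k : ℕ} (hS : S.card ≤ k + 1) :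
    (supportPoly S).coeff k = if S.card = k + 1 then (k.factorial : ℚ)⁻¹ else 0 := by
  split_ifs with h
  · rw [supportPoly, if_neg (by rintro rfl; simp at h), h]
    exact Polynomial.coeff_preHilbertPoly_self ℚ k _
  · rcases Nat.eq_zero_or_pos k with rfl | hk
    · have : S = ∅ := by
        rw [← Finset.card_eq_zero]
        omega
      simp [supportPoly, this]
    · refine Polynomial.coeff_eq_zero_of_natDegree_lt ?_
      have := natDegree_supportPoly_le (S := S) (k := k - 1) (by omega)
      omega

/-- The polynomial that counts the exponents with support in `D` in all large degrees. -/
def supportedPoly (D : Finset (Finset σ)) : Polynomial ℚ := ∑ S ∈ D, supportPoly S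

lemma natDegree_supportedPoly_le {D : Finset (Finset σ)} {k : ℕ}
    (hD : ∀ S ∈ D, S.card ≤ k + 1) : (supportedPoly D).natDegree ≤ k :=
  Polynomial.natDegree_sum_le_of_forall_le _ _ fun S hS => natDegree_supportPoly_le (hD S hS)

lemma coeff_supportedPoly {D : Finset (Finset σ)} {k : ℕ} (hD : ∀ S ∈ D, S.card ≤ k + 1) :
    (supportedPoly D).coeff k =
      ((D.filter fun S => S.card = k + 1).card : ℚ) * (k.factorial : ℚ)⁻¹ := by
  rw [supportedPoly, Polynomial.finsetSum_coeff,
    Finset.sum_congr rfl fun S hS => coeff_supportPoly (hD S hS), ← Finset.sum_filter,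
    Finset.sum_const, nsmul_eq_mul]

/-- The Hilbert polynomial of a complex of dimension `k` with `e` faces of the maximal size. -/
lemma supportedPoly_multiplicity {D : Finset (Finset σ)} {k e : ℕ}
    (hD : ∀ S ∈ D, S.card ≤ k + 1) (he : (D.filter fun S => S.card = k + 1).card = e)
    (hpos : e ≠ 0) : supportedPoly D ≠ 0 ∧
      (e : ℚ) = ((supportedPoly D).natDegree.factorial : ℚ) * (supportedPoly D).leadingCoeff := by
  have hk : (k.factorial : ℚ) ≠ 0 := by positivity
  have hcoeff := coeff_supportedPoly hD
  rw [he] at hcoeff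
  have hne : (supportedPoly D).coeff k ≠ 0 := by
    rw [hcoeff]
    exact mul_ne_zero (by exact_mod_cast hpos) (inv_ne_zero hk)
  have hdeg : (supportedPoly D).natDegree = k :=
    le_antisymm (natDegree_supportedPoly_le hD) (Polynomial.le_natDegree_of_ne_zero hne)
  refine ⟨fun h => hne (by rw [h, Polynomial.coeff_zero]), ?_⟩
  rw [Polynomial.leadingCoeff, hdeg, hcoeff]
  field_simp

end SupportPolynomial

section Counting

variable {σ : Type*} [Fintype σ] [DecidableEq σ]

/-- The exponents of degree `N` whose support is `S`. -/
def supportExps (S : Finset σ) (N : ℕ) : Finset (σ →₀ ℕ) :=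
  (degreeExps σ N).filter fun a => a.support = S

/-- The exponents of degree `N` whose support belongs to `D`. -/
def supportedExps (D : Finset (Finset σ)) (N : ℕ) : Finset (σ →₀ ℕ) :=
  (degreeExps σ N).filter fun a => a.support ∈ D

lemma mem_supportExps {S : Finset σ} {N : ℕ} {a : σ →₀ ℕ} :
    a ∈ supportExps S N ↔ a.degree = N ∧ a.support = S := by
  simp [supportExps, mem_degreeExps]

lemma mem_supportedExps {D : Finset (Finset σ)} {N : ℕ} {a : σ →₀ ℕ} :
    a ∈ supportedExps D N ↔ a.degree = N ∧ a.support ∈ D := by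
  simp [supportedExps, mem_degreeExps]

lemma card_supportExps {S : Finset σ} (hS : S.Nonempty) {N : ℕ} (hN : S.card ≤ N) :
    (supportExps S N).card = (N - S.card + (S.card - 1)).choose (S.card - 1) := by
  have hpos := hS.card_pos
  have h1 : (supportExps S N).card = (S.finsuppAntidiag (N - S.card)).card := by
    -- subtract one from every exponent in the support
    let u : σ →₀ ℕ := Finsupp.indicator S fun _ _ => 1
    have hu : ∀ i, u i = if i ∈ S then 1 else 0 := fun i => by
      simp [u, Finsupp.indicator_apply]
    have hudeg : u.degree = S.card := by
      rw [Finsupp.degree_eq_sum]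
      simp [hu]
    refine Finset.card_nbij' (fun a => a - u) (fun b => b + u) ?_ ?_ ?_ ?_
    · intro a ha
      rw [Finset.mem_coe, mem_supportExps] at ha
      have hle : u ≤ a := by
        intro i
        rw [hu]
        split_ifs with hi
        · rw [← ha.2, Finsupp.mem_support_iff] at hi
          omega
        · omega
      have h2 : (a - u).degree = N - S.card := by
        have := congrArg Finsupp.degree (tsub_add_cancel_of_le hle)
        rw [map_add, hudeg, ha.1] at this
        omega
      have h3 : (a - u).support ⊆ S := by
        intro i hi
        rw [← ha.2, Finsupp.mem_support_iff]
        rw [Finsupp.mem_support_iff, Finsupp.tsub_apply] at hi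
        omega
      rw [Finset.mem_coe, Finset.mem_finsuppAntidiag]
      refine ⟨?_, h3⟩
      rw [← h2, Finsupp.degree_eq_sum]
      refine Finset.sum_subset (Finset.subset_univ _) fun i _ hi => ?_
      by_contra hcon
      exact hi (h3 (Finsupp.mem_support_iff.mpr hcon))
    · intro b hb
      rw [Finset.mem_coe, Finset.mem_finsuppAntidiag] at hb
      rw [Finset.mem_coe, mem_supportExps]
      constructor
      · rw [map_add, hudeg, Finsupp.degree_eq_sum,
          ← Finset.sum_subset (Finset.subset_univ S) (fun i _ hi => ?_), hb.1]
        · omega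
        · by_contra hcon
          exact hi (hb.2 (Finsupp.mem_support_iff.mpr hcon))
      · ext i
        rw [Finsupp.mem_support_iff, Finsupp.add_apply, hu]
        by_cases hi : i ∈ S
        · simp [hi]
        · have : b i = 0 := by
            by_contra hcon
            exact hi (hb.2 (Finsupp.mem_support_iff.mpr hcon))
          simp [hi, this]
    · intro a ha
      rw [Finset.mem_coe, mem_supportExps] at ha
      ext i
      simp only [Finsupp.add_apply, Finsupp.tsub_apply, hu]
      split_ifs with hi
      · rw [← ha.2, Finsupp.mem_support_iff] at hi
        omega
      · omega
    · intro b _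
      simp
  rw [h1, Finset.card_finsuppAntidiag_nat_eq_choose,
    show S.card + (N - S.card) - 1 = N - S.card + (S.card - 1) by omega, Nat.choose_symm_add]

lemma eval_supportPoly (S : Finset σ) {N : ℕ} (hN : Fintype.card σ < N) :
    (supportPoly S).eval (N : ℚ) = (supportExps S N).card := by
  have hle : S.card ≤ N := (Finset.card_le_univ S).trans hN.le
  rw [supportPoly]
  split_ifs with h
  · subst h
    rw [Polynomial.eval_zero, eq_comm, Nat.cast_eq_zero, Finset.card_eq_zero,
      Finset.eq_empty_iff_forall_notMem]
    intro a ha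
    rw [mem_supportExps, Finsupp.support_eq_empty] at ha
    rw [ha.2, map_zero] at ha
    omega
  · rw [card_supportExps (Finset.nonempty_iff_ne_empty.mpr h) hle,
      Polynomial.preHilbertPoly_eq_choose_sub_add ℚ _ hle]

lemma card_supportedExps (D : Finset (Finset σ)) (N : ℕ) :
    (supportedExps D N).card = ∑ S ∈ D, (supportExps S N).card := by
  rw [Finset.card_eq_sum_card_fiberwise (f := fun a : σ →₀ ℕ => a.support) (t := D)]
  · refine Finset.sum_congr rfl fun S hS => ?_
    congr 1
    ext a
    simp only [Finset.mem_filter, mem_supportedExps, mem_supportExps]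
    constructor
    · exact fun h => ⟨h.1.1, h.2⟩
    · exact fun h => ⟨⟨h.1, h.2 ▸ hS⟩, h.2⟩
  · intro a ha
    exact (mem_supportedExps.mp ha).2

lemma eval_supportedPoly (D : Finset (Finset σ)) {N : ℕ} (hN : Fintype.card σ < N) :
    (supportedPoly D).eval (N : ℚ) = (supportedExps D N).card := by
  rw [supportedPoly, Polynomial.eval_finsetSum, card_supportedExps, Nat.cast_sum]
  exact Finset.sum_congr rfl fun S _ => eval_supportPoly S hN

end Counting

lemma coeff_le_coeff_of_eventually_le {P Q : Polynomial ℚ} {k : ℕ} (hP : P.natDegree ≤ k)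
    (hQ : Q.natDegree ≤ k)
    (h : ∀ᶠ N : ℕ in Filter.atTop, P.eval (N : ℚ) ≤ Q.eval (N : ℚ)) : P.coeff k ≤ Q.coeff k := by
  by_contra hcon
  push Not at hcon
  have hc : (Q - P).coeff k < 0 := by
    rw [Polynomial.coeff_sub]
    linarith
  have hdeg : (Q - P).natDegree = k :=
    le_antisymm ((Polynomial.natDegree_sub_le _ _).trans (max_le hQ hP))
      (Polynomial.le_natDegree_of_ne_zero hc.ne)
  have hlead : (Q - P).leadingCoeff < 0 := by rwa [Polynomial.leadingCoeff, hdeg]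
  have h' : ∀ᶠ N : ℕ in Filter.atTop, 0 ≤ (Q - P).eval (N : ℚ) := by
    filter_upwards [h] with N hN
    rw [Polynomial.eval_sub]
    linarith
  rcases Nat.eq_zero_or_pos k with rfl | hk
  · rw [Polynomial.eq_C_of_natDegree_eq_zero hdeg] at h'
    obtain ⟨N, hN⟩ := h'.exists
    rw [Polynomial.eval_C] at hN
    linarith
  · have ht := ((Q - P).tendsto_atBot_of_leadingCoeff_nonpos
      (Polynomial.natDegree_pos_iff_degree_pos.mp (by omega)) hlead.le).comp
      (tendsto_natCast_atTop_atTop (R := ℚ))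
    obtain ⟨N, hN, hN'⟩ := (h'.and (ht.eventually (Filter.eventually_lt_atBot 0))).exists
    simp only [Function.comp_apply] at hN'
    linarith

section Counting

variable {σ : Type*} [Fintype σ] [DecidableEq σ]

/-- If `D` has at least as many monomials as `E` in all large degrees, then it has at least as many
sets of the maximal size. -/
lemma card_filter_le_of_eventually_le {D E : Finset (Finset σ)} {k : ℕ}
    (hD : ∀ S ∈ D, S.card ≤ k + 1) (hE : ∀ S ∈ E, S.card = k + 1)
    (h : ∀ᶠ N : ℕ in Filter.atTop, (supportedExps E N).card ≤ (supportedExps D N).card) :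
    E.card ≤ (D.filter fun S => S.card = k + 1).card := by
  have h1 := coeff_le_coeff_of_eventually_le
    (natDegree_supportedPoly_le fun S hS => (hE S hS).le) (natDegree_supportedPoly_le hD) (by
      filter_upwards [h, Filter.eventually_gt_atTop (Fintype.card σ)] with N hN hN'
      rw [eval_supportedPoly _ hN', eval_supportedPoly _ hN']
      exact_mod_cast hN)
  rw [coeff_supportedPoly hD, coeff_supportedPoly fun S hS => (hE S hS).le,
    Finset.filter_true_of_mem hE] at h1
  have h2 : (0 : ℚ) < (k.factorial : ℚ)⁻¹ := by positivity
  exact_mod_cast (mul_le_mul_iff_left₀ h2).mp h1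

/-- If, moreover, `D` and `E` have the same number of sets of the maximal size, then the multiples
of a monomial whose support lies in a set of maximal size of `D` cannot be dispensed with. -/
lemma not_eventually_card_add_le {D E : Finset (Finset σ)} {k : ℕ}
    (hD : ∀ S ∈ D, S.card ≤ k + 1) (hE : ∀ S ∈ E, S.card = k + 1)
    (hcard : (D.filter fun S => S.card = k + 1).card ≤ E.card) {S : Finset σ}
    (hSk : S.card = k + 1) (r : ℕ) :
    ¬ ∀ᶠ N : ℕ in Filter.atTop,
      (supportedExps E N).card + (supportExps S (N - r)).card ≤ (supportedExps D N).card := by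
  intro h
  have hS : S.Nonempty := Finset.card_pos.mp (by omega)
  have h1 := coeff_le_coeff_of_eventually_le
    (P := supportedPoly E + Polynomial.preHilbertPoly ℚ k (k + 1 + r))
    ((Polynomial.natDegree_add_le _ _).trans (max_le
      (natDegree_supportedPoly_le fun S hS => (hE S hS).le)
      (Polynomial.natDegree_preHilbertPoly ℚ k _).le)) (natDegree_supportedPoly_le hD) (by
      filter_upwards [h, Filter.eventually_gt_atTop (Fintype.card σ),
        Filter.eventually_ge_atTop (k + 1 + r)] with N hN hN' hN''
      rw [Polynomial.eval_add, eval_supportedPoly _ hN', eval_supportedPoly _ hN',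
        Polynomial.preHilbertPoly_eq_choose_sub_add ℚ _ hN'']
      rw [card_supportExps hS (by omega), hSk, show N - r - (k + 1) = N - (k + 1 + r) by omega,
        Nat.add_sub_cancel] at hN
      exact_mod_cast hN)
  rw [Polynomial.coeff_add, coeff_supportedPoly hD, coeff_supportedPoly fun S hS => (hE S hS).le,
    Finset.filter_true_of_mem hE, Polynomial.coeff_preHilbertPoly_self] at h1
  have h2 : (0 : ℚ) < (k.factorial : ℚ)⁻¹ := by positivity
  have h3 : ((D.filter fun S => S.card = k + 1).card : ℚ) ≤ E.card := by exact_mod_cast hcard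
  nlinarith

end Counting

/-! ### The initial complex and its generators -/

section Positions

variable {m n : ℕ}

lemma lex_pos_lt {i j i' j' n : ℕ} (hj : j < n) (h : i < i' ∨ (i = i' ∧ j < j')) :
    i * n + j < i' * n + j' := by
  rcases h with h | ⟨rfl, h⟩
  · have : (i + 1) * n ≤ i' * n := Nat.mul_le_mul_right n h
    rw [add_mul, one_mul] at this
    omega
  · omega

lemma varPos_inr_lt {p q : Fin m × Fin n} (h : p.1 < q.1 ∨ (p.1 = q.1 ∧ p.2 < q.2)) :
    varPos (Sum.inr p) < varPos (Sum.inr q) := by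
  refine lex_pos_lt p.2.isLt ?_
  rcases h with h | h
  · exact Or.inl h
  · exact Or.inr ⟨congrArg Fin.val h.1, h.2⟩

lemma varPos_inl_lt {p q : Fin m × Fin n} (h : p.1 < q.1 ∨ (p.1 = q.1 ∧ p.2 < q.2)) :
    varPos (Sum.inl p) < varPos (Sum.inl q) :=
  Nat.add_lt_add_left (varPos_inr_lt h) _

lemma varPos_inr_lt_inl (p q : Fin m × Fin n) : varPos (Sum.inr p) < varPos (Sum.inl q) := by
  have h1 : varPos (Sum.inr p : Var m n) < m * n := by
    have : (p.1 : ℕ) * n + p.2 < m * n + 0 := lex_pos_lt p.2.isLt (Or.inl p.1.isLt)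
    simpa [varPos] using this
  exact h1.trans_le (Nat.le_add_right _ _)

lemma lex_cases {p q : Fin m × Fin n} (h : p ≠ q) :
    (p.1 < q.1 ∨ (p.1 = q.1 ∧ p.2 < q.2)) ∨ (q.1 < p.1 ∨ (q.1 = p.1 ∧ q.2 < p.2)) := by
  rcases lt_trichotomy p.1 q.1 with h1 | h1 | h1
  · exact Or.inl (Or.inl h1)
  · rcases lt_trichotomy p.2 q.2 with h2 | h2 | h2
    · exact Or.inl (Or.inr ⟨h1, h2⟩)
    · exact absurd (Prod.ext h1 h2) h
    · exact Or.inr (Or.inr ⟨h1.symm, h2⟩)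
  · exact Or.inr (Or.inl h1)

lemma varPos_injective : Function.Injective (varPos : Var m n → ℕ) := by
  rintro (p | p) (q | q) h
  · by_contra hne
    rcases lex_cases (fun h' : p = q => hne (congrArg _ h')) with h' | h'
    · exact absurd h (varPos_inl_lt h').ne
    · exact absurd h (varPos_inl_lt h').ne'
  · exact absurd h (varPos_inr_lt_inl q p).ne'
  · exact absurd h (varPos_inr_lt_inl p q).ne
  · by_contra hne
    rcases lex_cases (fun h' : p = q => hne (congrArg _ h')) with h' | h'
    · exact absurd h (varPos_inr_lt h').ne
    · exact absurd h (varPos_inr_lt h').ne'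

/-- The weight with value `c` on all `x`-variables and `0` on all `y`-variables. For `c = 0` the
order `WLT varPos (xWeight 0)` is the graded reverse lexicographical order; for `c = 1` it prefers,
among the monomials of the same degree, those of larger degree in the `x`-variables. -/
def xWeight (c : ℕ) : Var m n → ℕ := Sum.elim (fun _ => c) fun _ => 0

lemma grevlexLT_iff {a b : Var m n →₀ ℕ} : GrevlexLT a b ↔ WLT varPos (xWeight 0) a b := by
  have h : ∀ a : Var m n →₀ ℕ, Finsupp.weight (xWeight 0) a = 0 := by
    intro a
    have : (xWeight 0 : Var m n → ℕ) = 0 := by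
      ext (v | v) <;> rfl
    rw [Finsupp.weight_apply, this]
    simp [Finsupp.sum]
  simp [GrevlexLT, WLT, h]

lemma isLeadingMonomial_iff {F : Type*} [Field F] {f : MvPolynomial (Var m n) F}
    {a : Var m n →₀ ℕ} : IsLeadingMonomial f a ↔ IsLead varPos (xWeight 0) f a := by
  simp only [IsLeadingMonomial, IsLead, grevlexLT_iff]

end Positions

section Products

variable {σ : Type*} {pos w : σ → ℕ} {F : Type*} [Field F]

local notation "ε" v:max => Finsupp.single v (1 : ℕ)

lemma X_mul_X (u v : σ) : (X u * X v : MvPolynomial σ F) = monomial (ε u + ε v) 1 := by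
  simp [X, monomial_mul]

lemma X_mul_X_mul_X (u v t : σ) :
    (X u * X v * X t : MvPolynomial σ F) = monomial (ε u + ε v + ε t) 1 := by
  simp [X, monomial_mul]

lemma weight_single_one (v : σ) : Finsupp.weight w (ε v) = w v := by
  simp [Finsupp.weight_single]

lemma WLT.pair {v₁ v₂ u₁ u₂ : σ} (hw : w v₁ + w v₂ = w u₁ + w u₂) (hv : pos v₁ < pos v₂)
    (h₁ : pos u₁ < pos v₂) (h₂ : pos u₂ < pos v₂) :
    WLT pos w (ε v₁ + ε v₂) (ε u₁ + ε u₂) := by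
  classical
  have hne : ∀ {a b : σ}, pos a < pos b → (ε a) b = 0 := fun {a b} h =>
    Finsupp.single_eq_of_ne (by rintro rfl; exact lt_irrefl _ h)
  refine WLT.of_last (by simp) (by simp only [map_add, weight_single_one, hw]) v₂ (by simp)
    (fun u hu => ?_) (fun u hu => ?_)
  · rw [Finsupp.add_apply, hne (hv.trans hu), hne hu]
  · rw [Finsupp.add_apply, hne (h₁.trans_le hu), hne (h₂.trans_le hu)]

lemma WLT.triple {v₁ v₂ v₃ u₁ u₂ u₃ : σ} (hw : w v₁ + w v₂ + w v₃ = w u₁ + w u₂ + w u₃)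
    (hv₁ : pos v₁ < pos v₃) (hv₂ : pos v₂ < pos v₃) (h₁ : pos u₁ < pos v₃) (h₂ : pos u₂ < pos v₃)
    (h₃ : pos u₃ < pos v₃) : WLT pos w (ε v₁ + ε v₂ + ε v₃) (ε u₁ + ε u₂ + ε u₃) := by
  classical
  have hne : ∀ {a b : σ}, pos a < pos b → (ε a) b = 0 := fun {a b} h =>
    Finsupp.single_eq_of_ne (by rintro rfl; exact lt_irrefl _ h)
  refine WLT.of_last (by simp) (by simp only [map_add, weight_single_one, hw]) v₃ (by simp)
    (fun u hu => ?_) (fun u hu => ?_)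
  · rw [Finsupp.add_apply, Finsupp.add_apply, hne (hv₁.trans hu), hne (hv₂.trans hu), hne hu]
  · rw [Finsupp.add_apply, Finsupp.add_apply, hne (h₁.trans_le hu), hne (h₂.trans_le hu),
      hne (h₃.trans_le hu)]

variable (F) in
/-- The determinant of the `3 × 3` matrix of variables with rows `(a, b, c)`, `(d, e, f)` and
`(g, h, i)`, with the sign that makes the antidiagonal term `c * e * g` positive. -/
def detThree (a b c d e f g h i : σ) : MvPolynomial σ F :=
  X c * X e * X g - X b * X f * X g + X a * X f * X h - X a * X e * X i + X b * X d * X i -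
    X c * X d * X h

lemma isLead_detThree {a b c d e f g h i : σ} (hcf : pos c < pos f) (hef : pos e < pos f)
    (hbf : pos b < pos f) (hag : pos a < pos g) (hdg : pos d < pos g) (hfg : pos f < pos g)
    (hgh : pos g < pos h) (hgi : pos g < pos i) (hab : w a = w b) (hac : w a = w c)
    (hde : w d = w e) (hdf : w d = w f) (hwgh : w g = w h) (hwgi : w g = w i) :
    IsLead pos w (detThree F a b c d e f g h i) (ε c + ε e + ε g) := by
  refine IsLead.of_isBelow (g := -(X b * X f * X g) + X a * X f * X h + -(X a * X e * X i) +
    X b * X d * X i + -(X c * X d * X h)) ?_ ?_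
  · simp only [X_mul_X_mul_X]
    refine ((((IsBelow.neg (.monomial ?_ _)).add (.monomial ?_ _)).add
      (.neg (.monomial ?_ _))).add (.monomial ?_ _)).add (.neg (.monomial ?_ _))
    · exact (WLT.pair (by omega) hbf hcf hef).add_right _
    all_goals exact WLT.triple (by omega) (by omega) (by omega) (by omega) (by omega) (by omega)
  · rw [← X_mul_X_mul_X, detThree]
    ring

end Products

section Generators

variable {m n : ℕ}

/-- The nonzero squarefree monomials modulo the initial ideal: `S` contains none of the supports
of the leading monomials of the two by two minors of `(x)`, of their derivatives, and of the three
by three minors of the two matrices obtained by putting `(x)` below `(y)` and to the right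
of `(y)`. -/
structure Standard (S : Finset (Var m n)) : Prop where
  xx : ∀ p q, Sum.inl p ∈ S → Sum.inl q ∈ S → p.1 < q.1 → ¬ q.2 < p.2
  xy : ∀ p q, Sum.inl p ∈ S → Sum.inr q ∈ S → p.1 < q.1 → ¬ p.2 < q.2
  yyy : ∀ p q s, Sum.inr p ∈ S → Sum.inr q ∈ S → Sum.inr s ∈ S →
    p.1 < q.1 → q.2 < p.2 → q.1 < s.1 → ¬ s.2 < q.2
  below : ∀ p q s, Sum.inr p ∈ S → Sum.inr q ∈ S → Sum.inl s ∈ S →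
    p.1 < q.1 → q.2 < p.2 → ¬ s.2 < q.2
  right : ∀ p q s, Sum.inr p ∈ S → Sum.inr q ∈ S → Sum.inl s ∈ S →
    p.1 < q.1 → q.2 < p.2 → ¬ s.1 < p.1

variable {F : Type*} [Field F]

/-- The ideal `I` contains the two by two minors of `(x)`, their derivatives up to the multiple by
`δ` of the corresponding minors of `(y)`, and the three by three minors of the two matrices obtained
by putting `(x)` below `(y)` and to the right of `(y)`. -/
structure ContainsMinors (I : Ideal (MvPolynomial (Var m n) F)) (δ : F) : Prop where
  xx : ∀ i k j l, (X (Sum.inl (i, j)) * X (Sum.inl (k, l)) -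
    X (Sum.inl (i, l)) * X (Sum.inl (k, j)) : MvPolynomial (Var m n) F) ∈ I
  xy : ∀ i k j l, (X (Sum.inl (i, j)) * X (Sum.inr (k, l)) +
    X (Sum.inl (k, l)) * X (Sum.inr (i, j)) - X (Sum.inl (i, l)) * X (Sum.inr (k, j)) -
    X (Sum.inl (k, j)) * X (Sum.inr (i, l)) +
    C δ * (X (Sum.inr (i, j)) * X (Sum.inr (k, l)) -
      X (Sum.inr (i, l)) * X (Sum.inr (k, j))) : MvPolynomial (Var m n) F) ∈ I
  yyy : ∀ i k l a b c, detThree F (Sum.inr (i, a)) (Sum.inr (i, b)) (Sum.inr (i, c))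
    (Sum.inr (k, a)) (Sum.inr (k, b)) (Sum.inr (k, c))
    (Sum.inr (l, a)) (Sum.inr (l, b)) (Sum.inr (l, c)) ∈ I
  below : ∀ i k l a b c, detThree F (Sum.inr (i, a)) (Sum.inr (i, b)) (Sum.inr (i, c))
    (Sum.inr (k, a)) (Sum.inr (k, b)) (Sum.inr (k, c))
    (Sum.inl (l, a)) (Sum.inl (l, b)) (Sum.inl (l, c)) ∈ I
  right : ∀ i k l a b c, detThree F (Sum.inr (a, i)) (Sum.inr (b, i)) (Sum.inr (c, i))
    (Sum.inr (a, k)) (Sum.inr (b, k)) (Sum.inr (c, k))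
    (Sum.inl (a, l)) (Sum.inl (b, l)) (Sum.inl (c, l)) ∈ I

lemma exists_isLead_of_le {σ : Type*} {pos w : σ → ℕ} {I : Ideal (MvPolynomial σ F)}
    {f : MvPolynomial σ F} (hf : f ∈ I) {a b : σ →₀ ℕ} (hlead : IsLead pos w f b) (hb : b ≤ a) :
    ∃ f ∈ I, IsLead pos w f a := by
  refine ⟨_, I.mul_mem_left (monomial (a - b) 1) hf, ?_⟩
  have := hlead.monomial_mul (a - b)
  rwa [add_tsub_cancel_of_le hb] at this

lemma single_add_single_le {σ : Type*} {a : σ →₀ ℕ} {u v : σ} (huv : u ≠ v) (hu : u ∈ a.support)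
    (hv : v ∈ a.support) : Finsupp.single u 1 + Finsupp.single v 1 ≤ a := by
  classical
  intro x
  rw [Finsupp.mem_support_iff] at hu hv
  simp only [Finsupp.add_apply, Finsupp.single_apply]
  split_ifs with h1 h2 h2
  · exact absurd (h1.trans h2.symm) huv
  · subst h1; omega
  · subst h2; omega
  · omega

lemma single_add_single_add_single_le {σ : Type*} {a : σ →₀ ℕ} {u v t : σ} (huv : u ≠ v)
    (hut : u ≠ t) (hvt : v ≠ t) (hu : u ∈ a.support) (hv : v ∈ a.support) (ht : t ∈ a.support) :
    Finsupp.single u 1 + Finsupp.single v 1 + Finsupp.single t 1 ≤ a := by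
  classical
  intro x
  have h := single_add_single_le huv hu hv x
  rw [Finsupp.add_apply, Finsupp.single_apply (a := t)]
  split_ifs with h1
  · subst h1
    rw [Finsupp.mem_support_iff] at ht
    rw [Finsupp.add_apply, Finsupp.single_eq_of_ne hut.symm, Finsupp.single_eq_of_ne hvt.symm]
    omega
  · simpa using h

/-- Every exponent whose support is not standard is a leading exponent. -/
theorem ContainsMinors.exists_isLead {I : Ideal (MvPolynomial (Var m n) F)} {δ : F}
    (hI : ContainsMinors I δ) {c : ℕ} (hc : δ = 0 ∨ 0 < c) {a : Var m n →₀ ℕ}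
    (ha : ¬ Standard a.support) : ∃ f ∈ I, IsLead varPos (xWeight c) f a := by
  by_contra hcon
  refine ha ⟨?_, ?_, ?_, ?_, ?_⟩
  · rintro ⟨p, p'⟩ ⟨q, q'⟩ hp hq h1 h2
    simp only at h1 h2
    refine hcon (exists_isLead_of_le (I.neg_mem (hI.xx p q q' p')) ?_
      (single_add_single_le ?_ hp hq))
    · refine IsLead.of_isBelow (g := -(X (Sum.inl (p, q')) * X (Sum.inl (q, p')))) ?_ ?_
      · rw [X_mul_X]
        refine (IsBelow.monomial ?_ _).neg
        exact WLT.pair rfl (varPos_inl_lt (Or.inl h1)) (varPos_inl_lt (Or.inl h1))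
          (varPos_inl_lt (Or.inr ⟨rfl, h2⟩))
      · rw [← X_mul_X]
        ring
    · simp [h1.ne]
  · rintro ⟨p, p'⟩ ⟨q, q'⟩ hp hq h1 h2
    simp only at h1 h2
    refine hcon (exists_isLead_of_le (hI.xy p q p' q') ?_ (single_add_single_le ?_ hp hq))
    · refine IsLead.of_isBelow (g := X (Sum.inr (p, p')) * X (Sum.inl (q, q')) +
        -(X (Sum.inr (q, p')) * X (Sum.inl (p, q'))) +
        -(X (Sum.inr (p, q')) * X (Sum.inl (q, p'))) +
        C δ * (X (Sum.inr (p, p')) * X (Sum.inr (q, q')) +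
          -(X (Sum.inr (p, q')) * X (Sum.inr (q, p'))))) ?_ ?_
      · simp only [X_mul_X]
        refine ((IsBelow.add (.monomial ?_ _) (.neg (.monomial ?_ _))).add
          (.neg (.monomial ?_ _))).add ?_
        · exact WLT.pair (by simp [xWeight]) (varPos_inr_lt_inl _ _)
            (varPos_inl_lt (Or.inl h1)) (varPos_inr_lt_inl _ _)
        · exact WLT.pair (by simp [xWeight]) (varPos_inr_lt_inl _ _)
            (varPos_inl_lt (Or.inr ⟨rfl, h2⟩)) (varPos_inr_lt_inl _ _)
        · exact WLT.pair (by simp [xWeight]) (varPos_inr_lt_inl _ _)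
            (varPos_inl_lt (Or.inl h1)) (varPos_inr_lt_inl _ _)
        · rcases hc with rfl | hc
          · simp [IsBelow]
          -- the minor of `(y)` has smaller weight
          · have hlt : ∀ u v : Fin m × Fin n, WLT varPos (xWeight c)
                (Finsupp.single (Sum.inr u) 1 + Finsupp.single (Sum.inr v) 1)
                (Finsupp.single (Sum.inl (p, p')) 1 + Finsupp.single (Sum.inr (q, q')) 1) := by
              intro u v
              refine Or.inr ⟨by simp, Or.inl ?_⟩
              simp only [map_add, weight_single_one]
              simpa [xWeight] using hc
            exact ((IsBelow.monomial (hlt _ _) _).add (IsBelow.monomial (hlt _ _) _).neg).smul δ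
      · rw [← X_mul_X]
        ring
    · simp
  · rintro ⟨p, p'⟩ ⟨q, q'⟩ ⟨s, s'⟩ hp hq hs h1 h2 h3 h4
    simp only at h1 h2 h3 h4
    refine hcon (exists_isLead_of_le (hI.yyy p q s s' q' p') ?_
      (single_add_single_add_single_le ?_ ?_ ?_ hp hq hs))
    · refine isLead_detThree ?_ ?_ ?_ ?_ ?_ ?_ ?_ ?_ rfl rfl rfl rfl rfl rfl <;>
        refine varPos_inr_lt ?_
      exacts [Or.inl h1, Or.inr ⟨rfl, h2⟩, Or.inl h1, Or.inl (h1.trans h3), Or.inl h3,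
        Or.inl h3, Or.inr ⟨rfl, h4⟩, Or.inr ⟨rfl, h4.trans h2⟩]
    · simp [h1.ne]
    · simp [(h1.trans h3).ne]
    · simp [h3.ne]
  · rintro ⟨p, p'⟩ ⟨q, q'⟩ ⟨s, s'⟩ hp hq hs h1 h2 h4
    simp only at h1 h2 h4
    refine hcon (exists_isLead_of_le (hI.below p q s s' q' p') ?_
      (single_add_single_add_single_le ?_ ?_ ?_ hp hq hs))
    · refine isLead_detThree (varPos_inr_lt ?_) (varPos_inr_lt ?_)
        (varPos_inr_lt ?_) (varPos_inr_lt_inl _ _) (varPos_inr_lt_inl _ _)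
        (varPos_inr_lt_inl _ _) (varPos_inl_lt ?_) (varPos_inl_lt ?_)
        rfl rfl rfl rfl rfl rfl
      exacts [Or.inl h1, Or.inr ⟨rfl, h2⟩, Or.inl h1, Or.inr ⟨rfl, h4⟩,
        Or.inr ⟨rfl, h4.trans h2⟩]
    · simp [h1.ne]
    · simp
    · simp
  · rintro ⟨p, p'⟩ ⟨q, q'⟩ ⟨s, s'⟩ hp hq hs h1 h2 h4
    simp only at h1 h2 h4
    refine hcon (exists_isLead_of_le (hI.right q' p' s' s p q) ?_
      (single_add_single_add_single_le ?_ ?_ ?_ hq hp hs))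
    · refine isLead_detThree (varPos_inr_lt ?_) (varPos_inr_lt ?_)
        (varPos_inr_lt ?_) (varPos_inr_lt_inl _ _) (varPos_inr_lt_inl _ _)
        (varPos_inr_lt_inl _ _) (varPos_inl_lt ?_) (varPos_inl_lt ?_)
        rfl rfl rfl rfl rfl rfl
      exacts [Or.inr ⟨rfl, h2⟩, Or.inl h1, Or.inl h1, Or.inl h4, Or.inl (h4.trans h1)]
    · simp [h1.ne']
    · simp
    · simp

end Generators

/-! ### The product of two Segre cones -/

section Segre

/-- A filling of a grid with nonnegative integers, nonzero only along a chain, is determined by its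
row sums and its column sums. -/
lemma eq_of_chain_of_sums {m n : ℕ} {α β : Fin m → Fin n → ℕ}
    (hα : ∀ i j k l, α i j ≠ 0 → α k l ≠ 0 → i < k → ¬ l < j)
    (hβ : ∀ i j k l, β i j ≠ 0 → β k l ≠ 0 → i < k → ¬ l < j)
    (hrow : ∀ i, ∑ j, α i j = ∑ j, β i j) (hcol : ∀ j, ∑ i, α i j = ∑ i, β i j) : α = β := by
  -- at the first difference, the larger filling forces the smaller one to be nonzero at two
  -- places in antidiagonal position
  have key : ∀ (α β : Fin m → Fin n → ℕ),
      (∀ i j k l, β i j ≠ 0 → β k l ≠ 0 → i < k → ¬ l < j) →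
      (∀ i, ∑ j, α i j = ∑ j, β i j) → (∀ j, ∑ i, α i j = ∑ i, β i j) →
      ∀ i j, (∀ k l, k < i → α k l = β k l) → (∀ l, l < j → α i l = β i l) →
        ¬ β i j < α i j := by
    intro α β hβ hrow hcol i j hi hj hlt
    have h1 : ∃ l, j < l ∧ β i l ≠ 0 := by
      by_contra hcon
      push Not at hcon
      refine absurd (hrow i) (ne_of_gt (Finset.sum_lt_sum (fun l _ => ?_) ⟨j, by simp, hlt⟩))
      rcases lt_trichotomy l j with h | rfl | h
      · rw [hj l h]
      · exact hlt.le
      · rw [hcon l h]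
        exact Nat.zero_le _
    have h2 : ∃ k, i < k ∧ β k j ≠ 0 := by
      by_contra hcon
      push Not at hcon
      refine absurd (hcol j) (ne_of_gt (Finset.sum_lt_sum (fun k _ => ?_) ⟨i, by simp, hlt⟩))
      rcases lt_trichotomy k i with h | rfl | h
      · rw [hi k j h]
      · exact hlt.le
      · rw [hcon k h]
        exact Nat.zero_le _
    obtain ⟨l, hl, hl'⟩ := h1
    obtain ⟨k, hk, hk'⟩ := h2
    exact hβ i l k j hl' hk' hk hl
  funext i
  induction i using WellFoundedLT.induction with
  | _ i ihi =>
    funext j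
    induction j using WellFoundedLT.induction with
    | _ j ihj =>
      have h1 := key α β hβ hrow hcol i j (fun k l hk => congrFun (ihi k hk) l) ihj
      have h2 := key β α hα (fun i => (hrow i).symm) (fun j => (hcol j).symm) i j
        (fun k l hk => (congrFun (ihi k hk) l).symm) fun l hl => (ihj l hl).symm
      omega

variable (F : Type*) [Field F] (m n : ℕ)

/-- The variables of the polynomial ring that contains the coordinate ring of the product of two
Segre cones: two copies of the `m + n` parameters of a matrix of rank one. -/
abbrev SegreVar (m n : ℕ) : Type := (Fin m ⊕ Fin n) ⊕ (Fin m ⊕ Fin n)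

/-- The images of `x_{i,j}` and of `x_{i,j} + y_{i,j}` under `segreMap`, as exponents. -/
def segreExp : Var m n → SegreVar m n →₀ ℕ
  | Sum.inl p => Finsupp.single (Sum.inl (Sum.inl p.1)) 1 + Finsupp.single (Sum.inl (Sum.inr p.2)) 1
  | Sum.inr p => Finsupp.single (Sum.inr (Sum.inl p.1)) 1 + Finsupp.single (Sum.inr (Sum.inr p.2)) 1

/-- The parametrization of the pairs of matrices `(A, B)` for which `A` and `A + B` have rank at
most one. Its kernel degenerates to the ideal of the principal component. -/
def segreMap : MvPolynomial (Var m n) F →ₐ[F] MvPolynomial (SegreVar m n) F :=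
  aeval (Sum.elim
    (fun p => X (Sum.inl (Sum.inl p.1)) * X (Sum.inl (Sum.inr p.2)))
    (fun p => X (Sum.inr (Sum.inl p.1)) * X (Sum.inr (Sum.inr p.2)) -
      X (Sum.inl (Sum.inl p.1)) * X (Sum.inl (Sum.inr p.2))))

/-- The ideal of the pairs `(A, B)` for which `A` and `A + B` have rank at most one. -/
def segreIdeal : Ideal (MvPolynomial (Var m n) F) := RingHom.ker (segreMap F m n)

lemma segreMap_x (p : Fin m × Fin n) : segreMap F m n (X (Sum.inl p)) =
    X (Sum.inl (Sum.inl p.1)) * X (Sum.inl (Sum.inr p.2)) := by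
  simp [segreMap]

lemma segreMap_y (p : Fin m × Fin n) : segreMap F m n (X (Sum.inr p)) =
    X (Sum.inr (Sum.inl p.1)) * X (Sum.inr (Sum.inr p.2)) -
      X (Sum.inl (Sum.inl p.1)) * X (Sum.inl (Sum.inr p.2)) := by
  simp [segreMap]

lemma mem_segreIdeal {f : MvPolynomial (Var m n) F} :
    f ∈ segreIdeal F m n ↔ segreMap F m n f = 0 := RingHom.mem_ker

lemma segreIdeal_containsMinors : ContainsMinors (segreIdeal F m n) 1 where
  xx i k j l := by
    rw [mem_segreIdeal]
    simp only [map_sub, map_mul, segreMap_x]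
    ring
  xy i k j l := by
    rw [mem_segreIdeal]
    simp only [map_sub, map_mul, map_add, map_one, segreMap_x, segreMap_y]
    ring
  yyy i k l a b c := by
    rw [mem_segreIdeal]
    simp only [detThree, map_sub, map_mul, map_add, segreMap_y]
    ring
  below i k l a b c := by
    rw [mem_segreIdeal]
    simp only [detThree, map_sub, map_mul, map_add, segreMap_x, segreMap_y]
    ring
  right i k l a b c := by
    rw [mem_segreIdeal]
    simp only [detThree, map_sub, map_mul, map_add, segreMap_x, segreMap_y]
    ring

lemma homogeneousComponent_mem_segreIdeal {f : MvPolynomial (Var m n) F}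
    (hf : f ∈ segreIdeal F m n) (k : ℕ) : homogeneousComponent k f ∈ segreIdeal F m n := by
  rw [mem_segreIdeal] at hf ⊢
  have hhom : ∀ i, (segreMap F m n (homogeneousComponent i f)).IsHomogeneous (2 * i) := by
    intro i
    refine (homogeneousComponent_isHomogeneous i f).aeval _ ?_
    rintro (p | p)
    · exact (isHomogeneous_X F _).mul (isHomogeneous_X F _)
    · exact ((isHomogeneous_X F _).mul (isHomogeneous_X F _)).sub
        ((isHomogeneous_X F _).mul (isHomogeneous_X F _))
  by_cases hk : k ∈ Finset.range (f.totalDegree + 1)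
  · have h1 := congrArg (homogeneousComponent (2 * k))
      (congrArg (segreMap F m n) (sum_homogeneousComponent f))
    rw [hf, map_zero, map_sum, map_sum, Finset.sum_eq_single k] at h1
    · rwa [homogeneousComponent_of_mem (hhom k), if_pos rfl] at h1
    · intro i _ hi
      rw [homogeneousComponent_of_mem (hhom i), if_neg (by omega)]
    · exact fun h => absurd hk h
  · rw [homogeneousComponent_eq_zero, map_zero]
    rw [Finset.mem_range] at hk
    omega

variable {m n}

/-- Both the `x`-part and the `y`-part of `S` are chains. -/
def IsChainPair (S : Finset (Var m n)) : Prop :=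
  (∀ p q, Sum.inl p ∈ S → Sum.inl q ∈ S → p.1 < q.1 → ¬ q.2 < p.2) ∧
    ∀ p q, Sum.inr p ∈ S → Sum.inr q ∈ S → p.1 < q.1 → ¬ q.2 < p.2

/-- The exponent of the image of the monomial with exponent `a` in the variables `x_{i,j}` and
`x_{i,j} + y_{i,j}`. -/
def segreImage (a : Var m n →₀ ℕ) : SegreVar m n →₀ ℕ := a.sum fun v k => k • segreExp m n v

lemma segreImage_eq_sum (a : Var m n →₀ ℕ) (s : SegreVar m n) :
    segreImage a s = ∑ v, a v * segreExp m n v s := by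
  rw [segreImage, Finsupp.sum_fintype _ _ (by simp), Finsupp.finsetSum_apply]
  simp

lemma segreImage_apply (a : Var m n →₀ ℕ) :
    (∀ i, segreImage a (Sum.inl (Sum.inl i)) = ∑ j, a (Sum.inl (i, j))) ∧
    (∀ j, segreImage a (Sum.inl (Sum.inr j)) = ∑ i, a (Sum.inl (i, j))) ∧
    (∀ i, segreImage a (Sum.inr (Sum.inl i)) = ∑ j, a (Sum.inr (i, j))) ∧
    ∀ j, segreImage a (Sum.inr (Sum.inr j)) = ∑ i, a (Sum.inr (i, j)) := by
  refine ⟨fun i => ?_, fun j => ?_, fun i => ?_, fun j => ?_⟩ <;>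
    simp [segreImage_eq_sum, segreExp, Finsupp.single_apply, Fintype.sum_prod_type]
  all_goals
    rw [Finset.sum_comm]
    simp

lemma segreImage_injOn {a b : Var m n →₀ ℕ} (ha : IsChainPair a.support)
    (hb : IsChainPair b.support) (h : segreImage a = segreImage b) : a = b := by
  obtain ⟨h1, h2, h3, h4⟩ := segreImage_apply a
  obtain ⟨h1', h2', h3', h4'⟩ := segreImage_apply b
  have hx : (fun i j => a (Sum.inl (i, j))) = fun i j => b (Sum.inl (i, j)) := by
    refine eq_of_chain_of_sums (fun i j k l hi hk hik hlj => ?_) (fun i j k l hi hk hik hlj => ?_)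
      (fun i => ?_) (fun j => ?_)
    · exact ha.1 (i, j) (k, l) (Finsupp.mem_support_iff.mpr hi) (Finsupp.mem_support_iff.mpr hk)
        hik hlj
    · exact hb.1 (i, j) (k, l) (Finsupp.mem_support_iff.mpr hi) (Finsupp.mem_support_iff.mpr hk)
        hik hlj
    · rw [← h1, ← h1', h]
    · rw [← h2, ← h2', h]
  have hy : (fun i j => a (Sum.inr (i, j))) = fun i j => b (Sum.inr (i, j)) := by
    refine eq_of_chain_of_sums (fun i j k l hi hk hik hlj => ?_) (fun i j k l hi hk hik hlj => ?_)
      (fun i => ?_) (fun j => ?_)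
    · exact ha.2 (i, j) (k, l) (Finsupp.mem_support_iff.mpr hi) (Finsupp.mem_support_iff.mpr hk)
        hik hlj
    · exact hb.2 (i, j) (k, l) (Finsupp.mem_support_iff.mpr hi) (Finsupp.mem_support_iff.mpr hk)
        hik hlj
    · rw [← h3, ← h3', h]
    · rw [← h4, ← h4', h]
  ext (⟨i, j⟩ | ⟨i, j⟩)
  · exact congrFun (congrFun hx i) j
  · exact congrFun (congrFun hy i) j

/-- The monomials in the variables `x_{i,j}` and `z_{i,j} = x_{i,j} + y_{i,j}`. -/
def shiftedMonomial (a : Var m n →₀ ℕ) : MvPolynomial (Var m n) F :=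
  aeval (Sum.elim (fun p => X (Sum.inl p)) fun p => X (Sum.inl p) + X (Sum.inr p))
    (monomial a (1 : F))

lemma shiftedMonomial_isHomogeneous (a : Var m n →₀ ℕ) :
    (shiftedMonomial F a).IsHomogeneous a.degree := by
  have h := (isHomogeneous_monomial (1 : F) (rfl : a.degree = a.degree)).aeval
    (Sum.elim (fun p => X (Sum.inl p)) fun p => X (Sum.inl p) + X (Sum.inr p) :
      Var m n → MvPolynomial (Var m n) F) (n := 1) (by
      rintro (p | p)
      · exact isHomogeneous_X F _
      · exact (isHomogeneous_X F _).add (isHomogeneous_X F _))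
  rwa [one_mul] at h

lemma segreMap_shiftedMonomial (a : Var m n →₀ ℕ) :
    segreMap F m n (shiftedMonomial F a) = monomial (segreImage a) 1 := by
  rw [segreImage, monomial_finsupp_sum_index, shiftedMonomial, aeval_monomial, map_mul,
    AlgHom.commutes, map_one, map_one, Finsupp.prod, Finsupp.prod, map_prod]
  congr 1
  refine Finset.prod_congr rfl fun v _ => ?_
  rw [map_pow, ← one_pow (a v), ← monomial_pow]
  congr 1
  rcases v with p | p
  · simp [segreMap_x, segreExp, X_mul_X]
  · simp [segreMap_x, segreMap_y, segreExp, X_mul_X]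

/-- The monomials supported on pairs of chains have distinct images under `segreMap`. -/
theorem card_supportedExps_le_finrank (E : Finset (Finset (Var m n)))
    (hE : ∀ S ∈ E, IsChainPair S) (N : ℕ) : (supportedExps E N).card ≤
      Module.finrank F ((homogeneousSubmodule (Var m n) F N).map (segreMap F m n).toLinearMap) := by
  have h := card_le_finrank_map (segreMap F m n).toLinearMap N
    (fun a : supportedExps E N => shiftedMonomial F (a : Var m n →₀ ℕ)) (fun a => ?_) ?_
  · simpa using h
  · have := shiftedMonomial_isHomogeneous F (a : Var m n →₀ ℕ)
    rwa [(mem_supportedExps.mp a.2).1] at this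
  · have h1 : (fun a : supportedExps E N => (segreMap F m n).toLinearMap
        (shiftedMonomial F (a : Var m n →₀ ℕ))) =
        (basisMonomials (SegreVar m n) F) ∘ fun a : supportedExps E N =>
          segreImage (a : Var m n →₀ ℕ) := by
      funext a
      simp [segreMap_shiftedMonomial]
    rw [h1]
    refine (basisMonomials (SegreVar m n) F).linearIndependent.comp _ fun a b hab => ?_
    exact Subtype.ext (segreImage_injOn (hE _ (mem_supportedExps.mp a.2).2)
      (hE _ (mem_supportedExps.mp b.2).2) hab)

end Segre

section ChainPairs

variable {m n : ℕ}

/-- The part of a set of grid points that lies in the index range of the matrices. -/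
def gridPart (m n : ℕ) (M : Finset (ℕ × ℕ)) : Finset (Fin m × Fin n) :=
  Finset.univ.filter fun p => ((p.1 : ℕ), (p.2 : ℕ)) ∈ M

lemma mem_gridPart {M : Finset (ℕ × ℕ)} {p : Fin m × Fin n} :
    p ∈ gridPart m n M ↔ ((p.1 : ℕ), (p.2 : ℕ)) ∈ M := by
  simp [gridPart]

/-- The embedding of the index set into the grid of all pairs of natural numbers. -/
def gridEmb (m n : ℕ) : Fin m × Fin n ↪ ℕ × ℕ :=
  ⟨fun p => ((p.1 : ℕ), (p.2 : ℕ)), fun p q h => by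
    rw [Prod.mk.injEq] at h
    exact Prod.ext (Fin.ext h.1) (Fin.ext h.2)⟩

lemma map_gridPart {M : Finset (ℕ × ℕ)} (hM : ∀ p ∈ M, p.1 < m ∧ p.2 < n) :
    (gridPart m n M).map (gridEmb m n) = M := by
  ext ⟨a, b⟩
  rw [Finset.mem_map]
  constructor
  · rintro ⟨p, hp, h⟩
    rw [← h]
    exact mem_gridPart.mp hp
  · intro h
    exact ⟨(⟨a, (hM _ h).1⟩, ⟨b, (hM _ h).2⟩), mem_gridPart.mpr h, rfl⟩

lemma card_gridPart_le (M : Finset (ℕ × ℕ)) : (gridPart m n M).card ≤ M.card := by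
  rw [← Finset.card_map (gridEmb m n)]
  refine Finset.card_le_card fun x hx => ?_
  obtain ⟨p, hp, rfl⟩ := Finset.mem_map.mp hx
  exact mem_gridPart.mp hp

/-- The pairs of maximal chains. -/
theorem exists_chainPairs (hm : 1 ≤ m) (hn : 1 ≤ n) : ∃ E : Finset (Finset (Var m n)),
    E.card = (m - 1 + (n - 1)).choose (m - 1) ^ 2 ∧
    ∀ S ∈ E, S.card = 2 * (m + n - 1) ∧ IsChainPair S := by
  classical
  obtain ⟨E, hE, hM⟩ := exists_maximal_chains (m - 1) (n - 1)
  have hgrid : ∀ M ∈ E, (gridPart m n M).map (gridEmb m n) = M := fun M hM' =>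
    map_gridPart fun p hp => by
      have := (hM M hM').2.2.2 p hp
      omega
  refine ⟨(E ×ˢ E).image fun M => (gridPart m n M.1).disjSum (gridPart m n M.2), ?_, ?_⟩
  · rw [Finset.card_image_of_injOn, Finset.card_product, hE, sq]
    rintro ⟨M₁, M₂⟩ h ⟨M₁', M₂'⟩ h' heq
    rw [Finset.mem_coe, Finset.mem_product] at h h'
    have key : ∀ p, (Sum.inl p ∈ (gridPart m n M₁).disjSum (gridPart m n M₂) ↔
        Sum.inl p ∈ (gridPart m n M₁').disjSum (gridPart m n M₂')) ∧
        (Sum.inr p ∈ (gridPart m n M₁).disjSum (gridPart m n M₂) ↔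
        Sum.inr p ∈ (gridPart m n M₁').disjSum (gridPart m n M₂')) := by
      intro p
      simp only at heq
      rw [heq]
      simp
    simp only [Finset.inl_mem_disjSum, Finset.inr_mem_disjSum] at key
    have e1 : gridPart m n M₁ = gridPart m n M₁' := Finset.ext fun p => (key p).1
    have e2 : gridPart m n M₂ = gridPart m n M₂' := Finset.ext fun p => (key p).2
    have f1 : M₁ = M₁' := by rw [← hgrid M₁ h.1, e1, hgrid M₁' h'.1]
    have f2 : M₂ = M₂' := by rw [← hgrid M₂ h.2, e2, hgrid M₂' h'.2]
    rw [f1, f2]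
  · intro S hS
    obtain ⟨⟨M₁, M₂⟩, h, rfl⟩ := Finset.mem_image.mp hS
    rw [Finset.mem_product] at h
    have hcard : ∀ M ∈ E, (gridPart m n M).card = m + n - 1 := by
      intro M hM'
      rw [← Finset.card_map (gridEmb m n), hgrid M hM', (hM M hM').1]
      omega
    refine ⟨?_, ?_, ?_⟩
    · rw [Finset.card_disjSum, hcard _ h.1, hcard _ h.2]
      omega
    · intro p q hp hq hpq hqp
      rw [Finset.inl_mem_disjSum, mem_gridPart] at hp hq
      exact (hM _ h.1).2.2.1 _ hp _ hq hpq hqp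
    · intro p q hp hq hpq hqp
      rw [Finset.inr_mem_disjSum, mem_gridPart] at hp hq
      exact (hM _ h.2).2.2.1 _ hp _ hq hpq hqp

end ChainPairs

/-! ### The facets of the initial complex -/

section Facets

variable {m n : ℕ}

lemma Standard.mono {S T : Finset (Var m n)} (hT : Standard T) (h : S ⊆ T) : Standard S where
  xx p q hp hq := hT.xx p q (h hp) (h hq)
  xy p q hp hq := hT.xy p q (h hp) (h hq)
  yyy p q s hp hq hs := hT.yyy p q s (h hp) (h hq) (h hs)
  below p q s hp hq hs := hT.below p q s (h hp) (h hq) (h hs)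
  right p q s hp hq hs := hT.right p q s (h hp) (h hq) (h hs)

/-- The smallest variable `x_{m,n}` is a cone point of the initial complex. -/
lemma Standard.insert_last {S : Finset (Var m n)} (hS : Standard S) {z : Fin m × Fin n}
    (hz : ∀ p : Fin m × Fin n, p.1 ≤ z.1 ∧ p.2 ≤ z.2) : Standard (insert (Sum.inl z) S) where
  xx p q hp hq h1 h2 := by
    rw [Finset.mem_insert] at hp hq
    rcases hp with hp | hp
    · rw [Sum.inl.inj hp] at h1
      exact absurd h1 (not_lt.mpr (hz q).1)
    rcases hq with hq | hq
    · rw [Sum.inl.inj hq] at h2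
      exact absurd h2 (not_lt.mpr (hz p).2)
    exact hS.xx p q hp hq h1 h2
  xy p q hp hq h1 h2 := by
    rw [Finset.mem_insert] at hp hq
    rcases hp with hp | hp
    · rw [Sum.inl.inj hp] at h1
      exact absurd h1 (not_lt.mpr (hz q).1)
    · exact hS.xy p q hp (by simpa using hq) h1 h2
  yyy p q s hp hq hs := hS.yyy p q s (by simpa using hp) (by simpa using hq) (by simpa using hs)
  below p q s hp hq hs h1 h2 h3 := by
    rw [Finset.mem_insert] at hs
    rcases hs with hs | hs
    · rw [Sum.inl.inj hs] at h3
      exact absurd h3 (not_lt.mpr (hz q).2)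
    · exact hS.below p q s (by simpa using hp) (by simpa using hq) hs h1 h2 h3
  right p q s hp hq hs h1 h2 h3 := by
    rw [Finset.mem_insert] at hs
    rcases hs with hs | hs
    · rw [Sum.inl.inj hs] at h3
      exact absurd h3 (not_lt.mpr (hz p).1)
    · exact hS.right p q s (by simpa using hp) (by simpa using hq) hs h1 h2 h3

lemma mem_map_toLeft {S : Finset (Var m n)} {x : ℕ × ℕ} :
    x ∈ S.toLeft.map (gridEmb m n) ↔ ∃ p : Fin m × Fin n, Sum.inl p ∈ S ∧
      ((p.1 : ℕ), (p.2 : ℕ)) = x := by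
  rw [Finset.mem_map]
  simp only [Finset.mem_toLeft]
  rfl

lemma mem_map_toRight {S : Finset (Var m n)} {x : ℕ × ℕ} :
    x ∈ S.toRight.map (gridEmb m n) ↔ ∃ p : Fin m × Fin n, Sum.inr p ∈ S ∧
      ((p.1 : ℕ), (p.2 : ℕ)) = x := by
  rw [Finset.mem_map]
  simp only [Finset.mem_toRight]
  rfl

/-- The sets formed by a lattice path from `(i, j)` to the last index in the `x`-variables and a
pair of disjoint lattice paths in the `y`-variables. They contain all standard sets with smallest
`x`-index `(i, j)`. -/
lemma exists_cover (hm : 2 ≤ m) (hn : 2 ≤ n) (z : Fin m × Fin n)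
    (hz : ¬ ((z.1 : ℕ) = m - 1 ∧ (z.2 : ℕ) = n - 1)) :
    ∃ Q : Finset (Finset (Var m n)),
      (Q.card : ℤ) ≤ summand m n ((z.1 : ℕ) + 1) ((z.2 : ℕ) + 1) ∧
      (∀ M ∈ Q, M.card ≤ 2 * (m + n - 1) ∧ HasMu M z) ∧
      ∀ S : Finset (Var m n), IsGridChain (S.toLeft.map (gridEmb m n)) →
        (∀ p, Sum.inl p ∈ S → z ≤ p) →
        WidthTwo z.1 (n - 1) (m - 1) z.2 (S.toRight.map (gridEmb m n)) → ∃ M ∈ Q, S ⊆ M := by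
  classical
  obtain ⟨i, j⟩ := z
  have hi := i.isLt
  have hj := j.isLt
  obtain ⟨E, hE, hE', hcE⟩ := chainCover (m - 1 - i) (n - 1 - j) i j
  obtain ⟨P, hP, hP', hcP⟩ := pairCover i (n - 1) (m - 1) j (by omega) (by omega) (by omega)
    (by omega) (by
      simp only at hz
      omega)
  refine ⟨(E ×ˢ P).image fun M => (gridPart m n M.1).disjSum (gridPart m n M.2), ?_, ?_, ?_⟩
  · rw [summand_eq m n i j hm hn hi hj]
    have h1 : (((E ×ˢ P).image fun M =>
        (gridPart m n M.1).disjSum (gridPart m n M.2)).card : ℤ) ≤ E.card * P.card := by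
      have := Finset.card_image_le (s := E ×ˢ P) (f := fun M =>
        (gridPart m n M.1).disjSum (gridPart m n M.2))
      rw [Finset.card_product] at this
      exact_mod_cast this
    refine h1.trans (mul_le_mul (by exact_mod_cast hE) hP (by positivity) (by positivity))
  · intro M hM
    obtain ⟨⟨M₁, M₂⟩, h, rfl⟩ := Finset.mem_image.mp hM
    rw [Finset.mem_product] at h
    obtain ⟨h1, h2, h3⟩ := hE' M₁ h.1
    refine ⟨?_, ?_, ?_⟩
    · rw [Finset.card_disjSum]
      have h4 := hP' M₂ h.2
      have h5 := card_gridPart_le (m := m) (n := n) M₁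
      have h6 := card_gridPart_le (m := m) (n := n) M₂
      simp only at h4 ⊢
      omega
    · rw [Set.mem_ofPred_eq, Finset.inl_mem_disjSum, mem_gridPart]
      exact h2
    · intro p hp
      rw [Set.mem_ofPred_eq, Finset.inl_mem_disjSum, mem_gridPart] at hp
      exact h3 _ hp
  · intro S hS hle hT
    obtain ⟨M₁, hM₁, hSM₁⟩ := hcE _ hS fun x hx => by
      obtain ⟨p, hp, rfl⟩ := mem_map_toLeft.mp hx
      have h1 := hle p hp
      have h2 : (i : ℕ) ≤ p.1 := h1.1
      have h3 : (j : ℕ) ≤ p.2 := h1.2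
      have h4 := p.1.isLt
      have h5 := p.2.isLt
      simp only
      omega
    obtain ⟨M₂, hM₂, hSM₂⟩ := hcP _ hT
    have hM : (M₁, M₂) ∈ E ×ˢ P := Finset.mem_product.mpr ⟨hM₁, hM₂⟩
    refine ⟨_, Finset.mem_image_of_mem _ hM, ?_⟩
    rintro (p | p) hp
    · rw [Finset.inl_mem_disjSum, mem_gridPart]
      exact hSM₁ (mem_map_toLeft.mpr ⟨p, hp, rfl⟩)
    · rw [Finset.inr_mem_disjSum, mem_gridPart]
      exact hSM₂ (mem_map_toRight.mpr ⟨p, hp, rfl⟩)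

lemma Standard.isGridChain {S : Finset (Var m n)} (hS : Standard S) :
    IsGridChain (S.toLeft.map (gridEmb m n)) := by
  intro x hx y hy h1 h2
  obtain ⟨p, hp, rfl⟩ := mem_map_toLeft.mp hx
  obtain ⟨q, hq, rfl⟩ := mem_map_toLeft.mp hy
  exact hS.xx p q hp hq h1 h2

lemma Standard.exists_least {S : Finset (Var m n)} (hS : Standard S) {z : Fin m × Fin n}
    (hz : Sum.inl z ∈ S) : ∃ p, Sum.inl p ∈ S ∧ ∀ q, Sum.inl q ∈ S → p ≤ q := by
  obtain ⟨p, hp, hmin⟩ := Finset.exists_min_image S.toLeft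
    (fun p : Fin m × Fin n => (p.1 : ℕ) + p.2) ⟨z, Finset.mem_toLeft.mpr hz⟩
  rw [Finset.mem_toLeft] at hp
  refine ⟨p, hp, fun q hq => ?_⟩
  have h1 := hmin q (Finset.mem_toLeft.mpr hq)
  have h2 := hS.xx p q hp hq
  have h3 := hS.xx q p hq hp
  simp only [Fin.lt_def] at h2 h3
  refine Prod.mk_le_mk.mpr ⟨?_, ?_⟩ <;> rw [Fin.le_def] <;> omega

lemma Standard.widthTwo {S : Finset (Var m n)} (hS : Standard S) {z : Fin m × Fin n}
    (hz : Sum.inl z ∈ S) : WidthTwo z.1 (n - 1) (m - 1) z.2 (S.toRight.map (gridEmb m n)) := by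
  refine ⟨fun x hx => ?_, fun x hx y hy h1 h2 => ?_, fun x hx y hy h1 h2 => ?_,
    fun x hx y hy t ht h1 h2 h3 h4 => ?_⟩
  · obtain ⟨p, hp, rfl⟩ := mem_map_toRight.mp hx
    have h1 := hS.xy z p hz hp
    rw [Fin.lt_def, Fin.lt_def] at h1
    have h2 := p.1.isLt
    have h3 := p.2.isLt
    simp only
    omega
  · obtain ⟨p, hp, rfl⟩ := mem_map_toRight.mp hx
    obtain ⟨q, hq, rfl⟩ := mem_map_toRight.mp hy
    exact not_lt.mp (hS.below p q z hp hq hz h1 h2)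
  · obtain ⟨p, hp, rfl⟩ := mem_map_toRight.mp hx
    obtain ⟨q, hq, rfl⟩ := mem_map_toRight.mp hy
    exact not_lt.mp (hS.right p q z hp hq hz h1 h2)
  · obtain ⟨p, hp, rfl⟩ := mem_map_toRight.mp hx
    obtain ⟨q, hq, rfl⟩ := mem_map_toRight.mp hy
    obtain ⟨s, hs, rfl⟩ := mem_map_toRight.mp ht
    exact hS.yyy p q s hp hq hs h1 h2 h3 h4

/-- Every standard set lies in one of the sets of `exists_cover`. If its only `x`-variable
is `x_{m,n}`, then it is also compatible with `x_{m,n-1}`. -/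
lemma Standard.exists_compatible {S : Finset (Var m n)} (hS : Standard S) (hm : 2 ≤ m)
    (hn : 2 ≤ n) : ∃ z : Fin m × Fin n, ¬ ((z.1 : ℕ) = m - 1 ∧ (z.2 : ℕ) = n - 1) ∧
      (∀ p, Sum.inl p ∈ S → z ≤ p) ∧
      WidthTwo z.1 (n - 1) (m - 1) z.2 (S.toRight.map (gridEmb m n)) := by
  classical
  let l : Fin m × Fin n := (⟨m - 1, by omega⟩, ⟨n - 1, by omega⟩)
  have hl : ∀ p : Fin m × Fin n, p.1 ≤ l.1 ∧ p.2 ≤ l.2 := by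
    intro p
    have h1 := p.1.isLt
    have h2 := p.2.isLt
    simp only [l, Fin.le_def]
    omega
  have hS' := hS.insert_last hl
  obtain ⟨z, hz, hmin⟩ := hS'.exists_least (Finset.mem_insert_self _ _)
  have hw := hS'.widthTwo hz
  have hright : S.toRight ⊆ (insert (Sum.inl l) S).toRight := fun p hp =>
    Finset.mem_toRight.mpr (Finset.mem_insert_of_mem (Finset.mem_toRight.mp hp))
  have hw' := hw.mono (Finset.map_subset_map.mpr hright)
  have hmin' : ∀ p, Sum.inl p ∈ S → z ≤ p := fun p hp => hmin p (Finset.mem_insert_of_mem hp)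
  by_cases hzl : (z.1 : ℕ) = m - 1 ∧ (z.2 : ℕ) = n - 1
  · refine ⟨(⟨m - 1, by omega⟩, ⟨n - 2, by omega⟩), by simp only; omega, fun p hp => ?_, ?_⟩
    · have h1 := hmin' p hp
      refine le_trans (Prod.mk_le_mk.mpr ⟨?_, ?_⟩) h1 <;> rw [Fin.le_def] <;> simp only <;> omega
    · rw [hzl.1, hzl.2] at hw'
      refine ⟨fun x hx => ?_, fun x hx y hy h1 h2 => ?_, hw'.lower, hw'.three⟩
      · have := hw'.region x hx
        simp only
        omega
      · have := hw'.region x hx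
        simp only
        omega
  · exact ⟨z, hzl, hmin', hw'⟩

/-- The complex of standard sets. -/
def standardComplex (m n : ℕ) : Finset (Finset (Var m n)) := by
  classical exact Finset.univ.filter Standard

lemma mem_standardComplex {S : Finset (Var m n)} : S ∈ standardComplex m n ↔ Standard S := by
  simp [standardComplex]

lemma sum_summand_fin (hm : 2 ≤ m) (hn : 2 ≤ n) :
    ∑ z : Fin m × Fin n, summand m n ((z.1 : ℕ) + 1) ((z.2 : ℕ) + 1) =
      ((m - 1 + (n - 1)).choose (m - 1) : ℤ) ^ 2 := by
  obtain ⟨a, rfl⟩ := Nat.exists_eq_add_of_le' hm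
  obtain ⟨b, rfl⟩ := Nat.exists_eq_add_of_le' hn
  rw [show a + 2 - 1 = a + 1 from rfl, show b + 2 - 1 = b + 1 from rfl,
    ← sum_pathsTo_mul_pairDet a b, Fintype.sum_prod_type, Finset.sum_range]
  refine Finset.sum_congr rfl fun i _ => ?_
  rw [Finset.sum_range]
  refine Finset.sum_congr rfl fun j _ => ?_
  rw [← summand_eq_pathsTo a b i j i.isLt j.isLt]
  push_cast
  rfl

variable (F : Type*) [Field F]

/-- The standard monomials of degree `N` span the image of the forms of degree `N` under
`segreMap`. -/
lemma finrank_le_card_standard (N : ℕ) :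
    Module.finrank F ((homogeneousSubmodule (Var m n) F N).map (segreMap F m n).toLinearMap) ≤
      (supportedExps (standardComplex m n) N).card := by
  refine finrank_map_le_card (w := xWeight 1) varPos_injective _ N _ fun a ha haB => ?_
  have hns : ¬ Standard a.support := fun h =>
    haB (mem_supportedExps.mpr ⟨ha, mem_standardComplex.mpr h⟩)
  obtain ⟨f, hf, hlead⟩ := (segreIdeal_containsMinors F m n).exists_isLead
    (Or.inr Nat.one_pos) hns
  refine ⟨homogeneousComponent N f,
    (mem_segreIdeal F m n).mp (homogeneousComponent_mem_segreIdeal F m n hf N),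
    homogeneousComponent_isHomogeneous N f, hlead.homogeneousComponent ha⟩

/-- The facets of the complex of standard sets. Their number is bounded from above by the sum of
the summands, and from below by the degree of the product of two Segre cones; as the two bounds
agree, all the estimates are equalities. -/
theorem exists_facets (hm : 2 ≤ m) (hn : 2 ≤ n) : ∃ Q : Fin m × Fin n → Finset (Finset (Var m n)),
    (∀ z, ((Q z).card : ℤ) = summand m n ((z.1 : ℕ) + 1) ((z.2 : ℕ) + 1)) ∧
    (∀ z, ∀ M ∈ Q z, Standard M ∧ M.card = 2 * (m + n - 1) ∧ HasMu M z) ∧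
    (∀ S, Standard S → ∃ z, ∃ M ∈ Q z, S ⊆ M) ∧
    ((standardComplex m n).filter fun S => S.card = 2 * (m + n - 1)).card =
      (m - 1 + (n - 1)).choose (m - 1) ^ 2 := by
  classical
  have hQ : ∀ z : Fin m × Fin n, ∃ Q : Finset (Finset (Var m n)),
      (Q.card : ℤ) ≤ summand m n ((z.1 : ℕ) + 1) ((z.2 : ℕ) + 1) ∧
      (∀ M ∈ Q, M.card ≤ 2 * (m + n - 1) ∧ HasMu M z) ∧
      (¬ ((z.1 : ℕ) = m - 1 ∧ (z.2 : ℕ) = n - 1) →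
        ∀ S : Finset (Var m n), IsGridChain (S.toLeft.map (gridEmb m n)) →
          (∀ p, Sum.inl p ∈ S → z ≤ p) →
          WidthTwo z.1 (n - 1) (m - 1) z.2 (S.toRight.map (gridEmb m n)) → ∃ M ∈ Q, S ⊆ M) := by
    intro z
    by_cases hz : (z.1 : ℕ) = m - 1 ∧ (z.2 : ℕ) = n - 1
    · refine ⟨∅, ?_, by simp, fun h => absurd hz h⟩
      rw [summand_eq m n z.1 z.2 hm hn z.1.isLt z.2.isLt, hz.1, hz.2, pairDet, sub_self, mul_zero,
        Finset.card_empty, Nat.cast_zero]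
    · obtain ⟨Q, h1, h2, h3⟩ := exists_cover hm hn z hz
      exact ⟨Q, h1, h2, fun _ => h3⟩
  choose Q hcard hsize hcov using hQ
  have hcover : ∀ S, Standard S → ∃ z, ∃ M ∈ Q z, S ⊆ M := by
    intro S hS
    obtain ⟨z, hz, hle, hw⟩ := hS.exists_compatible hm hn
    exact ⟨z, hcov z hz S hS.isGridChain hle hw⟩
  let top := (standardComplex m n).filter fun S => S.card = 2 * (m + n - 1)
  have hd : 2 * (m + n - 1) = (2 * (m + n - 1) - 1) + 1 := by omega
  have hle : ∀ S ∈ standardComplex m n, S.card ≤ (2 * (m + n - 1) - 1) + 1 := by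
    intro S hS
    obtain ⟨z, M, hM, hSM⟩ := hcover S (mem_standardComplex.mp hS)
    rw [← hd]
    exact (Finset.card_le_card hSM).trans (hsize z M hM).1
  have htop : top ⊆ Finset.univ.biUnion Q := by
    intro S hS
    rw [Finset.mem_filter, mem_standardComplex] at hS
    obtain ⟨z, M, hM, hSM⟩ := hcover S hS.1
    have : S = M := Finset.eq_of_subset_of_card_le hSM (by
      rw [hS.2]
      exact (hsize z M hM).1)
    rw [Finset.mem_biUnion]
    exact ⟨z, Finset.mem_univ _, this ▸ hM⟩
  have hlower : (m - 1 + (n - 1)).choose (m - 1) ^ 2 ≤ top.card := by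
    obtain ⟨E, hE, hE'⟩ := exists_chainPairs (m := m) (n := n) (by omega) (by omega)
    rw [← hE]
    have := card_filter_le_of_eventually_le hle
      (fun S hS => (hE' S hS).1.trans hd) (Filter.Eventually.of_forall fun N =>
        (card_supportedExps_le_finrank ℚ E (fun S hS => (hE' S hS).2) N).trans
          (finrank_le_card_standard ℚ N))
    rwa [← hd] at this
  have hsum : ∑ z, ((Q z).card : ℤ) ≤ ((m - 1 + (n - 1)).choose (m - 1) : ℤ) ^ 2 := by
    rw [← sum_summand_fin hm hn]
    exact Finset.sum_le_sum fun z _ => hcard z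
  have hbi : (Finset.univ.biUnion Q).card ≤ ∑ z, (Q z).card := Finset.card_biUnion_le
  have hsum' : ∑ z, (Q z).card ≤ (m - 1 + (n - 1)).choose (m - 1) ^ 2 := by exact_mod_cast hsum
  have heq : top = Finset.univ.biUnion Q :=
    Finset.eq_of_subset_of_card_le htop (hbi.trans (hsum'.trans hlower))
  refine ⟨Q, fun z => ?_, fun z M hM => ?_, hcover, ?_⟩
  · have h1 : ∑ z, ((Q z).card : ℤ) =
        ∑ z : Fin m × Fin n, summand m n ((z.1 : ℕ) + 1) ((z.2 : ℕ) + 1) := by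
      refine le_antisymm (Finset.sum_le_sum fun z _ => hcard z) ?_
      rw [sum_summand_fin hm hn]
      exact_mod_cast hlower.trans ((Finset.card_le_card htop).trans hbi)
    exact (Finset.sum_eq_sum_iff_of_le fun z _ => hcard z).mp h1 z (Finset.mem_univ z)
  · have h1 : M ∈ top := by
      rw [heq, Finset.mem_biUnion]
      exact ⟨z, Finset.mem_univ z, hM⟩
    rw [Finset.mem_filter, mem_standardComplex] at h1
    exact ⟨h1.1, h1.2, (hsize z M hM).2⟩
  · exact le_antisymm ((Finset.card_le_card htop).trans (hbi.trans hsum')) hlower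

/-- The leading exponents of the ideal of the product of two Segre cones have nonstandard supports:
otherwise the multiples of one such monomial could be removed from the spanning set of standard
monomials, and the Hilbert function of the product would be too small. -/
theorem not_isLead_of_standard (hm : 2 ≤ m) (hn : 2 ≤ n) {f : MvPolynomial (Var m n) F}
    (hf : f ∈ segreIdeal F m n) {a : Var m n →₀ ℕ} (ha : Standard a.support) :
    ¬ IsLead varPos (xWeight 1) f a := by
  classical
  intro hlead
  obtain ⟨Q, -, hQ, hcover, htop⟩ := exists_facets hm hn
  obtain ⟨z, S, hS, haS⟩ := hcover _ ha
  obtain ⟨hstd, hcard, -⟩ := hQ z S hS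
  have hd : 2 * (m + n - 1) = (2 * (m + n - 1) - 1) + 1 := by omega
  obtain ⟨E, hE, hE'⟩ := exists_chainPairs (m := m) (n := n) (by omega) (by omega)
  have hle : ∀ S ∈ standardComplex m n, S.card ≤ (2 * (m + n - 1) - 1) + 1 := by
    intro S hS
    obtain ⟨z, M, hM, hSM⟩ := hcover S (mem_standardComplex.mp hS)
    rw [← hd, ← (hQ z M hM).2.1]
    exact Finset.card_le_card hSM
  refine not_eventually_card_add_le hle (fun S hS => (hE' S hS).1.trans hd)
    (by rw [← hd, htop, hE]) (hcard.trans hd) a.degree ?_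
  filter_upwards [Filter.eventually_ge_atTop a.degree] with N hN
  let mult := (supportExps S (N - a.degree)).image fun c => a + c
  have hmult : mult ⊆ supportedExps (standardComplex m n) N := by
    intro b hb
    obtain ⟨c, hc, rfl⟩ := Finset.mem_image.mp hb
    rw [mem_supportExps] at hc
    rw [mem_supportedExps, map_add, hc.1, mem_standardComplex]
    refine ⟨by omega, hstd.mono fun v hv => ?_⟩
    rcases Finset.mem_union.mp (Finsupp.support_add hv) with h | h
    · exact haS h
    · rwa [← hc.2]
  have hmcard : mult.card = (supportExps S (N - a.degree)).card :=
    Finset.card_image_of_injective _ (add_right_injective a)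
  have hspan : Module.finrank F
      ((homogeneousSubmodule (Var m n) F N).map (segreMap F m n).toLinearMap) ≤
      (supportedExps (standardComplex m n) N \ mult).card := by
    refine finrank_map_le_card (w := xWeight 1) varPos_injective _ N _ fun b hb hbB => ?_
    have h1 : ∃ g ∈ segreIdeal F m n, IsLead varPos (xWeight 1) g b := by
      by_cases hbs : Standard b.support
      · have h2 : b ∈ mult := by
          by_contra hcon
          exact hbB (Finset.mem_sdiff.mpr
            ⟨mem_supportedExps.mpr ⟨hb, mem_standardComplex.mpr hbs⟩, hcon⟩)
        obtain ⟨c, -, rfl⟩ := Finset.mem_image.mp h2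
        exact ⟨_, (segreIdeal F m n).mul_mem_left _ hf, hlead.monomial_mul c⟩
      · exact (segreIdeal_containsMinors F m n).exists_isLead (Or.inr Nat.one_pos) hbs
    obtain ⟨g, hg, hgl⟩ := h1
    refine ⟨homogeneousComponent N g,
      (mem_segreIdeal F m n).mp (homogeneousComponent_mem_segreIdeal F m n hg N),
      homogeneousComponent_isHomogeneous N g, hgl.homogeneousComponent hb⟩
  have h2 := (card_supportedExps_le_finrank F E (fun S hS => (hE' S hS).2) N).trans hspan
  have h3 := Finset.card_sdiff_add_card_eq_card hmult
  omega

end Facets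

/-! ### Dimension of domains between two polynomial rings -/

section Dimension

lemma ringKrullDim_eq_of_isIntegral {R S : Type*} [CommRing R] [CommRing S] [Algebra R S]
    [Algebra.IsIntegral R S] [FaithfulSMul R S] : ringKrullDim S = ringKrullDim R := by
  refine le_antisymm (Order.krullDim_le_of_strictMono
    (PrimeSpectrum.comap (algebraMap R S)) fun P Q hPQ => ?_) (iSup_le fun l => ?_)
  · exact Ideal.IsIntegral.comap_lt_comap hPQ
  · obtain ⟨⟨P, hP, hPl⟩⟩ := Ideal.nonempty_primesOver (S := S) l.head.asIdeal
    obtain ⟨L, hL, -⟩ := Ideal.exists_ltSeries_of_hasGoingUp l P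
    rw [← hL]
    exact le_iSup (fun p : LTSeries (PrimeSpectrum S) => (p.length : WithBot ℕ∞)) L

/-- A finitely generated algebra which contains a polynomial ring in `d` variables and embeds into
one has Krull dimension `d`: by Noether normalization the dimension is the transcendence degree. -/
theorem ringKrullDim_eq_of_injective {k A ι : Type*} [Field k] [CommRing A] [Algebra k A]
    [Algebra.FiniteType k A] [Finite ι] (f : MvPolynomial ι k →ₐ[k] A)
    (hf : Function.Injective f) (g : A →ₐ[k] MvPolynomial ι k) (hg : Function.Injective g) :
    ringKrullDim A = Nat.card ι := by
  have : IsDomain A := hg.isDomain g.toRingHom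
  obtain ⟨s, h, hh, hint⟩ := exists_integral_inj_algHom_of_fg k A
  have h1 : s ≤ Nat.card ι := by
    have := lift_trdeg_le_of_injective (g.comp h) (hg.comp hh)
    simp only [MvPolynomial.trdeg_of_isDomain] at this
    rw [← Nat.cast_card (α := ι)] at this
    simpa using this
  let := h.toRingHom.toAlgebra
  have htower : IsScalarTower k (MvPolynomial (Fin s) k) A :=
    IsScalarTower.of_algebraMap_eq fun x => (h.commutes x).symm
  have hi : Algebra.IsIntegral (MvPolynomial (Fin s) k) A := ⟨hint⟩
  have hfaith : FaithfulSMul (MvPolynomial (Fin s) k) A :=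
    (faithfulSMul_iff_algebraMap_injective _ _).mpr hh
  have h2 : Nat.card ι ≤ s := by
    have h3 := lift_trdeg_le_of_injective f hf
    have h4 := lift_trdeg_add_eq k (MvPolynomial (Fin s) k) A
    rw [trdeg_eq_zero (R := MvPolynomial (Fin s) k)] at h4
    simp only [MvPolynomial.trdeg_of_isDomain] at h3 h4
    rw [← Nat.cast_card (α := ι)] at h3
    simp at h3 h4
    rw [← h4] at h3
    simpa using h3
  rw [ringKrullDim_eq_of_isIntegral (R := MvPolynomial (Fin s) k),
    MvPolynomial.ringKrullDim_of_isNoetherianRing, ringKrullDim_eq_zero_of_field, zero_add,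
    Nat.card_fin, le_antisymm h1 h2]

end Dimension

/-! ### Tangent spaces of the determinantal variety -/

section DetVariety

variable {F : Type*} [Field F]

lemma eval_aeval {σ τ : Type*} (c : τ → F) (g : σ → MvPolynomial τ F) (f : MvPolynomial σ F) :
    eval c (aeval g f) = eval (fun s => eval c (g s)) f := by
  have h : (eval c).comp (aeval (R := F) g).toRingHom = eval (fun s => eval c (g s)) :=
    MvPolynomial.ringHom_ext (by simp) (by simp)
  exact DFunLike.congr_fun h f

lemma eq_zero_of_eval_eq_zero_of_ne_zero [Infinite F] {σ : Type*} {q : MvPolynomial σ F} (s : σ)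
    (h : ∀ c : σ → F, c s ≠ 0 → eval c q = 0) : q = 0 := by
  have h0 : X s * q = 0 := by
    refine MvPolynomial.funext fun c => ?_
    by_cases hc : c s = 0
    · simp [hc]
    · simp [h c hc]
  exact (mul_eq_zero.mp h0).resolve_left (X_ne_zero s)

variable {m n : ℕ}

lemma mem_detVariety_iff {A : Fin m × Fin n → F} :
    A ∈ detVariety F m n ↔ ∃ (u : Fin m → F) (v : Fin n → F), A = fun p => u p.1 * v p.2 := by
  constructor
  · intro h
    have h1 : (Matrix.of fun i j => A (i, j)).rank ≤ 1 := h
    rw [Matrix.rank_eq_finrank_span_cols, finrank_le_one_iff] at h1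
    obtain ⟨u, hu⟩ := h1
    have h2 : ∀ j, ∃ c : F, c • (u : Fin m → F) = (Matrix.of fun i j => A (i, j)).col j := by
      intro j
      obtain ⟨c, hc⟩ := hu ⟨_, Submodule.subset_span ⟨j, rfl⟩⟩
      exact ⟨c, congrArg Subtype.val hc⟩
    choose v hv using h2
    refine ⟨u, v, funext fun p => ?_⟩
    have := congrFun (hv p.2) p.1
    simp only [Pi.smul_apply, smul_eq_mul, Matrix.col_apply, Matrix.of_apply] at this
    rw [← this, mul_comm]
  · rintro ⟨u, v, rfl⟩
    exact Matrix.rank_vecMulVec_le u v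

/-- The coordinate ring contains the polynomial ring in the entries of the first row and column, and
embeds into a polynomial ring in as many variables by the parametrization `u vᵀ` with `v₀ = 1`. -/
theorem ringKrullDim_detVariety [Infinite F] (hm : 1 ≤ m) (hn : 1 ≤ n) :
    ringKrullDim (MvPolynomial (Fin m × Fin n) F ⧸ vanishingIdeal F (detVariety F m n)) =
      ((m + n - 1 : ℕ) : WithBot ℕ∞) := by
  obtain ⟨m, rfl⟩ := Nat.exists_eq_add_of_le' hm
  obtain ⟨n, rfl⟩ := Nat.exists_eq_add_of_le' hn
  set I := vanishingIdeal F (detVariety F (m + 1) (n + 1)) with hI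
  -- The matrices `u vᵀ` with `v₀ = 1` are dense in the determinantal variety.
  let φ : MvPolynomial (Fin (m + 1) × Fin (n + 1)) F →ₐ[F] MvPolynomial (Fin (m + 1) ⊕ Fin n) F :=
    aeval fun p => X (Sum.inl p.1) * Fin.cases 1 (fun j => X (Sum.inr j)) p.2
  have hφ : ∀ (f) (c : Fin (m + 1) ⊕ Fin n → F), eval c (φ f) = eval (fun p =>
      c (Sum.inl p.1) * Fin.cases (motive := fun _ => F) 1 (fun j => c (Sum.inr j)) p.2) f := by
    intro f c
    rw [eval_aeval]
    congr 2
    funext p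
    rcases p with ⟨i, j⟩
    refine Fin.cases ?_ (fun j => ?_) j <;> simp
  have hker : ∀ f, f ∈ I ↔ φ f = 0 := by
    intro f
    constructor
    · intro hf
      refine MvPolynomial.funext fun c => ?_
      rw [hφ, map_zero]
      exact hf _ (mem_detVariety_iff.mpr ⟨fun i => c (Sum.inl i),
        fun j => Fin.cases (motive := fun _ => F) 1 (fun j => c (Sum.inr j)) j, rfl⟩)
    · intro hf
      let ρ : MvPolynomial (Fin (m + 1) ⊕ Fin (n + 1)) F :=
        aeval (fun p : Fin (m + 1) × Fin (n + 1) => X (Sum.inl p.1) * X (Sum.inr p.2)) f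
      have hρ : ∀ c, eval c ρ = eval (fun p => c (Sum.inl p.1) * c (Sum.inr p.2)) f := by
        intro c
        rw [eval_aeval]
        simp
      -- Rescaling `u` and `v` reduces the points with `v₀ ≠ 0` to those with `v₀ = 1`.
      have hρ0 : ρ = 0 := by
        refine eq_zero_of_eval_eq_zero_of_ne_zero (Sum.inr 0) fun c hc => ?_
        have h1 := hφ f (Sum.elim (fun i => c (Sum.inl i) * c (Sum.inr 0))
          fun j => c (Sum.inr j.succ) / c (Sum.inr 0))
        rw [hf, map_zero] at h1
        rw [hρ, h1]
        congr 2
        funext p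
        rcases p with ⟨i, j⟩
        refine Fin.cases ?_ (fun j => ?_) j
        · simp
        · simp only [Sum.elim_inl, Fin.cases_succ, Sum.elim_inr]
          field_simp
      intro A hA
      obtain ⟨u, v, rfl⟩ := mem_detVariety_iff.mp hA
      have := hρ (Sum.elim u v)
      rw [hρ0, map_zero] at this
      exact this.symm
  let ψ : MvPolynomial (Fin (m + 1) ⊕ Fin n) F →ₐ[F] MvPolynomial (Fin (m + 1) × Fin (n + 1)) F :=
    aeval (Sum.elim (fun i => X (i, 0)) fun j => X (0, j.succ))
  have hψ : ∀ f, ψ f ∈ I → f = 0 := by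
    intro f hf
    -- A first row and a first column with nonzero common entry extend to a matrix `u vᵀ`.
    refine eq_zero_of_eval_eq_zero_of_ne_zero (Sum.inl 0) fun c hc => ?_
    have h1 : eval _ (ψ f) = 0 := hf _ (mem_detVariety_iff.mpr ⟨fun i => c (Sum.inl i),
      fun j => Fin.cases (motive := fun _ => F) 1 (fun j => c (Sum.inr j) / c (Sum.inl 0)) j, rfl⟩)
    rw [eval_aeval] at h1
    rw [← h1]
    congr 2
    funext s
    rcases s with i | j
    · simp
    · simp only [Sum.elim_inr, eval_X, Fin.cases_succ]
      field_simp
  have hcard : Nat.card (Fin (m + 1) ⊕ Fin n) = m + 1 + (n + 1) - 1 := by simp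
  rw [← hcard]
  refine ringKrullDim_eq_of_injective ((Ideal.Quotient.mkₐ F I).comp ψ) ?_
    (Ideal.Quotient.liftₐ I φ fun f hf => (hker f).mp hf) ?_
  · rw [injective_iff_map_eq_zero]
    intro f hf
    exact hψ f (Ideal.Quotient.eq_zero_iff_mem.mp hf)
  · rw [injective_iff_map_eq_zero]
    intro f hf
    obtain ⟨f, rfl⟩ := Ideal.Quotient.mk_surjective f
    exact Ideal.Quotient.eq_zero_iff_mem.mpr ((hker f).mpr hf)

lemma eval_pderiv_X {σ : Type*} [DecidableEq σ] (c : σ → F) (s t : σ) :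
    eval c (pderiv t (X s)) = if s = t then 1 else 0 := by
  rw [pderiv_X, Pi.single_apply]
  split_ifs <;> simp

/-- The tangent space at `u vᵀ` contains the velocities of the curves
`(u + s a) (v + s b)ᵀ`. -/
lemma mem_tangentSpace [Infinite F] (u a : Fin m → F) (v b : Fin n → F) :
    (fun p : Fin m × Fin n => a p.1 * v p.2 + u p.1 * b p.2) ∈
      tangentSpace (detVariety F m n) fun p => u p.1 * v p.2 := by
  intro f hf
  let γ : Fin m × Fin n → Polynomial F := fun p =>
    (Polynomial.C (u p.1) + Polynomial.X * Polynomial.C (a p.1)) *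
      (Polynomial.C (v p.2) + Polynomial.X * Polynomial.C (b p.2))
  have hchain : ∀ g : MvPolynomial (Fin m × Fin n) F,
      (Polynomial.derivative (aeval γ g)).eval 0 =
        ∑ p, eval (fun p => u p.1 * v p.2) (pderiv p g) * (a p.1 * v p.2 + u p.1 * b p.2) := by
    have hγ : ∀ g : MvPolynomial (Fin m × Fin n) F,
        (aeval γ g).eval 0 = eval (fun p => u p.1 * v p.2) g := by
      intro g
      have h : (Polynomial.evalRingHom 0).comp (aeval (R := F) γ).toRingHom =
          eval fun p => u p.1 * v p.2 := MvPolynomial.ringHom_ext (by simp) (by simp [γ])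
      exact DFunLike.congr_fun h g
    intro g
    induction g using MvPolynomial.induction_on with
    | C c => simp
    | add p q hp hq => simp [hp, hq, add_mul, Finset.sum_add_distrib]
    | mul_X p s hp =>
      classical
      rw [map_mul, Polynomial.derivative_mul, Polynomial.eval_add, Polynomial.eval_mul,
        Polynomial.eval_mul, hp, hγ, hγ]
      have hs : (Polynomial.derivative (aeval γ (X s : MvPolynomial (Fin m × Fin n) F))).eval 0 =
          a s.1 * v s.2 + u s.1 * b s.2 := by
        simp [γ]
      simp only [hs, pderiv_mul, map_add, map_mul, eval_X, eval_pderiv_X, add_mul _ _ (_ + _),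
        Finset.sum_add_distrib, mul_ite, mul_one, mul_zero, ite_mul, zero_mul, Finset.sum_ite_eq,
        Finset.mem_univ, if_true, Finset.sum_mul]
      congr 1
      exact Finset.sum_congr rfl fun x _ => by ring
  have h0 : aeval γ f = 0 := by
    refine Polynomial.funext fun s => ?_
    have h : (Polynomial.evalRingHom s).comp (aeval (R := F) γ).toRingHom =
        eval fun p => (u p.1 + s * a p.1) * (v p.2 + s * b p.2) :=
      MvPolynomial.ringHom_ext (by simp) (by simp [γ, mul_comm s])
    have h1 : (aeval γ f).eval s = _ := DFunLike.congr_fun h f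
    rw [h1, Polynomial.eval_zero]
    exact hf _ (mem_detVariety_iff.mpr
      ⟨fun i => u i + s * a i, fun j => v j + s * b j, rfl⟩)
  rw [← hchain, h0]
  simp

/-- At a nonzero matrix `u vᵀ` there are no other tangent vectors than these velocities: the
differentials of the minors that contain a fixed nonzero entry determine a tangent vector by its
entries in the row and in the column of that entry. -/
lemma exists_of_mem_tangentSpace {u : Fin m → F} {v : Fin n → F} (hu : u ≠ 0) (hv : v ≠ 0)
    {B : Fin m × Fin n → F}
    (hB : B ∈ tangentSpace (detVariety F m n) fun p => u p.1 * v p.2) :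
    ∃ (a : Fin m → F) (b : Fin n → F), B = fun p => a p.1 * v p.2 + u p.1 * b p.2 := by
  classical
  obtain ⟨k, hk⟩ := Function.ne_iff.mp hu
  obtain ⟨l, hl⟩ := Function.ne_iff.mp hv
  simp only [Pi.zero_apply] at hk hl
  refine ⟨fun i => B (i, l) / v l, fun j => B (k, j) / u k - v j * B (k, l) / (u k * v l),
    funext fun p => ?_⟩
  have h := hB (X p * X (k, l) - X (p.1, l) * X (k, p.2)) (by
    intro A hA
    obtain ⟨u', v', rfl⟩ := mem_detVariety_iff.mp hA
    simp
    ring)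
  simp only [pderiv_mul, map_add, map_sub, map_mul, eval_X, eval_pderiv_X, add_mul, sub_mul,
    Finset.sum_add_distrib, Finset.sum_sub_distrib, mul_ite, mul_one, mul_zero, ite_mul, one_mul,
    zero_mul, Finset.sum_ite_eq, Finset.mem_univ, if_true] at h
  field_simp
  linear_combination h

/-- The tangent space at a nonzero matrix of rank one has dimension `m + n - 1`: the pairs `(a, b)`
with `a vᵀ + u bᵀ = 0` are the multiples of `(u, -v)`. -/
lemma finrank_tangentSpace [Infinite F] {u : Fin m → F} {v : Fin n → F} (hu : u ≠ 0)
    (hv : v ≠ 0) :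
    Module.finrank F (tangentSpace (detVariety F m n) fun p => u p.1 * v p.2) = m + n - 1 := by
  let L : ((Fin m → F) × (Fin n → F)) →ₗ[F] (Fin m × Fin n → F) :=
    { toFun := fun c p => c.1 p.1 * v p.2 + u p.1 * c.2 p.2
      map_add' := fun c d => funext fun p => by simp; ring
      map_smul' := fun c d => funext fun p => by simp; ring }
  have hrange : tangentSpace (detVariety F m n) (fun p => u p.1 * v p.2) = L.range := by
    ext B
    constructor
    · intro hB
      obtain ⟨a, b, rfl⟩ := exists_of_mem_tangentSpace hu hv hB
      exact ⟨(a, b), rfl⟩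
    · rintro ⟨c, rfl⟩
      exact mem_tangentSpace u c.1 v c.2
  obtain ⟨k, hk⟩ := Function.ne_iff.mp hu
  obtain ⟨l, hl⟩ := Function.ne_iff.mp hv
  simp only [Pi.zero_apply] at hk hl
  have hker : L.ker = Submodule.span F {(u, -v)} := by
    ext c
    rw [LinearMap.mem_ker, Submodule.mem_span_singleton]
    constructor
    · intro h
      have h1 : ∀ i j, c.1 i * v j + u i * c.2 j = 0 := fun i j => congrFun h (i, j)
      refine ⟨c.1 k / u k, Prod.ext (funext fun i => ?_) (funext fun j => ?_)⟩
      · have h2 := h1 i l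
        have h3 := h1 k l
        simp
        field_simp
        exact mul_left_cancel₀ hl (by linear_combination u i * h3 - u k * h2)
      · have h2 := h1 k j
        simp
        field_simp
        linear_combination -h2
    · rintro ⟨t, rfl⟩
      funext p
      simp [L]
      ring
  have h := L.finrank_range_add_finrank_ker
  rw [hker, finrank_span_singleton (by simp [hu]), ← hrange] at h
  simp at h
  omega

theorem isNonsingularPoint_iff [Infinite F] (hm : 2 ≤ m) (hn : 2 ≤ n) {A : Fin m × Fin n → F} :
    IsNonsingularPoint (detVariety F m n) A ↔
      ∃ (u : Fin m → F) (v : Fin n → F), u ≠ 0 ∧ v ≠ 0 ∧ A = fun p => u p.1 * v p.2 := by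
  rw [IsNonsingularPoint, ringKrullDim_detVariety (by omega) (by omega)]
  constructor
  · rintro ⟨hA, hdim⟩
    obtain ⟨u, v, rfl⟩ := mem_detVariety_iff.mp hA
    have hne : (fun p : Fin m × Fin n => u p.1 * v p.2) ≠ 0 := by
      intro h0
      -- At the zero matrix all vectors are tangent.
      have htop : tangentSpace (detVariety F m n) (fun p => u p.1 * v p.2) = ⊤ := by
        classical
        rw [eq_top_iff]
        intro B _
        have h1 : B = ∑ q, B q • fun p : Fin m × Fin n =>
            (Pi.single q.1 1 : Fin m → F) p.1 * (Pi.single q.2 1 : Fin n → F) p.2 +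
              (0 : Fin m → F) p.1 * (0 : Fin n → F) p.2 := by
          funext p
          rw [Finset.sum_apply, Finset.sum_eq_single p]
          · simp
          · rintro ⟨q₁, q₂⟩ - hq
            by_cases h1 : p.1 = q₁
            · have h2 : p.2 ≠ q₂ := fun h2 => hq (Prod.ext h1.symm h2.symm)
              simp [h2]
            · simp [h1]
          · simp
        rw [h1]
        refine Submodule.sum_mem _ fun q _ => Submodule.smul_mem _ _ ?_
        have h2 := mem_tangentSpace (F := F) 0 (Pi.single q.1 1) (Pi.single q.2 1) 0
        convert! h2 using 2
        rw [h0]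
        funext p
        simp
      rw [htop, finrank_top] at hdim
      simp only [Module.finrank_fintype_fun_eq_card, Fintype.card_prod, Fintype.card_fin] at hdim
      have hdim' : m * n = m + n - 1 := by exact_mod_cast hdim
      obtain ⟨m, rfl⟩ := Nat.exists_eq_add_of_le' hm
      obtain ⟨n, rfl⟩ := Nat.exists_eq_add_of_le' hn
      have : (m + 2) * (n + 2) = m * n + 2 * m + 2 * n + 4 := by ring
      omega
    exact ⟨u, v, fun h => hne (by simp [h]; rfl), fun h => hne (by simp [h]; rfl), rfl⟩
  · rintro ⟨u, v, hu, hv, rfl⟩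
    exact ⟨mem_detVariety_iff.mpr ⟨u, v, rfl⟩, by rw [finrank_tangentSpace hu hv]⟩

/-- The ideal `J` consists of the polynomials which vanish at all pairs
`(u vᵀ, a vᵀ + u bᵀ)` with `u ≠ 0` and `v ≠ 0`. -/
theorem mem_principalIdeal_iff [Infinite F] (hm : 2 ≤ m) (hn : 2 ≤ n)
    {f : MvPolynomial (Var m n) F} : f ∈ principalIdeal F m n ↔
      ∀ (u a : Fin m → F) (v b : Fin n → F), u ≠ 0 → v ≠ 0 →
        eval (Sum.elim (fun p => u p.1 * v p.2) fun p => a p.1 * v p.2 + u p.1 * b p.2) f = 0 := by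
  have h1 : principalIdeal F m n = vanishingIdeal F (smoothTangents F m n) :=
    zeroLocus_vanishingIdeal_galoisConnection.u_l_u_eq_u (smoothTangents F m n)
  rw [h1]
  constructor
  · intro hf u a v b hu hv
    exact hf _ ⟨(isNonsingularPoint_iff hm hn).mpr ⟨u, v, hu, hv, rfl⟩, mem_tangentSpace u a v b⟩
  · rintro hf P ⟨hP, hB⟩
    obtain ⟨u, v, hu, hv, hA⟩ := (isNonsingularPoint_iff hm hn).mp hP
    rw [hA] at hB
    obtain ⟨a, b, hB⟩ := exists_of_mem_tangentSpace hu hv hB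
    have hP' : P = Sum.elim (fun p => u p.1 * v p.2) fun p => a p.1 * v p.2 + u p.1 * b p.2 := by
      rw [← hA, ← hB]
      funext s
      rcases s with s | s <;> rfl
    rw [hP']
    exact hf u a v b hu hv

end DetVariety

/-! ### Components of vanishing polynomials under one-parameter groups -/

section Torus

variable {F : Type*} [Field F] [Infinite F] {σ : Type*}

/-- If `f` vanishes along the orbit of a point under the one-parameter group with weights `w`, then
so do its weighted homogeneous components at the point. -/
lemma eval_weightedHomogeneousComponent_eq_zero (w : σ → ℕ) {f : MvPolynomial σ F} {c : σ → F}
    (h : ∀ t : F, t ≠ 0 → eval (fun s => t ^ w s * c s) f = 0) (k : ℕ) :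
    eval c (weightedHomogeneousComponent w k f) = 0 := by
  classical
  let γ : σ → Polynomial F := fun s => Polynomial.C (c s) * Polynomial.X ^ w s
  have hcoeff : (aeval γ f).coeff k = eval c (weightedHomogeneousComponent w k f) := by
    clear h
    induction f using MvPolynomial.induction_on' with
    | monomial a r =>
      have h1 : aeval γ (monomial a r) =
          Polynomial.C (eval c (monomial a r)) * Polynomial.X ^ Finsupp.weight w a := by
        rw [aeval_monomial, eval_monomial, Finsupp.weight_apply, Finsupp.prod, Finsupp.prod,
          Finsupp.sum, map_mul, map_prod, ← Finset.prod_pow_eq_pow_sum, mul_assoc,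
          ← Finset.prod_mul_distrib]
        congr 1
        refine Finset.prod_congr rfl fun s _ => ?_
        rw [mul_pow, ← pow_mul, map_pow, smul_eq_mul, mul_comm (a s)]
      rw [h1, Polynomial.coeff_C_mul_X_pow,
        weightedHomogeneousComponent_of_mem (isWeightedHomogeneous_monomial w a r rfl)]
      split_ifs <;> simp
    | add p q hp hq => simp [hp, hq]
  have h0 : Polynomial.X * aeval γ f = 0 := by
    refine Polynomial.funext fun t => ?_
    have h1 : (Polynomial.evalRingHom t).comp (aeval (R := F) γ).toRingHom =
        eval fun s => t ^ w s * c s :=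
      MvPolynomial.ringHom_ext (by simp) fun s => by simp [γ, mul_comm (c s)]
    have h2 : (aeval γ f).eval t = _ := DFunLike.congr_fun h1 f
    rw [Polynomial.eval_mul, Polynomial.eval_X, h2, Polynomial.eval_zero]
    by_cases ht : t = 0
    · rw [ht, zero_mul]
    · rw [h t ht, mul_zero]
  rw [← hcoeff, (mul_eq_zero.mp h0).resolve_left Polynomial.X_ne_zero, Polynomial.coeff_zero]

end Torus

/-! ### The ideal of the principal component -/

section Principal

variable {F : Type*} [Field F] {m n : ℕ}

/-- The ideal of the two by two minors of `(x)` and of their derivatives, the ideal of the full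
jet scheme. -/
def jetIdeal (F : Type*) [Field F] (m n : ℕ) : Ideal (MvPolynomial (Var m n) F) :=
  Ideal.span ({f | ∃ i k j l, f = X (Sum.inl (i, j)) * X (Sum.inl (k, l)) -
      X (Sum.inl (i, l)) * X (Sum.inl (k, j))} ∪
    {f | ∃ i k j l, f = X (Sum.inl (i, j)) * X (Sum.inr (k, l)) +
      X (Sum.inl (k, l)) * X (Sum.inr (i, j)) - X (Sum.inl (i, l)) * X (Sum.inr (k, j)) -
      X (Sum.inl (k, j)) * X (Sum.inr (i, l))})

/-- The variables whose row or column is that of `z`. -/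
def cross (z : Fin m × Fin n) : Set (Var m n) :=
  {s | ∃ p : Fin m × Fin n, (p.1 = z.1 ∨ p.2 = z.2) ∧ (s = Sum.inl p ∨ s = Sum.inr p)}

/-- Up to powers of `x_z`, the variables in the row and in the column of `z` generate the polynomial
ring modulo the ideal of the jet scheme. -/
lemma exists_pow_mul_sub_mem_jetIdeal (z : Fin m × Fin n) (f : MvPolynomial (Var m n) F) :
    ∃ k : ℕ, ∃ g ∈ supported F (cross z), X (Sum.inl z) ^ k * f - g ∈ jetIdeal F m n := by
  have hX : ∀ p : Fin m × Fin n, (p.1 = z.1 ∨ p.2 = z.2) →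
      (X (Sum.inl p) : MvPolynomial (Var m n) F) ∈ supported F (cross z) ∧
      (X (Sum.inr p) : MvPolynomial (Var m n) F) ∈ supported F (cross z) := fun p hp =>
    ⟨X_mem_supported.mpr ⟨p, hp, Or.inl rfl⟩, X_mem_supported.mpr ⟨p, hp, Or.inr rfl⟩⟩
  have hz := hX z (Or.inl rfl)
  induction f using MvPolynomial.induction_on with
  | C c => exact ⟨0, C c, Subalgebra.algebraMap_mem _ c, by simp⟩
  | add p q hp hq =>
    obtain ⟨k, g, hg, h⟩ := hp
    obtain ⟨l, g', hg', h'⟩ := hq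
    refine ⟨k + l, X (Sum.inl z) ^ l * g + X (Sum.inl z) ^ k * g',
      add_mem (mul_mem (pow_mem hz.1 _) hg) (mul_mem (pow_mem hz.1 _) hg'), ?_⟩
    convert! add_mem (Ideal.mul_mem_left _ (X (Sum.inl z) ^ l) h)
      (Ideal.mul_mem_left _ (X (Sum.inl z) ^ k) h') using 1
    ring
  | mul_X p s hp =>
    obtain ⟨k, g, hg, h⟩ := hp
    have hs : ∃ l : ℕ, ∃ g' ∈ supported F (cross z),
        X (Sum.inl z) ^ l * X s - g' ∈ jetIdeal F m n := by
      rcases z with ⟨i, j⟩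
      rcases s with ⟨k, l⟩ | ⟨k, l⟩
      · refine ⟨1, X (Sum.inl (i, l)) * X (Sum.inl (k, j)),
          mul_mem (hX (i, l) (Or.inl rfl)).1 (hX (k, j) (Or.inr rfl)).1, ?_⟩
        rw [pow_one]
        exact Ideal.subset_span (Or.inl ⟨i, k, j, l, rfl⟩)
      · refine ⟨2, X (Sum.inl (i, j)) * (X (Sum.inl (i, l)) * X (Sum.inr (k, j)) +
            X (Sum.inl (k, j)) * X (Sum.inr (i, l))) -
            X (Sum.inl (i, l)) * X (Sum.inl (k, j)) * X (Sum.inr (i, j)),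
          sub_mem (mul_mem hz.1 (add_mem
            (mul_mem (hX (i, l) (Or.inl rfl)).1 (hX (k, j) (Or.inr rfl)).2)
            (mul_mem (hX (k, j) (Or.inr rfl)).1 (hX (i, l) (Or.inl rfl)).2)))
            (mul_mem (mul_mem (hX (i, l) (Or.inl rfl)).1 (hX (k, j) (Or.inr rfl)).1) hz.2), ?_⟩
        have h1 : _ ∈ jetIdeal F m n := Ideal.subset_span (Or.inl ⟨i, k, j, l, rfl⟩)
        have h2 : _ ∈ jetIdeal F m n := Ideal.subset_span (Or.inr ⟨i, k, j, l, rfl⟩)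
        convert! sub_mem (Ideal.mul_mem_left _ (X (Sum.inl (i, j))) h2)
          (Ideal.mul_mem_left _ (X (Sum.inr (i, j))) h1) using 1
        ring
    obtain ⟨l, g', hg', h'⟩ := hs
    refine ⟨k + l, g * g', mul_mem hg hg', ?_⟩
    convert! add_mem (Ideal.mul_mem_left _ (X (Sum.inl z) ^ l * X s) h)
      (Ideal.mul_mem_left _ g h') using 1
    ring

variable [Infinite F]

lemma principalIdeal_containsMinors (hm : 2 ≤ m) (hn : 2 ≤ n) :
    ContainsMinors (principalIdeal F m n) 0 where
  xx i k j l := by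
    rw [mem_principalIdeal_iff hm hn]
    intro u a v b _ _
    simp only [map_sub, map_mul, eval_X, Sum.elim_inl]
    ring
  xy i k j l := by
    rw [mem_principalIdeal_iff hm hn]
    intro u a v b _ _
    simp only [map_sub, map_mul, map_add, map_zero, eval_X, Sum.elim_inl, Sum.elim_inr]
    ring
  yyy i k l a b c := by
    rw [mem_principalIdeal_iff hm hn]
    intro u a v b _ _
    simp only [detThree, map_sub, map_mul, map_add, eval_X, Sum.elim_inr]
    ring
  below i k l a b c := by
    rw [mem_principalIdeal_iff hm hn]
    intro u a v b _ _
    simp only [detThree, map_sub, map_mul, map_add, eval_X, Sum.elim_inl, Sum.elim_inr]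
    ring
  right i k l a b c := by
    rw [mem_principalIdeal_iff hm hn]
    intro u a v b _ _
    simp only [detThree, map_sub, map_mul, map_add, eval_X, Sum.elim_inl, Sum.elim_inr]
    ring

lemma homogeneousComponent_mem_principalIdeal (hm : 2 ≤ m) (hn : 2 ≤ n)
    {f : MvPolynomial (Var m n) F} (hf : f ∈ principalIdeal F m n) (k : ℕ) :
    homogeneousComponent k f ∈ principalIdeal F m n := by
  rw [mem_principalIdeal_iff hm hn] at hf ⊢
  intro u a v b hu hv
  refine eval_weightedHomogeneousComponent_eq_zero 1 (fun t ht => ?_) k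
  rw [← hf (t • u) (t • a) v b (smul_ne_zero ht hu) hv]
  congr 2
  funext s
  rcases s with s | s <;> simp <;> ring

lemma xComponent_mem_principalIdeal (hm : 2 ≤ m) (hn : 2 ≤ n)
    {f : MvPolynomial (Var m n) F} (hf : f ∈ principalIdeal F m n) (k : ℕ) :
    weightedHomogeneousComponent (xWeight 1) k f ∈ principalIdeal F m n := by
  rw [mem_principalIdeal_iff hm hn] at hf ⊢
  intro u a v b hu hv
  refine eval_weightedHomogeneousComponent_eq_zero _ (fun t ht => ?_) k
  rw [← hf (t • u) a v (t⁻¹ • b) (smul_ne_zero ht hu) hv]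
  congr 2
  funext s
  rcases s with s | s
  · simp [xWeight]
    ring
  · simp [xWeight]
    field_simp

lemma jetIdeal_le_principalIdeal (hm : 2 ≤ m) (hn : 2 ≤ n) :
    jetIdeal F m n ≤ principalIdeal F m n := by
  refine Ideal.span_le.mpr ?_
  rintro f (⟨i, k, j, l, rfl⟩ | ⟨i, k, j, l, rfl⟩)
  · exact (principalIdeal_containsMinors hm hn).xx i k j l
  · have := (principalIdeal_containsMinors (F := F) hm hn).xy i k j l
    rwa [map_zero, zero_mul, add_zero] at this

/-- The coordinates in the row and in the column of `z` take arbitrary values with `x_z ≠ 0` at the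
points `(u vᵀ, a vᵀ + u bᵀ)`. -/
lemma eq_zero_of_mem_supported_cross (hm : 2 ≤ m) (hn : 2 ≤ n) (z : Fin m × Fin n)
    {g : MvPolynomial (Var m n) F} (hg : g ∈ supported F (cross z))
    (hJ : g ∈ principalIdeal F m n) : g = 0 := by
  refine eq_zero_of_eval_eq_zero_of_ne_zero (Sum.inl z) fun c hc => ?_
  rcases z with ⟨i, j⟩
  have h := (mem_principalIdeal_iff hm hn).mp hJ (fun k => c (Sum.inl (k, j)))
    (fun k => c (Sum.inr (k, j))) (fun l => c (Sum.inl (i, l)) / c (Sum.inl (i, j)))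
    (fun l => (c (Sum.inr (i, l)) - c (Sum.inr (i, j)) * c (Sum.inl (i, l)) / c (Sum.inl (i, j))) /
      c (Sum.inl (i, j)))
    (Function.ne_iff.mpr ⟨i, hc⟩) (Function.ne_iff.mpr ⟨j, by simp [hc]⟩)
  rw [← h]
  refine eval₂Hom_congr' rfl (fun s hs _ => ?_) rfl
  obtain ⟨⟨k, l⟩, hp, hs⟩ := mem_supported.mp hg hs
  simp only at hp
  rcases hp with rfl | rfl <;> rcases hs with rfl | rfl
  all_goals
    simp only [Sum.elim_inl, Sum.elim_inr]
    field_simp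
    try ring

lemma exists_pow_mul_mem_jetIdeal (hm : 2 ≤ m) (hn : 2 ≤ n) (z : Fin m × Fin n)
    {f : MvPolynomial (Var m n) F} (hf : f ∈ principalIdeal F m n) :
    ∃ k : ℕ, X (Sum.inl z) ^ k * f ∈ jetIdeal F m n := by
  obtain ⟨k, g, hg, h⟩ := exists_pow_mul_sub_mem_jetIdeal z f
  have hgJ : g ∈ principalIdeal F m n := by
    convert! sub_mem (Ideal.mul_mem_left _ (X (Sum.inl z) ^ k) hf)
      (jetIdeal_le_principalIdeal hm hn h) using 1
    ring
  rw [eq_zero_of_mem_supported_cross hm hn z hg hgJ, sub_zero] at h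
  exact ⟨k, h⟩

end Principal

/-! ### Degeneration of the product of two Segre cones -/

section Degeneration

variable {F : Type*} [Field F] {m n : ℕ}

/-- The bigrading by the degree and by the degree in the `x`-variables. -/
def biWeight : Var m n → ℕ × ℕ := fun s => (1, xWeight 1 s)

lemma weight_biWeight (a : Var m n →₀ ℕ) :
    Finsupp.weight biWeight a = (a.degree, Finsupp.weight (xWeight 1) a) := by
  induction a using Finsupp.induction_linear with
  | zero => simp [Prod.zero_eq_mk]
  | add a b ha hb => simp [ha, hb]
  | single s k => simp [Finsupp.weight_single, biWeight]

/-- The bihomogeneous components of the elements of the ideal of the jet scheme are the parts of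
highest degree in `x` of elements of the ideal of the product of two Segre cones. -/
lemma exists_mem_segreIdeal {h : MvPolynomial (Var m n) F} (hh : h ∈ jetIdeal F m n) (N p : ℕ) :
    ∃ h' ∈ segreIdeal F m n,
      ∀ b ∈ (h' - weightedHomogeneousComponent biWeight (N, p) h).support,
        b.degree = N ∧ Finsupp.weight (xWeight 1) b < p := by
  classical
  have hadd : ∀ r s : MvPolynomial (Var m n) F,
      (∃ h' ∈ segreIdeal F m n,
        ∀ b ∈ (h' - weightedHomogeneousComponent biWeight (N, p) r).support,
          b.degree = N ∧ Finsupp.weight (xWeight 1) b < p) →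
      (∃ h' ∈ segreIdeal F m n,
        ∀ b ∈ (h' - weightedHomogeneousComponent biWeight (N, p) s).support,
          b.degree = N ∧ Finsupp.weight (xWeight 1) b < p) →
      ∃ h' ∈ segreIdeal F m n,
        ∀ b ∈ (h' - weightedHomogeneousComponent biWeight (N, p) (r + s)).support,
          b.degree = N ∧ Finsupp.weight (xWeight 1) b < p := by
    rintro r s ⟨r', hr', hr⟩ ⟨s', hs', hs⟩
    refine ⟨r' + s', add_mem hr' hs', fun b hb => ?_⟩
    rw [map_add, add_sub_add_comm] at hb
    rcases Finset.mem_union.mp (support_add hb) with hb | hb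
    exacts [hr b hb, hs b hb]
  -- A bihomogeneous generator lifts by adding a form `e` of smaller degree in `x`, and so do its
  -- multiples by a monomial.
  have hgen : ∀ (g e : MvPolynomial (Var m n) F) (q q' : ℕ × ℕ), g + e ∈ segreIdeal F m n →
      IsWeightedHomogeneous biWeight g q → IsWeightedHomogeneous biWeight e q' →
      q'.1 = q.1 → q'.2 < q.2 → ∀ r : MvPolynomial (Var m n) F, ∃ h' ∈ segreIdeal F m n,
        ∀ b ∈ (h' - weightedHomogeneousComponent biWeight (N, p) (r * g)).support,
          b.degree = N ∧ Finsupp.weight (xWeight 1) b < p := by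
    intro g e q q' hge hg he h1 h2 r
    induction r using MvPolynomial.induction_on' with
    | monomial a c =>
      have hga := (isWeightedHomogeneous_monomial biWeight a c rfl).mul hg
      have hea := (isWeightedHomogeneous_monomial biWeight a c rfl).mul he
      rw [weightedHomogeneousComponent_of_mem hga]
      split_ifs with hd
      · refine ⟨monomial a c * (g + e), Ideal.mul_mem_left _ _ hge, fun b hb => ?_⟩
        rw [mul_add, add_sub_cancel_left, mem_support_iff] at hb
        have hw := hea hb
        rw [weight_biWeight, weight_biWeight] at hw
        rw [weight_biWeight] at hd
        have hw1 := congrArg Prod.fst hw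
        have hw2 := congrArg Prod.snd hw
        have hd1 := congrArg Prod.fst hd
        have hd2 := congrArg Prod.snd hd
        simp only [Prod.fst_add, Prod.snd_add] at hw1 hw2 hd1 hd2
        omega
      · exact ⟨0, zero_mem _, by simp⟩
    | add r s hr hs =>
      rw [add_mul]
      exact hadd _ _ hr hs
  have hxx : ∀ u v : Fin m × Fin n, IsWeightedHomogeneous biWeight
      (X (Sum.inl u) * X (Sum.inl v) : MvPolynomial (Var m n) F) (2, 2) := fun u v =>
    (isWeightedHomogeneous_X F biWeight _).mul (isWeightedHomogeneous_X F biWeight _)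
  have hxy : ∀ u v : Fin m × Fin n, IsWeightedHomogeneous biWeight
      (X (Sum.inl u) * X (Sum.inr v) : MvPolynomial (Var m n) F) (2, 1) := fun u v =>
    (isWeightedHomogeneous_X F biWeight _).mul (isWeightedHomogeneous_X F biWeight _)
  have hyy : ∀ u v : Fin m × Fin n, IsWeightedHomogeneous biWeight
      (X (Sum.inr u) * X (Sum.inr v) : MvPolynomial (Var m n) F) (2, 0) := fun u v =>
    (isWeightedHomogeneous_X F biWeight _).mul (isWeightedHomogeneous_X F biWeight _)
  refine Submodule.closure_induction ⟨0, zero_mem _, by simp⟩ (fun r s _ _ => hadd r s) ?_ hh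
  rintro r g (⟨i, k, j, l, rfl⟩ | ⟨i, k, j, l, rfl⟩)
  · refine hgen _ 0 (2, 2) (2, 0) ?_ ((hxx _ _).sub (hxx _ _))
      (isWeightedHomogeneous_zero F biWeight _) rfl (by norm_num) r
    rw [add_zero]
    exact (segreIdeal_containsMinors F m n).xx i k j l
  · refine hgen _ (X (Sum.inr (i, j)) * X (Sum.inr (k, l)) -
      X (Sum.inr (i, l)) * X (Sum.inr (k, j))) (2, 1) (2, 0) ?_
      ((((hxy _ _).add (hxy _ _)).sub (hxy _ _)).sub (hxy _ _)) ((hyy _ _).sub (hyy _ _))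
      rfl (by norm_num) r
    have h1 := (segreIdeal_containsMinors F m n).xy i k j l
    rwa [map_one, one_mul] at h1

variable [Infinite F]

/-- A leading exponent of the ideal of the principal component with a standard support would yield
one of the ideal of the product of two Segre cones, which degenerates to the former ideal up to
powers of the last variable. -/
theorem not_isLead_principalIdeal (hm : 2 ≤ m) (hn : 2 ≤ n) {f : MvPolynomial (Var m n) F}
    (hf : f ∈ principalIdeal F m n) {a : Var m n →₀ ℕ} (ha : Standard a.support) :
    ¬ IsLead varPos (xWeight 0) f a := by
  classical
  intro hlead
  -- The bihomogeneous component of `f` that contains the leading monomial.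
  set N := a.degree with hN
  set p := Finsupp.weight (xWeight 1) a with hp
  set g := weightedHomogeneousComponent (xWeight 1) p (homogeneousComponent N f) with hg
  have hcoeff : ∀ b, coeff b g = if b.degree = N ∧ Finsupp.weight (xWeight 1) b = p then
      coeff b f else 0 := by
    intro b
    rw [hg, coeff_weightedHomogeneousComponent, coeff_homogeneousComponent]
    split_ifs <;> simp_all
  have hbi : IsWeightedHomogeneous biWeight g (N, p) := by
    intro b hb
    rw [hcoeff] at hb
    rw [weight_biWeight]
    by_cases h : b.degree = N ∧ Finsupp.weight (xWeight 1) b = p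
    · rw [h.1, h.2]
    · simp [h] at hb
  have hgJ : g ∈ principalIdeal F m n :=
    xComponent_mem_principalIdeal hm hn (homogeneousComponent_mem_principalIdeal hm hn hf N) p
  have hglead : IsLead varPos (xWeight 1) g a := by
    have h0 := hlead.1
    refine ⟨by rwa [mem_support_iff, hcoeff, if_pos ⟨rfl, rfl⟩, ← mem_support_iff],
      fun b hb hne => ?_⟩
    rw [mem_support_iff, hcoeff] at hb
    have hb' : b.degree = N ∧ Finsupp.weight (xWeight 1) b = p := by
      by_contra h
      simp [h] at hb
    rw [if_pos hb'] at hb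
    have h1 := grevlexLT_iff.mpr (hlead.2 b (mem_support_iff.mpr hb) hne)
    rcases h1 with h1 | ⟨-, h1⟩
    · exact absurd h1 (by omega)
    · exact Or.inr ⟨hb'.1, Or.inr ⟨hb'.2, h1⟩⟩
  let z : Fin m × Fin n := (⟨m - 1, by omega⟩, ⟨n - 1, by omega⟩)
  obtain ⟨k, hk⟩ := exists_pow_mul_mem_jetIdeal hm hn z hgJ
  have hpow : (X (Sum.inl z) ^ k : MvPolynomial (Var m n) F) =
      monomial (Finsupp.single (Sum.inl z) k) 1 := X_pow_eq_monomial
  rw [hpow] at hk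
  set e : Var m n →₀ ℕ := Finsupp.single (Sum.inl z) k with he
  obtain ⟨h', hh', hlow⟩ := exists_mem_segreIdeal hk (a + e).degree
    (Finsupp.weight (xWeight 1) (a + e))
  have hhom : IsWeightedHomogeneous biWeight (monomial e 1 * g)
      ((a + e).degree, Finsupp.weight (xWeight 1) (a + e)) := by
    have := (isWeightedHomogeneous_monomial biWeight e (1 : F) rfl).mul hbi
    rwa [weight_biWeight, Prod.mk_add_mk, hN, hp, ← map_add, ← map_add, add_comm e] at this
  rw [weightedHomogeneousComponent_of_mem hhom, if_pos rfl] at hlow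
  have hlead' : IsLead varPos (xWeight 1) h' (a + e) := by
    rw [← add_sub_cancel (monomial e 1 * g) h']
    exact (hglead.monomial_mul e).add_isBelow fun b hb =>
      Or.inr ⟨(hlow b hb).1, Or.inl (hlow b hb).2⟩
  refine not_isLead_of_standard F hm hn hh' ?_ hlead'
  refine (ha.insert_last (z := z) fun q => ⟨?_, ?_⟩).mono fun v hv => ?_
  · exact Fin.le_def.mpr (by have := q.1.isLt; simp only [z]; omega)
  · exact Fin.le_def.mpr (by have := q.2.isLt; simp only [z]; omega)
  · rcases Finset.mem_union.mp (Finsupp.support_add hv) with h | h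
    · exact Finset.mem_insert_of_mem h
    · exact Finset.mem_insert.mpr (Or.inl (Finset.mem_singleton.mp
        (Finsupp.support_single_subset h)))

/-- The leading exponents of the ideal of the principal component are those whose supports are not
standard. -/
theorem exists_isLead_principalIdeal_iff (hm : 2 ≤ m) (hn : 2 ≤ n) {a : Var m n →₀ ℕ} :
    (∃ f ∈ principalIdeal F m n, IsLead varPos (xWeight 0) f a) ↔ ¬ Standard a.support :=
  ⟨fun ⟨_, hf, hlead⟩ ha => not_isLead_principalIdeal hm hn hf ha hlead,
    (principalIdeal_containsMinors hm hn).exists_isLead (Or.inl rfl)⟩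

end Degeneration

/-! ### The initial complex and the Hilbert function of the principal component -/

section Conclusion

variable {F : Type*} [Field F] [Infinite F] {m n : ℕ}

lemma isFace_leadingIdeal_iff (hm : 2 ≤ m) (hn : 2 ≤ n) {S : Finset (Var m n)} :
    IsFace (leadingIdeal (principalIdeal F m n)) S ↔ Standard S := by
  classical
  have hspan : leadingIdeal (principalIdeal F m n) = Ideal.span
      ((fun a => monomial a (1 : F)) '' {a : Var m n →₀ ℕ | ¬ Standard a.support}) := by
    rw [leadingIdeal]
    congr 1
    ext g
    constructor
    · rintro ⟨f, hf, a, ha, rfl⟩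
      exact ⟨a, (exists_isLead_principalIdeal_iff hm hn).mp
        ⟨f, hf, isLeadingMonomial_iff.mp ha⟩, rfl⟩
    · rintro ⟨a, ha, rfl⟩
      obtain ⟨f, hf, hlead⟩ := (exists_isLead_principalIdeal_iff (F := F) hm hn).mpr ha
      exact ⟨f, hf, a, isLeadingMonomial_iff.mpr hlead, rfl⟩
  have hprod : (∏ v ∈ S, X v : MvPolynomial (Var m n) F) =
      monomial (∑ v ∈ S, Finsupp.single v 1) 1 := (monomial_sum_one S _).symm
  have hsupp : ∀ v, (∑ u ∈ S, Finsupp.single u 1 : Var m n →₀ ℕ) v = if v ∈ S then 1 else 0 := by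
    intro v
    simp [Finsupp.finsetSum_apply, Finsupp.single_apply]
  rw [IsFace, hspan, hprod, mem_ideal_span_monomial_image, support_monomial, if_neg one_ne_zero]
  simp only [Finset.mem_singleton, forall_eq]
  constructor
  · intro h
    by_contra hS
    refine h ⟨_, ?_, le_rfl⟩
    intro h'
    refine hS (h'.mono fun v hv => ?_)
    rw [Finsupp.mem_support_iff, hsupp, if_pos hv]
    exact one_ne_zero
  · rintro hS ⟨a, ha, hle⟩
    refine ha (hS.mono fun v hv => ?_)
    have h1 := hle v
    rw [hsupp] at h1
    rw [Finsupp.mem_support_iff] at hv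
    by_contra hvS
    rw [if_neg hvS] at h1
    omega

/-- The standard monomials of degree `N` form a basis of the forms of degree `N` modulo `J`. -/
lemma hilbertFunction_principalIdeal (hm : 2 ≤ m) (hn : 2 ≤ n) (N : ℕ) :
    hilbertFunction (principalIdeal F m n) N = (supportedExps (standardComplex m n) N).card := by
  have hker : ∀ f : MvPolynomial (Var m n) F,
      (Ideal.Quotient.mkₐ F (principalIdeal F m n)).toLinearMap f = 0 ↔
        f ∈ principalIdeal F m n := fun f => Ideal.Quotient.eq_zero_iff_mem
  refine le_antisymm
    (finrank_map_le_card (w := xWeight 0) varPos_injective _ N _ fun a ha haB => ?_)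
    (card_le_finrank_map_of_isLead (w := xWeight 0) varPos_injective _ N _
      (fun a ha => (mem_supportedExps.mp ha).1) fun a ha f hf => ?_)
  · have hns : ¬ Standard a.support := fun h =>
      haB (mem_supportedExps.mpr ⟨ha, mem_standardComplex.mpr h⟩)
    obtain ⟨f, hf, hlead⟩ := (exists_isLead_principalIdeal_iff (F := F) hm hn).mpr hns
    exact ⟨homogeneousComponent N f,
      (hker _).mpr (homogeneousComponent_mem_principalIdeal hm hn hf N),
      homogeneousComponent_isHomogeneous N f, hlead.homogeneousComponent ha⟩
  · exact not_isLead_principalIdeal hm hn ((hker f).mp hf)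
      (mem_standardComplex.mp (mem_supportedExps.mp ha).2)

theorem hasMultiplicity_principalIdeal (hm : 2 ≤ m) (hn : 2 ≤ n) :
    HasMultiplicity (principalIdeal F m n)
      (((m - 1 + (n - 1)).choose (m - 1) ^ 2 : ℕ) : ℚ) := by
  obtain ⟨Q, -, hQ, hcover, htop⟩ := exists_facets hm hn
  have hd : 2 * (m + n - 1) = (2 * (m + n - 1) - 1) + 1 := by omega
  refine ⟨fun f hf => homogeneousComponent_mem_principalIdeal hm hn hf,
    supportedPoly (standardComplex m n), ?_, Or.inl ?_⟩
  · filter_upwards [Filter.eventually_gt_atTop (Fintype.card (Var m n))] with N hN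
    rw [hilbertFunction_principalIdeal hm hn, eval_supportedPoly _ hN]
  · refine supportedPoly_multiplicity (k := 2 * (m + n - 1) - 1) (fun S hS => ?_)
      (by rw [← hd, htop]) (pow_ne_zero _ (Nat.choose_pos (by omega)).ne')
    obtain ⟨z, M, hM, hSM⟩ := hcover S (mem_standardComplex.mp hS)
    rw [← hd, ← (hQ z M hM).2.1]
    exact Finset.card_le_card hSM

theorem ncard_facets (hm : 2 ≤ m) (hn : 2 ≤ n) (z : Fin m × Fin n) :
    ({S : Finset (Var m n) | IsFacet (leadingIdeal (principalIdeal F m n)) S ∧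
      HasMu S z}.ncard : ℤ) = summand m n ((z.1 : ℕ) + 1) ((z.2 : ℕ) + 1) := by
  obtain ⟨Q, hQcard, hQ, hcover, -⟩ := exists_facets hm hn
  have hset : {S : Finset (Var m n) | IsFacet (leadingIdeal (principalIdeal F m n)) S ∧
      HasMu S z} = Q z := by
    ext S
    constructor
    · rintro ⟨hS, hmu⟩
      obtain ⟨z', M, hM, hSM⟩ := hcover S ((isFace_leadingIdeal_iff hm hn).mp hS.1)
      have hMS : M = S := le_antisymm
        (hS.2 ((isFace_leadingIdeal_iff hm hn).mpr (hQ z' M hM).1) hSM) hSM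
      subst hMS
      rwa [← (hQ z' M hM).2.2.unique hmu]
    · intro hS
      obtain ⟨hstd, hcard, hmu⟩ := hQ z S hS
      refine ⟨⟨(isFace_leadingIdeal_iff hm hn).mpr hstd, fun T hT hST => ?_⟩, hmu⟩
      obtain ⟨z', M, hM, hTM⟩ := hcover T ((isFace_leadingIdeal_iff hm hn).mp hT)
      have hSM : S = M := Finset.eq_of_subset_of_card_le (Finset.Subset.trans hST hTM)
        (by rw [hcard, (hQ z' M hM).2.1])
      rw [hSM]
      exact hTM
  rw [hset, Set.ncard_coe_finset, hQcard]

end Conclusion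

end JetDet

end

theorem mainTheorem5 (F : Type*) [Field F] [IsAlgClosed F] (m n : ℕ) (hm : 2 ≤ m) (hmn : m ≤ n) :
    JetDet.HasMultiplicity (JetDet.principalIdeal F m n)
      ((∑ q ∈ ((Finset.Icc 1 m) ×ˢ (Finset.Icc 1 n)).erase (m, n),
        JetDet.summand (m : ℤ) (n : ℤ) (q.1 : ℤ) (q.2 : ℤ) : ℤ) : ℚ) ∧
    ∀ (i : Fin m) (j : Fin n), ((i : ℕ) + 1, (j : ℕ) + 1) ≠ (m, n) →
      ({S : Finset (JetDet.Var m n) |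
          JetDet.IsFacet (JetDet.leadingIdeal (JetDet.principalIdeal F m n)) S ∧
          JetDet.HasMu S (i, j)}.ncard : ℤ) =
        JetDet.summand (m : ℤ) (n : ℤ) ((i : ℤ) + 1) ((j : ℤ) + 1) := by
  have hn : 2 ≤ n := hm.trans hmn
  refine ⟨?_, fun i j _ => JetDet.ncard_facets hm hn (i, j)⟩
  rw [JetDet.sum_summand m n hm hn]
  exact_mod_cast JetDet.hasMultiplicity_principalIdeal hm hn
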